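/- Let $n\ge 3$, let $M$ be a compact connected smooth $n$-manifold without boundary, and let $p>\frac n2$ be real. Let $\gamma\in M^p_2$, i.e. $\gamma$ is a (continuous) Riemannian metric on $M$ of Sobolev class $W^p_2$ (derivatives up to order two in $L^p$), with Laplace operator $\Delta_\gamma$ and scalar curvature $R(\gamma)$, and put $r=\frac{n-2}{4(n-1)}R(\gamma)$. Let $a,q_1,q_2,b\in L^1(M)$ satisfy, almost everywhere, $a\ge 0$, $q_1\ge 0$, $b-q_2\ge 0$, and suppose $a+q_1+b-q_2\not\equiv 0$, in the sense that there is a non-empty open subset of $M$ on which the essential infimum of $a+q_1+b-q_2$ is positive. Then the Lichnerowicz equation $$\Delta_\gamma\varphi = r\varphi - a\,\varphi^{-\frac{3n-2}{n-2}} - q_1\,\varphi^{-\frac{n}{n-2}} + (b-q_2)\,\varphi^{\frac{n+2}{n-2}}\quad\text{a.e. on } M$$ has at most one solution $\varphi\in W^p_2$ (identified with its continuous representative) with $\varphi>0$ everywhere on $M$. No condition is imposed on the sign of $r$ or on the Yamabe class of $\gamma$. -/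

import Mathlib

open MeasureTheory
open scoped Manifold ContDiff

noncomputable section

namespace Lichnerowicz

/-- The model space `ℝⁿ` with its Euclidean norm and Lebesgue measure. -/
abbrev Model (n : ℕ) : Type := EuclideanSpace ℝ (Fin n)

/-- The `i`-th standard basis vector of `ℝⁿ`. -/
def basisVec {n : ℕ} (i : Fin n) : Model n := EuclideanSpace.single i (1 : ℝ)

/-! ### Weak derivatives and local Sobolev spaces on a subset of `ℝⁿ` -/

/-- On the open set `Ω`, the locally integrable function `v` is the weak (distributional) partial
derivative of the locally integrable function `u` in the direction of the `i`-th coordinate. -/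
def IsWeakPartial {n : ℕ} (Ω : Set (Model n)) (i : Fin n) (u v : Model n → ℝ) : Prop :=
  LocallyIntegrableOn u Ω ∧ LocallyIntegrableOn v Ω ∧
    ∀ ψ : Model n → ℝ, ContDiff ℝ ∞ ψ → HasCompactSupport ψ → tsupport ψ ⊆ Ω →
      ∫ y, u y * fderiv ℝ ψ y (basisVec i) = -∫ y, v y * ψ y

open Classical in
/-- A chosen weak partial derivative of `u` on `Ω` (unique up to a null set of the open set `Ω`);
it is `0` if there is none. -/
def weakPartial {n : ℕ} (Ω : Set (Model n)) (i : Fin n) (u : Model n → ℝ) : Model n → ℝ :=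
  if h : ∃ v, IsWeakPartial Ω i u v then h.choose else 0

/-- `u ∈ L^p_loc(Ω)`: the function `u` is in `L^p` of every compact subset of `Ω`. -/
def MemLpLoc {n : ℕ} (p : ℝ) (Ω : Set (Model n)) (u : Model n → ℝ) : Prop :=
  ∀ K : Set (Model n), K ⊆ Ω → IsCompact K →
    MemLp u (ENNReal.ofReal p) (volume.restrict K)

/-- `u ∈ W^{2,p}_loc(Ω)`: the function `u` and its weak derivatives of order one and two exist
and are in `L^p_loc(Ω)`. -/
def MemW2pLoc {n : ℕ} (p : ℝ) (Ω : Set (Model n)) (u : Model n → ℝ) : Prop :=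
  MemLpLoc p Ω u ∧
    ∀ i : Fin n, ∃ v, IsWeakPartial Ω i u v ∧ MemLpLoc p Ω v ∧
      ∀ j : Fin n, ∃ w, IsWeakPartial Ω j v w ∧ MemLpLoc p Ω w

/-! ### Riemannian geometry of a metric with weak derivatives, in coordinates

Here `g y` is the matrix `(g_{ij}(y))` of the components of a metric at the point `y` of the
coordinate domain `Ω ⊆ ℝⁿ`; indices are raised with the inverse matrix `(g y)⁻¹`. -/

/-- The Christoffel symbol
`Γ^k_{ij} = ½ ∑ₗ g^{kl} (∂ᵢ g_{jl} + ∂ⱼ g_{il} - ∂ₗ g_{ij})`. -/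
def christoffel {n : ℕ} (Ω : Set (Model n)) (g : Model n → Matrix (Fin n) (Fin n) ℝ)
    (k i j : Fin n) (y : Model n) : ℝ :=
  (1 / 2 : ℝ) * ∑ l, (g y)⁻¹ k l *
    (weakPartial Ω i (fun z => g z j l) y + weakPartial Ω j (fun z => g z i l) y
      - weakPartial Ω l (fun z => g z i j) y)

/-- The weak second derivative `∂ₐ ∂_b g_{ij}` of a component of the metric. -/
def secondPartial {n : ℕ} (Ω : Set (Model n)) (g : Model n → Matrix (Fin n) (Fin n) ℝ)
    (a b i j : Fin n) : Model n → ℝ :=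
  weakPartial Ω a (weakPartial Ω b (fun z => g z i j))

/-- The component of the Riemann curvature tensor with all indices lowered,
`R_{iklm} = ½ (∂ₖ∂ₗ g_{im} + ∂ᵢ∂ₘ g_{kl} - ∂ₖ∂ₘ g_{il} - ∂ᵢ∂ₗ g_{km})`
`+ ∑ g_{ab} (Γ^a_{kl} Γ^b_{im} - Γ^a_{km} Γ^b_{il})`. -/
def riemann {n : ℕ} (Ω : Set (Model n)) (g : Model n → Matrix (Fin n) (Fin n) ℝ)
    (i k l m : Fin n) (y : Model n) : ℝ :=
  (1 / 2 : ℝ) * (secondPartial Ω g k l i m y + secondPartial Ω g i m k l y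
      - secondPartial Ω g k m i l y - secondPartial Ω g i l k m y)
    + ∑ a, ∑ b, g y a b *
        (christoffel Ω g a k l y * christoffel Ω g b i m y
          - christoffel Ω g a k m y * christoffel Ω g b i l y)

/-- The scalar curvature `R(g) = ∑ g^{il} g^{km} R_{iklm}` (positive on round spheres). -/
def scalarCurvature {n : ℕ} (Ω : Set (Model n)) (g : Model n → Matrix (Fin n) (Fin n) ℝ)
    (y : Model n) : ℝ :=
  ∑ i, ∑ k, ∑ l, ∑ m, (g y)⁻¹ i l * (g y)⁻¹ k m * riemann Ω g i k l m y

/-- The Laplace operator on functions `Δ_g u = ∑ g^{ij} (∂ᵢ∂ⱼ u - ∑ₖ Γ^k_{ij} ∂ₖ u)`. -/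
def laplacian {n : ℕ} (Ω : Set (Model n)) (g : Model n → Matrix (Fin n) (Fin n) ℝ)
    (u : Model n → ℝ) (y : Model n) : ℝ :=
  ∑ i, ∑ j, (g y)⁻¹ i j *
    (weakPartial Ω i (weakPartial Ω j u) y
      - ∑ k, christoffel Ω g k i j y * weakPartial Ω k u y)

/-! ### Function spaces on a compact manifold -/

section Manifold

variable {n : ℕ} {M : Type*} [TopologicalSpace M] [ChartedSpace (Model n) M]

variable (n) in
/-- The property `P` holds almost everywhere on the manifold `M`: its coordinate expression holds
at Lebesgue-almost every point of every chart. -/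
def AlmostEverywhere (P : M → Prop) : Prop :=
  ∀ χ ∈ atlas (Model n) M, ∀ᵐ y ∂(volume.restrict χ.target), P (χ.symm y)

variable (n) in
/-- `f ∈ L¹(M)` for a compact manifold `M`: the coordinate expression of `f` is integrable on
compact subsets of every chart. As `M` is compact, this is integrability for the volume
measure of any continuous Riemannian metric on `M`. -/
def MemL1 (f : M → ℝ) : Prop :=
  ∀ χ ∈ atlas (Model n) M, LocallyIntegrableOn (fun y => f (χ.symm y)) χ.target

variable (n) in
/-- `f ∈ W^p_2(M)` for a compact manifold `M`: the coordinate expression of `f` in every chart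
is in `W^{2,p}_loc`. As `M` is compact, this is the Sobolev space of any smooth Riemannian
metric on `M`. -/
def MemW2p (p : ℝ) (f : M → ℝ) : Prop :=
  ∀ χ ∈ atlas (Model n) M, MemW2pLoc p χ.target (fun y => f (χ.symm y))

variable (n) in
/-- A function `f ≥ 0`, defined almost everywhere on `M`, is `≢ 0` if its (essential) infimum on
some non-empty open set is positive. -/
def NotIdenticallyZero (f : M → ℝ) : Prop :=
  ∃ U : Set M, IsOpen U ∧ U.Nonempty ∧
    ∃ c : ℝ, 0 < c ∧ AlmostEverywhere n (fun x => x ∈ U → c ≤ f x)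

variable [IsManifold (𝓡 n) ∞ M]

variable (n M) in
/-- Continuous Riemannian metrics on the manifold `M`. -/
abbrev ContMetric : Type _ :=
  Bundle.ContinuousRiemannianMetric (Model n) (fun x : M => TangentSpace (𝓡 n) x)

/-- The matrix of components `γ_{ij} = γ(∂ᵢ, ∂ⱼ)` of the metric `γ` in the chart `χ`, as a
function on the coordinate domain; `∂ᵢ` is the `i`-th coordinate vector field. -/
def components (γ : ContMetric n M) (χ : OpenPartialHomeomorph M (Model n)) (y : Model n) :
    Matrix (Fin n) (Fin n) ℝ :=
  Matrix.of fun i j => γ.inner (χ.symm y)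
    (mfderiv (𝓡 n) (𝓡 n) χ.symm y (basisVec i)) (mfderiv (𝓡 n) (𝓡 n) χ.symm y (basisVec j))

/-- `γ ∈ M^p_2`: the Riemannian metric `γ` (continuous, since it is considered for `p > n/2`
only) is of class `W^p_2`. -/
def MetricMemW2p (p : ℝ) (γ : ContMetric n M) : Prop :=
  ∀ χ ∈ atlas (Model n) M, ∀ i j : Fin n,
    MemW2pLoc p χ.target (fun y => components γ χ y i j)

/-! ### The Lichnerowicz equation -/

/-- The nonlinearity
`r t - a t^{-(3n-2)/(n-2)} - q₁ t^{-n/(n-2)} + (b - q₂) t^{(n+2)/(n-2)}`. -/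
def nonlinearity (n : ℕ) (r a q₁ q₂ b t : ℝ) : ℝ :=
  r * t - a * t ^ (-((3 * (n : ℝ) - 2) / ((n : ℝ) - 2)))
    - q₁ * t ^ (-((n : ℝ) / ((n : ℝ) - 2)))
    + (b - q₂) * t ^ (((n : ℝ) + 2) / ((n : ℝ) - 2))

/-- The function `φ` satisfies, almost everywhere, the Lichnerowicz equation
`Δ_γ φ = r φ - a φ^{-(3n-2)/(n-2)} - q₁ φ^{-n/(n-2)} + (b - q₂) φ^{(n+2)/(n-2)}`
with `r = (n-2) / (4(n-1)) R(γ)`. -/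
def SolvesLichnerowicz (γ : ContMetric n M) (a q₁ q₂ b φ : M → ℝ) : Prop :=
  ∀ χ ∈ atlas (Model n) M, ∀ᵐ y ∂(volume.restrict χ.target),
    laplacian χ.target (components γ χ) (fun z => φ (χ.symm z)) y =
      nonlinearity n
        (((n : ℝ) - 2) / (4 * ((n : ℝ) - 1)) * scalarCurvature χ.target (components γ χ) y)
        (a (χ.symm y)) (q₁ (χ.symm y)) (q₂ (χ.symm y)) (b (χ.symm y)) (φ (χ.symm y))

/-- `φ` is a positive solution of class `W^p_2` of the Lichnerowicz equation. For `p > n/2` the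
elements of `W^p_2` are continuous; `φ` denotes the continuous representative. -/
structure IsPositiveSolution (p : ℝ) (γ : ContMetric n M) (a q₁ q₂ b φ : M → ℝ) : Prop where
  continuous : Continuous φ
  memW2p : MemW2p n p φ
  pos : ∀ x, 0 < φ x
  solves : SolvesLichnerowicz γ a q₁ q₂ b φ

end Manifold

end Lichnerowicz

end

/-! For two positive solutions put `ζ = log φ₁ - log φ₂` and write the equation as `Δφ = F(x, φ)`.
Since `φ₂∇φ₁ - φ₁∇φ₂ = φ₁φ₂∇ζ`, the divergence of `φ₁φ₂∇ζ` is `φ₂Δφ₁ - φ₁Δφ₂`. Testing this with `ζ`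
on a closed manifold gives `∫ ζ (φ₂F(φ₁) - φ₁F(φ₂)) + φ₁φ₂|∇ζ|² = 0`. The linear term `rφ` drops out
of the cross difference, so the curvature plays no role. What remains is `φ₁φ₂` times an increment
of `F(t)/t - r`, which is nondecreasing in `t` because `a`, `q₁`, `b - q₂` are nonnegative and
multiply, up to the right sign, powers of the right monotonicity (`log_mul_nonlinearity`). Both
summands are thus nonnegative and vanish almost everywhere. Then `ζ` is constant by connectedness,
and it is zero because the monotonicity is strict where `a + q₁ + b - q₂ > 0`.

The analytic difficulty is to integrate by parts with a metric and functions that are only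
continuous with two weak derivatives. Interpolation does it: `∫ |∂d|² = -∫ d ∂²d ≤ sup|d| · ‖∂²d‖₁`,
so mollifications of a continuous function with locally integrable second derivatives have gradients
converging locally in `L²` (`lpConv_two_fderiv_mollify`). The class `Approx` of uniform limits with
`L²`-convergent gradients is stable under products, `C¹` functions and changes of coordinates. It
therefore contains `√(det g) g⁻¹` and `ζ`, and its members may be multiplied with second weak
derivatives in the limit (`Approx.integral_mul_weakPartial`). With the identity `∂ᵢ(√g g^{ij}) = -√g
g^{kl}Γ^j_{kl}` (`IsMetricField.sum_dDensInv`) this yields Green's identity in a chart.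

No measure on the manifold is needed. A partition of unity `ρ_k` splits the integral into chart
integrals, each equal to minus the flux of `φ₁φ₂ζ∇ζ` through `∇ρ_k`. The flux is a density, hence
independent of the chart up to the Jacobian, and the fluxes cancel because `∑ ∇ρ_k = 0`
(`sum_setIntegral_chartFlux`). -/

noncomputable section

namespace Lichnerowicz

open Filter Topology Metric Set
open scoped Pointwise ENNReal

variable {n : ℕ}

/-! ### Mollification -/

/-- A sequence of bump functions with radii tending to `0`. -/
def bump (n m : ℕ) : ContDiffBump (0 : Model n) where
  rIn := 1 / (m + 2)
  rOut := 1 / (m + 1)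
  rIn_pos := by positivity
  rIn_lt_rOut := by
    apply one_div_lt_one_div_of_lt
    · positivity
    · linarith

/-- The standard mollifier. -/
def mollifier (n m : ℕ) : Model n → ℝ := (bump n m).normed volume

/-- The mollification of a function. -/
def mollify (m : ℕ) (f : Model n → ℝ) : Model n → ℝ :=
  convolution (mollifier n m) f (ContinuousLinearMap.lsmul ℝ ℝ) volume

theorem tendsto_bump_rOut : Tendsto (fun m => (bump n m).rOut) atTop (𝓝 0) :=
  tendsto_one_div_add_atTop_nhds_zero_nat

theorem mollifier_nonneg (m : ℕ) (x : Model n) : 0 ≤ mollifier n m x :=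
  (bump n m).nonneg_normed x

theorem contDiff_mollifier (m : ℕ) : ContDiff ℝ ∞ (mollifier n m) :=
  (bump n m).contDiff_normed

theorem hasCompactSupport_mollifier (m : ℕ) : HasCompactSupport (mollifier n m) :=
  (bump n m).hasCompactSupport_normed

theorem tsupport_mollifier (m : ℕ) :
    tsupport (mollifier n m) = closedBall 0 (bump n m).rOut :=
  (bump n m).tsupport_normed_eq

theorem integrable_mollifier (m : ℕ) : Integrable (mollifier n m) :=
  (bump n m).integrable_normed

theorem contDiff_mollify (m : ℕ) {f : Model n → ℝ} (hf : LocallyIntegrable f) :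
    ContDiff ℝ ∞ (mollify m f) :=
  (hasCompactSupport_mollifier m).contDiff_convolution_left _ (contDiff_mollifier m) hf

theorem mollify_apply (m : ℕ) (f : Model n → ℝ) (x : Model n) :
    mollify m f x = ∫ t, mollifier n m (x - t) * f t := by
  rw [mollify, convolution_lsmul_swap]
  simp

/-- The derivative of a convolution may be put on the kernel, and `t ↦ mollifier n m (x - t)` is an
admissible test function on `Ω` because its support lies in the closed ball around `x`. The sign
from reflecting the kernel cancels the sign in the definition of the weak derivative. -/
theorem fderiv_mollify (m : ℕ) {Ω : Set (Model n)} {f v : Model n → ℝ} {i : Fin n}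
    (hf : LocallyIntegrable f) (hv : IsWeakPartial Ω i f v) {x : Model n}
    (hx : closedBall x (bump n m).rOut ⊆ Ω) :
    fderiv ℝ (mollify m f) x (basisVec i) = mollify m v x := by
  have h1 := ((hasCompactSupport_mollifier m).hasFDerivAt_convolution_left
    (ContinuousLinearMap.lsmul ℝ ℝ) ((contDiff_mollifier m).of_le (by simp)) hf x).fderiv
  have hint : ConvolutionExistsAt (fderiv ℝ (mollifier n m)) f x
      ((ContinuousLinearMap.lsmul ℝ ℝ).precompL (Model n)) volume :=
    HasCompactSupport.convolutionExists_left _ ((hasCompactSupport_mollifier m).fderiv ℝ)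
      ((contDiff_mollifier m).continuous_fderiv (by simp)) hf x
  rw [mollify, h1, convolution_eq_swap, ContinuousLinearMap.integral_apply, mollify_apply]
  · set ψ : Model n → ℝ := fun t => mollifier n m (x - t) with hψ
    have hψd : ContDiff ℝ ∞ ψ := (contDiff_mollifier m).comp (contDiff_const.sub contDiff_id)
    have hψs : tsupport ψ ⊆ closedBall x (bump n m).rOut := by
      apply closure_minimal _ isClosed_closedBall
      intro t ht
      have : x - t ∈ tsupport (mollifier n m) := subset_tsupport _ ht
      rw [tsupport_mollifier, mem_closedBall, dist_zero_right] at this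
      rwa [mem_closedBall, dist_comm, dist_eq_norm]
    have hψc : HasCompactSupport ψ :=
      (isCompact_closedBall x (bump n m).rOut).of_isClosed_subset (isClosed_tsupport _) hψs
    have := hv.2.2 ψ hψd hψc (hψs.trans hx)
    have hd : ∀ y, fderiv ℝ ψ y (basisVec i) =
        - fderiv ℝ (mollifier n m) (x - y) (basisVec i) := by
      intro y
      have h2 : HasFDerivAt (fun t : Model n => x - t) (-ContinuousLinearMap.id ℝ (Model n)) y := by
        simpa using (hasFDerivAt_id y).const_sub x
      have h3 : HasFDerivAt (mollifier n m) (fderiv ℝ (mollifier n m) (x - y)) (x - y) :=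
        ((contDiff_mollifier m).differentiable (by simp) _).hasFDerivAt
      have := (h3.comp y h2).fderiv
      have e : ψ = mollifier n m ∘ fun t => x - t := rfl
      rw [e, this]; simp
    simp only [hd] at this
    have h4 : ∫ t, v t * ψ t = ∫ t, mollifier n m (x - t) * v t := by
      congr 1; ext t; simp [hψ, mul_comm]
    rw [← h4]
    have h5 : ∫ t, f t * -(fderiv ℝ (mollifier n m) (x - t)) (basisVec i)
        = - ∫ t, f t * (fderiv ℝ (mollifier n m) (x - t)) (basisVec i) := by
      rw [← integral_neg]; congr 1; ext t; ring
    rw [h5, neg_inj] at this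
    rw [← this]
    congr 1; ext t
    simp [ContinuousLinearMap.precompL_apply, mul_comm]
  · have := hint.integrable_swap
    exact this

theorem tendstoUniformly_mollify {f : Model n → ℝ} (hf : UniformContinuous f) :
    TendstoUniformly (fun m => mollify m f) f atTop := by
  rw [Metric.tendstoUniformly_iff]
  intro ε hε
  obtain ⟨δ, hδ, h⟩ := Metric.uniformContinuous_iff.1 hf (ε / 2) (half_pos hε)
  filter_upwards [tendsto_bump_rOut.eventually (gt_mem_nhds hδ)] with m hm x
  rw [dist_comm]
  refine lt_of_le_of_lt ?_ (half_lt_self hε)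
  apply (bump n m).dist_normed_convolution_le hf.continuous.aestronglyMeasurable
  intro y hy
  exact (h ((mem_ball.1 hy).trans hm)).le

theorem integrable_mollify (m : ℕ) {f : Model n → ℝ} (hf : Integrable f) :
    Integrable (mollify m f) :=
  (integrable_mollifier m).integrable_convolution _ hf

/-- The kernel is nonnegative with total mass one, so `|f|` dominates after convolution and keeps
its integral. -/
theorem integral_abs_mollify_le (m : ℕ) {f : Model n → ℝ} (hf : Integrable f) :
    ∫ x, |mollify m f x| ≤ ∫ x, |f x| := by
  have h1 : ∫ x, mollify m (fun y => |f y|) x = ∫ x, |f x| := by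
    rw [mollify, integral_convolution _ (integrable_mollifier m) hf.abs]
    have : ∫ x, mollifier n m x = 1 := (bump n m).integral_normed
    simp [this]
  rw [← h1]
  apply integral_mono (integrable_mollify m hf).abs (integrable_mollify m hf.abs)
  intro x
  simp only [mollify_apply]
  refine (abs_integral_le_integral_abs).trans_eq ?_
  congr 1; ext t
  rw [abs_mul, abs_of_nonneg (mollifier_nonneg m _)]

theorem mollify_sub (m : ℕ) {f g : Model n → ℝ} (hf : LocallyIntegrable f)
    (hg : LocallyIntegrable g) : mollify m (f - g) = mollify m f - mollify m g := by
  have e : ∀ {h : Model n → ℝ}, LocallyIntegrable h → ConvolutionExists (mollifier n m) h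
      (ContinuousLinearMap.lsmul ℝ ℝ) volume := fun hh =>
    (hasCompactSupport_mollifier m).convolutionExists_left _ (contDiff_mollifier m).continuous hh
  have hn : mollify m (-g) = - mollify m g := by
    ext x; simp [mollify_apply, integral_neg]
  rw [sub_eq_add_neg, sub_eq_add_neg, ← hn]
  exact (e hf).distrib_add (e hg.neg)

theorem hasCompactSupport_mollify (m : ℕ) {f : Model n → ℝ} (hf : HasCompactSupport f) :
    HasCompactSupport (mollify m f) :=
  (hasCompactSupport_mollifier m).convolution _ hf

theorem bump_rOut_le_one (m : ℕ) : (bump n m).rOut ≤ 1 := by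
  have : (bump n m).rOut = 1 / ((m : ℝ) + 1) := rfl
  rw [this, div_le_one (by positivity)]
  linarith [Nat.cast_nonneg (α := ℝ) m]

theorem support_mollify_subset (m : ℕ) (f : Model n → ℝ) :
    Function.support (mollify m f) ⊆ Function.support (mollifier n m) + Function.support f := by
  unfold mollify
  apply support_convolution_subset

theorem tsupport_mollify_subset (m : ℕ) (f : Model n → ℝ) :
    tsupport (mollify m f) ⊆ cthickening 1 (tsupport f) := by
  apply closure_minimal _ isClosed_cthickening
  intro x hx
  obtain ⟨a, ha, b, hb, hab⟩ := support_mollify_subset m f hx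
  have ha' : a ∈ tsupport (mollifier n m) := subset_tsupport _ ha
  rw [tsupport_mollifier, mem_closedBall, dist_zero_right] at ha'
  refine mem_cthickening_of_dist_le x b 1 _ (subset_tsupport _ hb) ?_
  have h1 : x - b = a := by rw [← hab]; simp
  rw [dist_eq_norm, h1]
  exact ha'.trans (bump_rOut_le_one m)

theorem tendsto_integral_abs_mollify_sub_of_continuous {g : Model n → ℝ} (hg : Continuous g)
    (hgc : HasCompactSupport g) :
    Tendsto (fun m => ∫ x, |mollify m g x - g x|) atTop (𝓝 0) := by
  set K := cthickening 1 (tsupport g) with hK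
  have hKc : IsCompact K := IsCompact.cthickening hgc
  have hu := tendstoUniformly_mollify (hgc.uniformContinuous_of_continuous hg)
  rw [Metric.tendsto_atTop]
  intro ε hε
  -- The summand one avoids dividing by zero when `K` is a null set.
  have hpos : (0 : ℝ) < (volume.real K + 1) := by positivity
  have h2 := (Metric.tendstoUniformly_iff.1 hu) (ε / (2 * (volume.real K + 1))) (by positivity)
  obtain ⟨N, hN⟩ := eventually_atTop.1 h2
  refine ⟨N, fun m hm => ?_⟩
  rw [Real.dist_0_eq_abs, abs_of_nonneg (integral_nonneg fun _ => abs_nonneg _)]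
  have h3 : ∫ x, |mollify m g x - g x| = ∫ x in K, |mollify m g x - g x| := by
    rw [setIntegral_eq_integral_of_forall_compl_eq_zero]
    intro x hx
    have a1 : g x = 0 := by
      by_contra h
      exact hx (self_subset_cthickening _ (subset_tsupport _ h))
    have a2 : mollify m g x = 0 := by
      by_contra h
      exact hx (tsupport_mollify_subset m g (subset_tsupport _ h))
    simp [a1, a2]
  rw [h3]
  have h4 := norm_setIntegral_le_of_norm_le_const (μ := volume) (s := K)
    (f := fun x => |mollify m g x - g x|) (C := ε / (2 * (volume.real K + 1)))
    hKc.measure_lt_top (fun x _ => by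
      rw [Real.norm_eq_abs, abs_abs, ← Real.dist_eq, dist_comm]
      exact (hN m hm x).le)
  refine (le_abs_self _).trans_lt (h4.trans_lt ?_)
  rw [div_mul_eq_mul_div, div_lt_iff₀ (by positivity)]
  nlinarith [measureReal_nonneg (μ := volume) (s := K)]

theorem tendsto_integral_abs_mollify_sub {f : Model n → ℝ} (hf : Integrable f) :
    Tendsto (fun m => ∫ x, |mollify m f x - f x|) atTop (𝓝 0) := by
  rw [Metric.tendsto_atTop]
  intro ε hε
  -- Three errors of size `ε / 4` arise: the distance from `f` to `g`, that of their mollifications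
  -- (by the `L¹` contraction), and the mollification error of `g`.
  obtain ⟨g, hgc, hfg, hg, hgi⟩ := hf.exists_hasCompactSupport_integral_sub_le
    (ε := ε / 4) (by positivity)
  obtain ⟨N, hN⟩ := Metric.tendsto_atTop.1
    (tendsto_integral_abs_mollify_sub_of_continuous hg hgc) (ε / 4) (by positivity)
  refine ⟨N, fun m hm => ?_⟩
  have h1 := hN m hm
  rw [Real.dist_0_eq_abs, abs_of_nonneg (integral_nonneg fun _ => abs_nonneg _)] at h1 ⊢
  have h2 := integral_abs_mollify_le m (hf.sub hgi)
  have h3 : ∀ x, |mollify m f x - f x| ≤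
      |mollify m (f - g) x| + |mollify m g x - g x| + |f x - g x| := by
    intro x
    rw [mollify_sub m hf.locallyIntegrable hgi.locallyIntegrable]
    have : mollify m f x - f x = (mollify m f - mollify m g) x + (mollify m g x - g x)
      - (f x - g x) := by simp
    rw [this]
    exact (abs_sub _ _).trans (add_le_add_left (abs_add_le _ _) _)
  have i1 := (integrable_mollify m (hf.sub hgi)).abs
  have i2 := ((integrable_mollify m hgi).sub hgi).abs
  have i3 := (hf.sub hgi).abs
  have h4 := integral_mono ((integrable_mollify m hf).sub hf).abs ((i1.add i2).add i3) h3
  have h5 : ∫ x, ((fun x => |mollify m (f - g) x|) + (fun x => |(mollify m g - g) x|)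
      + fun x => |(f - g) x|) x = (∫ x, |mollify m (f - g) x|) + (∫ x, |(mollify m g - g) x|)
      + ∫ x, |(f - g) x| := by
    rw [integral_add' (i1.add i2) i3, integral_add' i1 i2]
  rw [h5] at h4
  simp only [Pi.sub_apply] at *
  simp only [Real.norm_eq_abs] at hfg
  linarith

/-! ### Weak derivatives -/

theorem integrable_mul_of_tsupport_subset {Ω : Set (Model n)} {f η : Model n → ℝ}
    (hf : LocallyIntegrableOn f Ω) (hη : Continuous η) (hηc : HasCompactSupport η)
    (hηΩ : tsupport η ⊆ Ω) : Integrable (fun y => f y * η y) := by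
  have h1 : IntegrableOn f (tsupport η) := hf.integrableOn_compact_subset hηΩ hηc
  have h2 : IntegrableOn (fun y => f y * η y) (tsupport η) :=
    h1.mul_continuousOn hη.continuousOn hηc
  rwa [integrableOn_iff_integrable_of_support_subset] at h2
  intro y hy
  by_contra h
  exact hy (by simp [image_eq_zero_of_notMem_tsupport h])

theorem tsupport_fderiv_apply_subset (ψ : Model n → ℝ) (e : Model n) :
    tsupport (fun y => fderiv ℝ ψ y e) ⊆ tsupport ψ := by
  refine (closure_mono ?_).trans (tsupport_fderiv_subset ℝ (f := ψ))
  intro y hy h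
  exact hy (by simp [h])

theorem hasCompactSupport_fderiv_apply {ψ : Model n → ℝ} (hψ : HasCompactSupport ψ)
    (e : Model n) : HasCompactSupport (fun y => fderiv ℝ ψ y e) :=
  IsCompact.of_isClosed_subset hψ (isClosed_tsupport _) (tsupport_fderiv_apply_subset ψ e)

theorem contDiff_fderiv_apply {ψ : Model n → ℝ} (hψ : ContDiff ℝ ∞ ψ) (e : Model n) :
    ContDiff ℝ ∞ (fun y => fderiv ℝ ψ y e) :=
  (hψ.fderiv_right (by simp)).clm_apply contDiff_const

theorem fderiv_mul_apply {f g : Model n → ℝ} {y : Model n} (hf : DifferentiableAt ℝ f y)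
    (hg : DifferentiableAt ℝ g y) (e : Model n) :
    fderiv ℝ (fun z => f z * g z) y e = f y * fderiv ℝ g y e + g y * fderiv ℝ f y e := by
  rw [fderiv_fun_mul hf hg]; simp

theorem IsWeakPartial.add {Ω : Set (Model n)} {i : Fin n} {u v u' v' : Model n → ℝ}
    (h : IsWeakPartial Ω i u v) (h' : IsWeakPartial Ω i u' v') :
    IsWeakPartial Ω i (fun y => u y + u' y) (fun y => v y + v' y) := by
  refine ⟨h.1.add h'.1, h.2.1.add h'.2.1, fun ψ hψ hc hs => ?_⟩
  have hdc := (contDiff_fderiv_apply hψ (basisVec i)).continuous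
  have hdcs := hasCompactSupport_fderiv_apply hc (basisVec i)
  have hds := (tsupport_fderiv_apply_subset ψ (basisVec i)).trans hs
  simp only [add_mul]
  rw [integral_add (integrable_mul_of_tsupport_subset h.1 hdc hdcs hds)
    (integrable_mul_of_tsupport_subset h'.1 hdc hdcs hds),
    integral_add (integrable_mul_of_tsupport_subset h.2.1 hψ.continuous hc hs)
    (integrable_mul_of_tsupport_subset h'.2.1 hψ.continuous hc hs), h.2.2 ψ hψ hc hs,
    h'.2.2 ψ hψ hc hs]
  ring

theorem integral_mul_congr_of_tsupport_subset {Ω : Set (Model n)} (hΩ : IsOpen Ω)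
    {f g η : Model n → ℝ} (h : f =ᵐ[volume.restrict Ω] g) (hη : tsupport η ⊆ Ω) :
    ∫ y, f y * η y = ∫ y, g y * η y := by
  apply integral_congr_ae
  filter_upwards [(ae_restrict_iff' hΩ.measurableSet).1 h] with y hy
  by_cases hyΩ : y ∈ Ω
  · rw [hy hyΩ]
  · simp [image_eq_zero_of_notMem_tsupport fun h => hyΩ (hη h)]

theorem LocallyIntegrableOn.congr_ae {Ω : Set (Model n)} {f g : Model n → ℝ}
    (hf : LocallyIntegrableOn f Ω) (hΩ : IsOpen Ω) (h : f =ᵐ[volume.restrict Ω] g) :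
    LocallyIntegrableOn g Ω := by
  rw [locallyIntegrableOn_iff hΩ.isLocallyClosed] at hf ⊢
  intro K hK hKc
  exact (hf K hK hKc).congr (ae_restrict_of_ae_restrict_of_subset hK h)

theorem IsWeakPartial.congr {Ω : Set (Model n)} (hΩ : IsOpen Ω) {i : Fin n}
    {u v u' v' : Model n → ℝ} (h : IsWeakPartial Ω i u v) (hu : u =ᵐ[volume.restrict Ω] u')
    (hv : v =ᵐ[volume.restrict Ω] v') : IsWeakPartial Ω i u' v' := by
  refine ⟨LocallyIntegrableOn.congr_ae h.1 hΩ hu, LocallyIntegrableOn.congr_ae h.2.1 hΩ hv,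
    fun ψ hψ hc hs => ?_⟩
  rw [← integral_mul_congr_of_tsupport_subset hΩ hu
    ((tsupport_fderiv_apply_subset ψ (basisVec i)).trans hs),
    ← integral_mul_congr_of_tsupport_subset hΩ hv hs]
  exact h.2.2 ψ hψ hc hs

theorem IsWeakPartial.ae_eq {Ω : Set (Model n)} (hΩ : IsOpen Ω) {i : Fin n}
    {u v v' : Model n → ℝ} (h : IsWeakPartial Ω i u v) (h' : IsWeakPartial Ω i u v') :
    v =ᵐ[volume.restrict Ω] v' := by
  have := hΩ.ae_eq_zero_of_integral_contDiff_smul_eq_zero (μ := volume) (f := fun y => v y - v' y)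
    (h.2.1.sub h'.2.1) (fun ψ hψ hc hs => by
      have e : ∀ y, ψ y • (v y - v' y) = v y * ψ y - v' y * ψ y := fun y => by
        simp only [smul_eq_mul]; ring
      simp only [e]
      rw [integral_sub (integrable_mul_of_tsupport_subset h.2.1 hψ.continuous hc hs)
        (integrable_mul_of_tsupport_subset h'.2.1 hψ.continuous hc hs)]
      linarith [h.2.2 ψ hψ hc hs, h'.2.2 ψ hψ hc hs])
  rw [EventuallyEq, ae_restrict_iff' hΩ.measurableSet]
  filter_upwards [this] with y hy hyΩ
  exact sub_eq_zero.1 (hy hyΩ)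

theorem IsWeakPartial.weakPartial {Ω : Set (Model n)} {i : Fin n} {u v : Model n → ℝ}
    (h : IsWeakPartial Ω i u v) : IsWeakPartial Ω i u (weakPartial Ω i u) := by
  have : ∃ v, IsWeakPartial Ω i u v := ⟨v, h⟩
  rw [Lichnerowicz.weakPartial, dif_pos this]
  exact this.choose_spec

/-- The Leibniz rule follows by testing the weak derivative of `u` against `η ψ`, which is supported
in `Ω` for an arbitrary `ψ`. This is why the product has a weak derivative on the whole space. -/
theorem IsWeakPartial.mul_cutoff {Ω : Set (Model n)} {i : Fin n} {u v η : Model n → ℝ}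
    (h : IsWeakPartial Ω i u v) (hη : ContDiff ℝ ∞ η) (hηc : HasCompactSupport η)
    (hηΩ : tsupport η ⊆ Ω) :
    IsWeakPartial univ i (fun y => u y * η y)
      (fun y => v y * η y + u y * fderiv ℝ η y (basisVec i)) := by
  have hdη := contDiff_fderiv_apply hη (basisVec i)
  have hdηc := hasCompactSupport_fderiv_apply hηc (basisVec i)
  have hdηΩ := (tsupport_fderiv_apply_subset η (basisVec i)).trans hηΩ
  have i1 := integrable_mul_of_tsupport_subset h.1 hη.continuous hηc hηΩ
  have i2 := integrable_mul_of_tsupport_subset h.2.1 hη.continuous hηc hηΩ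
  have i3 := integrable_mul_of_tsupport_subset h.1 hdη.continuous hdηc hdηΩ
  refine ⟨i1.locallyIntegrable.locallyIntegrableOn _,
    (i2.add i3).locallyIntegrable.locallyIntegrableOn _, fun ψ hψ hc _ => ?_⟩
  have hdψ := contDiff_fderiv_apply hψ (basisVec i)
  have hηψΩ : tsupport (fun y => η y * ψ y) ⊆ Ω := (tsupport_mul_subset_left).trans hηΩ
  have key := h.2.2 (fun y => η y * ψ y) (hη.mul hψ) (hηc.mul_right) hηψΩ
  have e : ∀ y, u y * fderiv ℝ (fun z => η z * ψ z) y (basisVec i) =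
      u y * (η y * fderiv ℝ ψ y (basisVec i)) + u y * (fderiv ℝ η y (basisVec i) * ψ y) := by
    intro y
    rw [fderiv_mul_apply (hη.differentiable (by simp) y) (hψ.differentiable (by simp) y)]
    ring
  have j1 := integrable_mul_of_tsupport_subset h.1 (hη.mul hdψ).continuous
    (hηc.mul_right) ((tsupport_mul_subset_left).trans hηΩ)
  have j2 := integrable_mul_of_tsupport_subset h.1 (hdη.mul hψ).continuous
    (hdηc.mul_right) ((tsupport_mul_subset_left).trans hdηΩ)
  have j3 := integrable_mul_of_tsupport_subset h.2.1 (hη.mul hψ).continuous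
    (hηc.mul_right) hηψΩ
  simp only [e] at key
  rw [integral_add j1 j2] at key
  have e2 : ∀ y, (v y * η y + u y * fderiv ℝ η y (basisVec i)) * ψ y =
      v y * (η y * ψ y) + u y * (fderiv ℝ η y (basisVec i) * ψ y) := fun y => by ring
  simp only [e2]
  rw [integral_add j3 j2]
  simp only [mul_assoc]
  linarith

/-! ### Convergence in `L^q` -/

/-- The functions `s m` are in `L^q` and converge in `L^q` to `v`. -/
structure LpConv {α : Type*} [MeasurableSpace α] (q : ℝ≥0∞) (μ : Measure α) (s : ℕ → α → ℝ)
    (v : α → ℝ) : Prop where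
  memLp_seq : ∀ m, MemLp (s m) q μ
  memLp : MemLp v q μ
  tendsto : Tendsto (fun m => eLpNorm (s m - v) q μ) atTop (𝓝 0)

namespace LpConv

variable {α : Type*} [MeasurableSpace α] {q r t : ℝ≥0∞} {μ : Measure α}
  {s s' : ℕ → α → ℝ} {v v' : α → ℝ}

theorem const (h : MemLp v q μ) : LpConv q μ (fun _ => v) v :=
  ⟨fun _ => h, h, by simp⟩

theorem add (hq : 1 ≤ q) (h : LpConv q μ s v) (h' : LpConv q μ s' v') :
    LpConv q μ (fun m x => s m x + s' m x) (fun x => v x + v' x) := by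
  refine ⟨fun m => (h.memLp_seq m).add (h'.memLp_seq m), h.memLp.add h'.memLp, ?_⟩
  have := h.tendsto.add h'.tendsto
  rw [add_zero] at this
  refine tendsto_of_tendsto_of_tendsto_of_le_of_le tendsto_const_nhds this (fun _ => zero_le)
    (fun m => ?_)
  refine le_trans (le_of_eq ?_) (eLpNorm_add_le ((h.memLp_seq m).sub h.memLp).1
    ((h'.memLp_seq m).sub h'.memLp).1 hq)
  congr 1; ext x; simp; ring

theorem zero : LpConv q μ (fun _ _ => 0) (fun _ => 0) :=
  const (v := fun _ => (0 : ℝ)) MemLp.zero'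

theorem sum {ι : Type*} (hq : 1 ≤ q) (I : Finset ι) {S : ι → ℕ → α → ℝ} {V : ι → α → ℝ}
    (h : ∀ k ∈ I, LpConv q μ (S k) (V k)) :
    LpConv q μ (fun m x => ∑ k ∈ I, S k m x) (fun x => ∑ k ∈ I, V k x) := by
  classical
  induction I using Finset.induction_on with
  | empty =>
    simp only [Finset.sum_empty]
    exact zero
  | insert k I hk ih =>
    have h1 := h k (Finset.mem_insert_self k I)
    have h2 := ih fun l hl => h l (Finset.mem_insert_of_mem hl)
    simp only [Finset.sum_insert hk]
    exact add (s := S k) (v := V k) (s' := fun m x => ∑ k ∈ I, S k m x)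
      (v' := fun x => ∑ k ∈ I, V k x) hq h1 h2

theorem mul (hr : 1 ≤ r) [q.HolderTriple t r] (h : LpConv q μ s v) (h' : LpConv t μ s' v') :
    LpConv r μ (fun m x => s m x * s' m x) (fun x => v x * v' x) := by
  have hol : ∀ {f g : α → ℝ}, MemLp f q μ → MemLp g t μ →
      eLpNorm (f * g) r μ ≤ eLpNorm f q μ * eLpNorm g t μ := by
    intro f g hf hg
    rw [← smul_eq_mul]
    exact eLpNorm_smul_le_mul_eLpNorm hg.1 hf.1
  refine ⟨fun m => (h'.memLp_seq m).mul' (h.memLp_seq m), h'.memLp.mul' h.memLp, ?_⟩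
  have hb : Tendsto (fun m => eLpNorm (s m - v) q μ * eLpNorm (s' m - v') t μ
      + eLpNorm (s m - v) q μ * eLpNorm v' t μ + eLpNorm v q μ * eLpNorm (s' m - v') t μ)
      atTop (𝓝 0) := by
    have a1 := ENNReal.Tendsto.mul h.tendsto (by simp) h'.tendsto (by simp)
    have a2 := ENNReal.Tendsto.mul_const h.tendsto (b := eLpNorm v' t μ) (Or.inr h'.memLp.2.ne)
    have a3 := ENNReal.Tendsto.const_mul h'.tendsto (a := eLpNorm v q μ) (Or.inr h.memLp.2.ne)
    simpa using (a1.add a2).add a3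
  refine tendsto_of_tendsto_of_tendsto_of_le_of_le tendsto_const_nhds hb (fun _ => zero_le)
    (fun m => ?_)
  have d := (h.memLp_seq m).sub h.memLp
  have d' := (h'.memLp_seq m).sub h'.memLp
  -- The difference of the products is expanded so that every term contains a factor tending to
  -- zero; Hölder's inequality then bounds each term.
  have e : (fun x => s m x * s' m x) - (fun x => v x * v' x) =
      (s m - v) * (s' m - v') + (s m - v) * v' + v * (s' m - v') := by
    ext x; simp; ring
  simp only [e]
  refine (eLpNorm_add_le ((d'.mul d (r := r)).add (h'.memLp.mul d)).1
    (d'.mul h.memLp (r := r)).1 hr).trans ?_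
  refine add_le_add ((eLpNorm_add_le (d'.mul d (r := r)).1 (h'.memLp.mul d (r := r)).1 hr).trans
    (add_le_add (hol d d') (hol d h'.memLp))) (hol h.memLp d')

theorem mono_exponent [IsFiniteMeasure μ] (hrq : r ≤ q) (h : LpConv q μ s v) :
    LpConv r μ s v := by
  refine ⟨fun m => (h.memLp_seq m).mono_exponent hrq, h.memLp.mono_exponent hrq, ?_⟩
  rcases eq_or_ne r 0 with rfl | hr0
  · simp
  have hne : μ univ ^ (1 / r.toReal - 1 / q.toReal) ≠ ⊤ := by
    apply ENNReal.rpow_ne_top_of_nonneg _ (measure_ne_top _ _)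
    rcases eq_or_ne q ⊤ with rfl | hq
    · simp
    · have := ENNReal.toReal_mono hq hrq
      have h0 : 0 < r.toReal := ENNReal.toReal_pos hr0 (ne_top_of_le_ne_top hq hrq)
      have := one_div_le_one_div_of_le h0 this
      linarith
  have hb := ENNReal.Tendsto.mul_const h.tendsto (Or.inr hne)
  rw [zero_mul] at hb
  exact tendsto_of_tendsto_of_tendsto_of_le_of_le tendsto_const_nhds hb (fun _ => zero_le)
    (fun m => eLpNorm_le_eLpNorm_mul_rpow_measure_univ hrq ((h.memLp_seq m).sub h.memLp).1)

theorem restrict (h : LpConv q μ s v) (K : Set α) : LpConv q (μ.restrict K) s v :=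
  ⟨fun m => (h.memLp_seq m).restrict K, h.memLp.restrict K,
    tendsto_of_tendsto_of_tendsto_of_le_of_le tendsto_const_nhds h.tendsto (fun _ => zero_le)
    (fun _ => eLpNorm_mono_measure _ Measure.restrict_le_self)⟩

theorem congr_ae (h : LpConv q μ s v) (hs : ∀ m, s m =ᵐ[μ] s' m) (hv : v =ᵐ[μ] v') :
    LpConv q μ s' v' :=
  ⟨fun m => (memLp_congr_ae (hs m)).1 (h.memLp_seq m), (memLp_congr_ae hv).1 h.memLp,
    h.tendsto.congr fun m => eLpNorm_congr_ae ((hs m).sub hv)⟩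

theorem comp_add (h : LpConv q μ s v) (N : ℕ) : LpConv q μ (fun m => s (m + N)) v :=
  ⟨fun _ => h.memLp_seq _, h.memLp, h.tendsto.comp (tendsto_add_atTop_nat N)⟩

theorem tendsto_integral (h : LpConv 1 μ s v) :
    Tendsto (fun m => ∫ x, s m x ∂μ) atTop (𝓝 (∫ x, v x ∂μ)) := by
  apply tendsto_integral_of_L1' v h.memLp.1
  · exact Eventually.of_forall fun m => memLp_one_iff_integrable.1 (h.memLp_seq m)
  · exact h.tendsto

end LpConv

theorem LpConv.of_tendstoUniformlyOn {s : ℕ → Model n → ℝ} {u : Model n → ℝ}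
    {K : Set (Model n)} (hK : IsCompact K) (hs : ∀ m, ContinuousOn (s m) K)
    (h : TendstoUniformlyOn s u atTop K) : LpConv ⊤ (volume.restrict K) s u := by
  have mem : ∀ {f : Model n → ℝ}, ContinuousOn f K → MemLp f ⊤ (volume.restrict K) := by
    intro f hf
    obtain ⟨C, hC⟩ := hK.exists_bound_of_continuousOn hf
    refine memLp_top_of_bound (hf.aestronglyMeasurable hK.measurableSet) C ?_
    exact (ae_restrict_iff' hK.measurableSet).2 (Eventually.of_forall hC)
  refine ⟨fun m => mem (hs m), mem (h.continuousOn (Frequently.of_forall hs)), ?_⟩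
  rw [ENNReal.tendsto_nhds_zero]
  intro ε hε
  rcases eq_or_ne ε ⊤ with rfl | hε'
  · simp
  have hpos : 0 < ε.toReal := ENNReal.toReal_pos hε.ne' hε'
  filter_upwards [Metric.tendstoUniformlyOn_iff.1 h _ hpos] with m hm
  have := eLpNormEssSup_le_of_ae_bound (μ := volume.restrict K) (f := s m - u) (C := ε.toReal) ?_
  · rw [eLpNorm_exponent_top]
    rwa [ENNReal.ofReal_toReal hε'] at this
  · refine (ae_restrict_iff' hK.measurableSet).2 (Eventually.of_forall fun y hy => ?_)
    have := hm y hy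
    rw [dist_comm, Real.dist_eq] at this
    simpa using this.le

theorem memLp_restrict_of_continuousOn {K : Set (Model n)} (hK : IsCompact K)
    {f : Model n → ℝ} (hf : ContinuousOn f K) (q : ℝ≥0∞) : MemLp f q (volume.restrict K) := by
  have : IsFiniteMeasure (volume.restrict K) := ⟨by simpa using hK.measure_lt_top⟩
  refine MemLp.mono_exponent ?_ le_top
  exact (LpConv.of_tendstoUniformlyOn hK (fun _ => hf)
    (s := fun _ => f) (u := f) (by
      rw [Metric.tendstoUniformlyOn_iff]; intro ε hε; simp [hε])).memLp

/-! ### Approximation of functions with two weak derivatives -/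

theorem lpConv_one_mollify {f : Model n → ℝ} (hf : Integrable f) :
    LpConv 1 volume (fun m => mollify m f) f := by
  refine ⟨fun m => memLp_one_iff_integrable.2 (integrable_mollify m hf),
    memLp_one_iff_integrable.2 hf, ?_⟩
  have h := ENNReal.tendsto_ofReal (tendsto_integral_abs_mollify_sub hf)
  rw [ENNReal.ofReal_zero] at h
  refine h.congr fun m => ?_
  rw [eLpNorm_one_eq_lintegral_enorm,
    ← ofReal_integral_norm_eq_lintegral_enorm ((integrable_mollify m hf).sub hf)]
  rfl

theorem eLpNorm_two_eq_integral_sq {f : Model n → ℝ} (hf : MemLp f 2 (volume : Measure (Model n))) :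
    eLpNorm f 2 volume = ENNReal.ofReal (Real.sqrt (∫ x, f x ^ 2)) := by
  rw [hf.eLpNorm_eq_integral_rpow_norm (by simp) (by simp), Real.sqrt_eq_rpow]
  simp

/-- The interpolation inequality between the uniform norm of a function and the integral norm of
its second derivative. -/
theorem integral_sq_fderiv_le {d : Model n → ℝ} (hd : ContDiff ℝ ∞ d) (hc : HasCompactSupport d)
    {ε C : ℝ} (e : Model n) (hε : ∀ x, |d x| ≤ ε)
    (hC : ∫ x, |fderiv ℝ (fun y => fderiv ℝ d y e) x e| ≤ C) :
    ∫ x, (fderiv ℝ d x e) ^ 2 ≤ ε * C := by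
  have h1 := contDiff_fderiv_apply hd e
  have c1 := hasCompactSupport_fderiv_apply hc e
  have h2 := contDiff_fderiv_apply h1 e
  have c2 := hasCompactSupport_fderiv_apply c1 e
  -- Integration by parts with `d` and its own derivative; the compact support leaves no boundary
  -- term.
  have key := integral_mul_fderiv_eq_neg_fderiv_mul_of_integrable (μ := (volume : Measure (Model n)))
    (f := d) (g := fun y => fderiv ℝ d y e) (v := e)
    ((h1.mul h1).continuous.integrable_of_hasCompactSupport c1.mul_right)
    ((hd.mul h2).continuous.integrable_of_hasCompactSupport hc.mul_right)
    ((hd.mul h1).continuous.integrable_of_hasCompactSupport hc.mul_right)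
    (fun x _ => hd.differentiable (by simp) x) (fun x _ => h1.differentiable (by simp) x)
  have h3 : ∫ x, (fderiv ℝ d x e) ^ 2 = - ∫ x, d x * fderiv ℝ (fun y => fderiv ℝ d y e) x e := by
    rw [key, neg_neg]; congr 1; ext x; ring
  have hε0 : 0 ≤ ε := (abs_nonneg _).trans (hε 0)
  rw [h3]
  calc - ∫ x, d x * fderiv ℝ (fun y => fderiv ℝ d y e) x e
      ≤ |∫ x, d x * fderiv ℝ (fun y => fderiv ℝ d y e) x e| := neg_le_abs _
    _ ≤ ∫ x, |d x * fderiv ℝ (fun y => fderiv ℝ d y e) x e| := abs_integral_le_integral_abs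
    _ ≤ ∫ x, ε * |fderiv ℝ (fun y => fderiv ℝ d y e) x e| := by
        apply integral_mono
        · exact ((hd.mul h2).continuous.integrable_of_hasCompactSupport hc.mul_right).abs
        · exact (h2.continuous.integrable_of_hasCompactSupport c2).abs.const_mul _
        · intro x
          simp only [abs_mul]
          exact mul_le_mul_of_nonneg_right (hε x) (abs_nonneg _)
    _ = ε * ∫ x, |fderiv ℝ (fun y => fderiv ℝ d y e) x e| := integral_const_mul _ _
    _ ≤ ε * C := mul_le_mul_of_nonneg_left hC hε0

section Global

variable {u : Model n → ℝ} {v : Fin n → Model n → ℝ} {w : Fin n → Fin n → Model n → ℝ}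

theorem fderiv_mollify_univ (hu : Integrable u) {i : Fin n} {v : Model n → ℝ}
    (hv : IsWeakPartial univ i u v) (m : ℕ) :
    (fun x => fderiv ℝ (mollify m u) x (basisVec i)) = mollify m v :=
  funext fun _ => fderiv_mollify m hu.locallyIntegrable hv (subset_univ _)

/-- The interpolation inequality is applied to differences of two mollifications: they are uniformly
small, while their second derivatives stay bounded in `L¹`. In particular `v` is in `L²`, although
only its integrability is assumed. Only the pure derivative `∂ᵢ∂ᵢ u` enters. -/
theorem lpConv_two_fderiv_mollify (hu : Continuous u) (huc : HasCompactSupport u)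
    {i : Fin n} {v w : Model n → ℝ} (hv : Integrable v) (hw : Integrable w)
    (huv : IsWeakPartial univ i u v) (hvw : IsWeakPartial univ i v w) :
    LpConv 2 volume (fun m x => fderiv ℝ (mollify m u) x (basisVec i)) v := by
  have hui : Integrable u := hu.integrable_of_hasCompactSupport huc
  have hsd := fun m => contDiff_mollify m hui.locallyIntegrable
  have hsc := fun m => hasCompactSupport_mollify m huc
  have hmem : ∀ m, MemLp (mollify m v) 2 volume := fun m => by
    rw [← fderiv_mollify_univ hui huv m]
    exact (contDiff_fderiv_apply (hsd m) _).continuous.memLp_of_hasCompactSupport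
      (hasCompactSupport_fderiv_apply (hsc m) _)
  have hunif := tendstoUniformly_mollify (huc.uniformContinuous_of_continuous hu)
  -- The derivatives form a Cauchy sequence.
  have hcauchy : ∀ ε : ℝ, 0 < ε → ∃ N, ∀ m ≥ N, ∀ k ≥ N,
      eLpNorm (mollify m v - mollify k v) 2 volume ≤ ENNReal.ofReal ε := by
    intro ε hε
    -- Twice the norm of `w` bounds the second derivative of a difference of two mollifications;
    -- adding one makes `C` positive.
    set C := 2 * (∫ x, |w x|) + 1 with hC
    have hC0 : 0 < C := by
      have : 0 ≤ ∫ x, |w x| := integral_nonneg fun _ => abs_nonneg _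
      linarith
    obtain ⟨N, hN⟩ := eventually_atTop.1
      -- Two mollifications then differ by at most `ε ^ 2 / C`, and interpolation multiplies this by
      -- `C`.
      ((Metric.tendstoUniformly_iff.1 hunif) (ε ^ 2 / (2 * C)) (by positivity))
    refine ⟨N, fun m hm k hk => ?_⟩
    rw [eLpNorm_two_eq_integral_sq ((hmem m).sub (hmem k))]
    apply ENNReal.ofReal_le_ofReal
    rw [Real.sqrt_le_left hε.le]
    have hdd : ContDiff ℝ ∞ (mollify m u - mollify k u) := (hsd m).sub (hsd k)
    have hdc : HasCompactSupport (mollify m u - mollify k u) := (hsc m).sub (hsc k)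
    have e1 : (fun x => fderiv ℝ (mollify m u - mollify k u) x (basisVec i)) =
        mollify m v - mollify k v := by
      rw [← fderiv_mollify_univ hui huv m, ← fderiv_mollify_univ hui huv k]
      ext x
      rw [fderiv_sub ((hsd m).differentiable (by simp) x) ((hsd k).differentiable (by simp) x)]
      rfl
    have e2 : (fun x => fderiv ℝ (mollify m v - mollify k v) x (basisVec i)) =
        mollify m w - mollify k w := by
      rw [← fderiv_mollify_univ hv hvw m, ← fderiv_mollify_univ hv hvw k]
      ext x
      rw [fderiv_sub ((contDiff_mollify m hv.locallyIntegrable).differentiable (by simp) x)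
        ((contDiff_mollify k hv.locallyIntegrable).differentiable (by simp) x)]
      rfl
    have hb := integral_sq_fderiv_le hdd hdc (ε := ε ^ 2 / C) (C := C) (basisVec i) (fun x => by
      have a1 := hN m hm x
      have a2 := hN k hk x
      rw [Real.dist_eq] at a1 a2
      have : ε ^ 2 / C = ε ^ 2 / (2 * C) + ε ^ 2 / (2 * C) := by field_simp; norm_num
      rw [this, Pi.sub_apply, show mollify m u x - mollify k u x =
        -(u x - mollify m u x) + (u x - mollify k u x) by ring]
      exact (abs_add_le _ _).trans (by rw [abs_neg]; exact add_le_add a1.le a2.le)) (by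
      rw [e1]
      have a1 := integral_abs_mollify_le m hw
      have a2 := integral_abs_mollify_le k hw
      have a3 : ∫ x, |(mollify m w - mollify k w) x| ≤
          (∫ x, |mollify m w x|) + ∫ x, |mollify k w x| := by
        rw [← integral_add (integrable_mollify m hw).abs (integrable_mollify k hw).abs]
        exact integral_mono ((integrable_mollify m hw).sub (integrable_mollify k hw)).abs
          ((integrable_mollify m hw).abs.add (integrable_mollify k hw).abs)
          (fun x => abs_sub _ _)
      have e3 : ∀ x, fderiv ℝ (mollify m v - mollify k v) x (basisVec i) =
        (mollify m w - mollify k w) x := fun x => congrFun e2 x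
      simp only [e3]
      linarith)
    have e4 : ∀ x, (mollify m v - mollify k v) x =
      fderiv ℝ (mollify m u - mollify k u) x (basisVec i) := fun x => (congrFun e1 x).symm
    simp only [e4]
    rwa [div_mul_cancel₀ _ hC0.ne'] at hb
  -- The limit is identified with the help of an almost everywhere convergent subsequence.
  obtain ⟨ns, hns, hae⟩ := (tendstoInMeasure_of_tendsto_eLpNorm one_ne_zero
    (fun m => (integrable_mollify m hv).1) hv.1 (lpConv_one_mollify hv).tendsto).exists_seq_tendsto_ae
  have hlim : ∀ ε : ℝ, 0 < ε → ∃ N, ∀ m ≥ N,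
      eLpNorm (mollify m v - v) 2 volume ≤ ENNReal.ofReal ε := by
    intro ε hε
    obtain ⟨N, hN⟩ := hcauchy ε hε
    refine ⟨N, fun m hm => ?_⟩
    -- Fatou's lemma: the Cauchy bound for `mollify m v - mollify (ns k) v` survives the almost
    -- everywhere limit in `k`.
    apply Lp.eLpNorm_le_of_ae_tendsto (u := atTop) (f := fun k => mollify m v - mollify (ns k) v)
    · filter_upwards [hns.tendsto_atTop.eventually_ge_atTop N] with k hk
      exact hN m hm _ hk
    · exact fun k => ((hmem m).sub (hmem _)).1
    · filter_upwards [hae] with x hx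
      exact hx.const_sub _
  have hvmem : MemLp v 2 volume := by
    obtain ⟨N, hN⟩ := hlim 1 one_pos
    have h1 : MemLp (mollify N v - v) 2 volume :=
      ⟨(hmem N).1.sub hv.1, (hN N le_rfl).trans_lt ENNReal.ofReal_lt_top⟩
    have := (hmem N).sub h1
    simpa using this
  have e : (fun m x => fderiv ℝ (mollify m u) x (basisVec i)) = fun m => mollify m v :=
    funext fun m => fderiv_mollify_univ hui huv m
  rw [e]
  refine ⟨hmem, hvmem, ?_⟩
  rw [ENNReal.tendsto_nhds_zero]
  intro ε hε
  rcases eq_or_ne ε ⊤ with rfl | hε'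
  · simp
  obtain ⟨N, hN⟩ := hlim ε.toReal (ENNReal.toReal_pos hε.ne' hε')
  filter_upwards [eventually_ge_atTop N] with m hm
  simpa [ENNReal.ofReal_toReal hε'] using hN m hm

end Global

/-- The cutoff equals one on a neighbourhood of `K`, not merely on `K`, so that its derivatives
vanish on `K`. -/
theorem exists_cutoff {Ω K : Set (Model n)} (hΩ : IsOpen Ω) (hK : IsCompact K) (hKΩ : K ⊆ Ω) :
    ∃ η : Model n → ℝ, ContDiff ℝ ∞ η ∧ HasCompactSupport η ∧ tsupport η ⊆ Ω ∧
      ∃ U, IsOpen U ∧ K ⊆ U ∧ ∀ y ∈ U, η y = 1 := by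
  obtain ⟨L, hL, hKL, hLΩ⟩ := exists_compact_between hK hΩ hKΩ
  obtain ⟨f, hf1, hf0, -⟩ := exists_contMDiffMap_one_nhds_of_subset_interior (n := ⊤)
    (𝓘(ℝ, Model n)) hK.isClosed hKL
  have hs : tsupport f ⊆ L := closure_minimal (fun y hy => by
    by_contra h; exact hy (hf0 y h)) hL.isClosed
  obtain ⟨U, hU, hKU, hU1⟩ := eventually_nhdsSet_iff_exists.1 hf1
  exact ⟨f, f.contMDiff.contDiff, hL.of_isClosed_subset (isClosed_tsupport _) hs, hs.trans hLΩ,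
    U, hU, hKU, hU1⟩

/-- Multiplying by a cutoff `η` makes `u` a compactly supported function on the whole space, which
can be mollified globally. On `K` every Leibniz term with a derivative of `η` vanishes, so the
limits there are the derivatives of `u` itself. -/
theorem exists_smooth_approx {Ω K : Set (Model n)} (hΩ : IsOpen Ω) (hK : IsCompact K)
    (hKΩ : K ⊆ Ω) {u : Model n → ℝ} {v : Fin n → Model n → ℝ} {w : Fin n → Fin n → Model n → ℝ}
    (hu : ContinuousOn u Ω) (huv : ∀ i, IsWeakPartial Ω i u (v i))
    (hvw : ∀ i j, IsWeakPartial Ω j (v i) (w i j)) :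
    ∃ s : ℕ → Model n → ℝ, (∀ m, ContDiff ℝ ∞ (s m)) ∧ TendstoUniformlyOn s u atTop K ∧
      (∀ i, LpConv 2 (volume.restrict K) (fun m y => fderiv ℝ (s m) y (basisVec i)) (v i)) ∧
      ∀ i j, LpConv 1 (volume.restrict K)
        (fun m y => fderiv ℝ (fun z => fderiv ℝ (s m) z (basisVec i)) y (basisVec j)) (w i j) := by
  obtain ⟨η, hη, hηc, hηΩ, U, hU, hKU, hU1⟩ := exists_cutoff hΩ hK hKΩ
  have hdη := fun i : Fin n => contDiff_fderiv_apply hη (basisVec i)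
  have hdηc := fun i : Fin n => hasCompactSupport_fderiv_apply hηc (basisVec i)
  have hdηΩ := fun i : Fin n => (tsupport_fderiv_apply_subset η (basisVec i)).trans hηΩ
  have hd0 : ∀ i, ∀ y ∈ U, fderiv ℝ η y (basisVec i) = 0 := by
    intro i y hy
    have : η =ᶠ[𝓝 y] fun _ => 1 := by
      filter_upwards [hU.mem_nhds hy] with z hz using hU1 z hz
    rw [this.fderiv_eq]; simp
  have hdd0 : ∀ i j, ∀ y ∈ U,
      fderiv ℝ (fun z => fderiv ℝ η z (basisVec i)) y (basisVec j) = 0 := by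
    intro i j y hy
    have : (fun z => fderiv ℝ η z (basisVec i)) =ᶠ[𝓝 y] fun _ => 0 := by
      filter_upwards [hU.mem_nhds hy] with z hz using hd0 i z hz
    rw [this.fderiv_eq]; simp
  set u' : Model n → ℝ := fun y => u y * η y with hu'
  have hu'c : HasCompactSupport u' := hηc.mul_left
  have hu'cont : Continuous u' := by
    rw [continuous_iff_continuousAt]
    intro y
    by_cases hy : y ∈ tsupport η
    · exact (hu.continuousAt (hΩ.mem_nhds (hηΩ hy))).mul hη.continuous.continuousAt
    · have : u' =ᶠ[𝓝 y] fun _ => 0 := by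
        filter_upwards [(isClosed_tsupport η).isOpen_compl.mem_nhds hy] with z hz
        simp [hu', image_eq_zero_of_notMem_tsupport hz]
      exact continuousAt_const.congr this.symm
  have W1 := fun i => (huv i).mul_cutoff hη hηc hηΩ
  -- The first weak derivative of `u η` is `v i * η + u * ∂ᵢη`; the Leibniz rule is applied again to
  -- each summand.
  have W2 := fun i j => ((hvw i j).mul_cutoff hη hηc hηΩ).add
    ((huv j).mul_cutoff (hdη i) (hdηc i) (hdηΩ i))
  have I : ∀ {f ψ : Model n → ℝ}, LocallyIntegrableOn f Ω → ContDiff ℝ ∞ ψ → HasCompactSupport ψ →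
    tsupport ψ ⊆ Ω → Integrable (fun y => f y * ψ y) := fun hf hψ hc hs =>
    integrable_mul_of_tsupport_subset hf hψ.continuous hc hs
  have hv' := fun i => (I (huv i).2.1 hη hηc hηΩ).add (I (huv i).1 (hdη i) (hdηc i) (hdηΩ i))
  have hw' := fun i j => ((I (hvw i j).2.1 hη hηc hηΩ).add
    (I (hvw i j).1 (hdη j) (hdηc j) (hdηΩ j))).add ((I (huv j).2.1 (hdη i) (hdηc i) (hdηΩ i)).add
      (I (huv j).1 (contDiff_fderiv_apply (hdη i) (basisVec j))
        (hasCompactSupport_fderiv_apply (hdηc i) _)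
        ((tsupport_fderiv_apply_subset _ _).trans (hdηΩ i))))
  have hu'i : Integrable u' := hu'cont.integrable_of_hasCompactSupport hu'c
  refine ⟨fun m => mollify m u', fun m => contDiff_mollify m hu'i.locallyIntegrable, ?_, ?_, ?_⟩
  · have := (tendstoUniformly_mollify (hu'c.uniformContinuous_of_continuous hu'cont)).tendstoUniformlyOn
      (s := K)
    refine this.congr_right fun y hy => ?_
    simp [hu', hU1 y (hKU hy)]
  · intro i
    refine ((lpConv_two_fderiv_mollify hu'cont hu'c (hv' i) (hw' i i) (W1 i) (W2 i i)).restrict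
      K).congr_ae (fun m => EventuallyEq.rfl) ?_
    rw [EventuallyEq, ae_restrict_iff' hK.measurableSet]
    refine Eventually.of_forall fun y hy => ?_
    simp [hU1 y (hKU hy), hd0 i y (hKU hy)]
  · intro i j
    refine ((lpConv_one_mollify (hw' i j)).restrict K).congr_ae (fun m => ?_) ?_
    · rw [fderiv_mollify_univ hu'i (W1 i) m]
      exact (fderiv_mollify_univ (hv' i) (W2 i j) m).symm.eventuallyEq
    · rw [EventuallyEq, ae_restrict_iff' hK.measurableSet]
      refine Eventually.of_forall fun y hy => ?_
      simp [hU1 y (hKU hy), hd0 i y (hKU hy), hd0 j y (hKU hy), hdd0 i j y (hKU hy)]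

/-- The function `u` is continuous on `Ω` and has weak derivatives of order at most two in
`L¹_loc(Ω)`. -/
structure IsW21 (Ω : Set (Model n)) (u : Model n → ℝ) : Prop where
  continuousOn : ContinuousOn u Ω
  partial_one : ∀ i, IsWeakPartial Ω i u (weakPartial Ω i u)
  partial_two : ∀ i j, IsWeakPartial Ω j (weakPartial Ω i u) (weakPartial Ω j (weakPartial Ω i u))

/-- The definition grants second derivatives to some first derivative `v`. Uniqueness of weak
derivatives almost everywhere transfers them to the chosen one. -/
theorem MemW2pLoc.isW21 {p : ℝ} {Ω : Set (Model n)} (hΩ : IsOpen Ω) {u : Model n → ℝ}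
    (h : MemW2pLoc p Ω u) (hu : ContinuousOn u Ω) : IsW21 Ω u := by
  refine ⟨hu, fun i => ?_, fun i j => ?_⟩
  · obtain ⟨v, hv, -⟩ := h.2 i
    exact hv.weakPartial
  · obtain ⟨v, hv, -, hw⟩ := h.2 i
    obtain ⟨w, hw, -⟩ := hw j
    exact (hw.congr hΩ (hv.ae_eq hΩ hv.weakPartial) EventuallyEq.rfl).weakPartial

/-- On `K`, the function `u` is a uniform limit of functions of class `C¹`, whose gradients
converge to `v` in `L²`. -/
def Approx (K : Set (Model n)) (u : Model n → ℝ) (v : Fin n → Model n → ℝ) : Prop :=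
  ∃ s : ℕ → Model n → ℝ, (∀ m, ∀ y ∈ K, ContDiffAt ℝ 1 (s m) y) ∧ TendstoUniformlyOn s u atTop K ∧
    ∀ i, LpConv 2 (volume.restrict K) (fun m y => fderiv ℝ (s m) y (basisVec i)) (v i)

theorem IsW21.approx {Ω K : Set (Model n)} {u : Model n → ℝ} (h : IsW21 Ω u) (hΩ : IsOpen Ω)
    (hK : IsCompact K) (hKΩ : K ⊆ Ω) : Approx K u (fun i => weakPartial Ω i u) := by
  obtain ⟨s, h1, h2, h3, -⟩ := exists_smooth_approx hΩ hK hKΩ h.continuousOn h.partial_one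
    h.partial_two
  exact ⟨s, fun m y _ => ((h1 m).of_le (by simp)).contDiffAt, h2, h3⟩

theorem Approx.continuousOn {K : Set (Model n)} {u : Model n → ℝ} {v : Fin n → Model n → ℝ}
    (h : Approx K u v) : ContinuousOn u K := by
  obtain ⟨s, h1, h2, -⟩ := h
  exact h2.continuousOn (Frequently.of_forall fun m y hy =>
    (h1 m y hy).continuousAt.continuousWithinAt)

theorem Approx.memLp {K : Set (Model n)} {u : Model n → ℝ} {v : Fin n → Model n → ℝ}
    (h : Approx K u v) (i : Fin n) : MemLp (v i) 2 (volume.restrict K) := by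
  obtain ⟨s, -, -, h3⟩ := h
  exact (h3 i).memLp

theorem tendstoUniformlyOn_comp {ι : Type*} [Fintype ι] {K : Set (Model n)} {D : Set (ι → ℝ)}
    {S : ℕ → Model n → ι → ℝ} {U : Model n → ι → ℝ} (hS : TendstoUniformlyOn S U atTop K)
    (hD : IsCompact D) (hSD : ∀ m, ∀ y ∈ K, S m y ∈ D) (hUD : ∀ y ∈ K, U y ∈ D)
    {G : (ι → ℝ) → ℝ} (hG : ContinuousOn G D) :
    TendstoUniformlyOn (fun m y => G (S m y)) (fun y => G (U y)) atTop K := by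
  have huc := hD.uniformContinuousOn_of_continuous hG
  rw [Metric.uniformContinuousOn_iff] at huc
  rw [Metric.tendstoUniformlyOn_iff] at hS ⊢
  intro ε hε
  obtain ⟨δ, hδ, h⟩ := huc ε hε
  filter_upwards [hS δ hδ] with m hm y hy
  exact h _ (hUD y hy) _ (hSD m y hy) (hm y hy)

/-- The chain rule for functions which are approximable on a compact set. -/
theorem Approx.comp {ι : Type*} [Fintype ι] {K : Set (Model n)} (hK : IsCompact K)
    {U : ι → Model n → ℝ} {V : ι → Fin n → Model n → ℝ} (h : ∀ k, Approx K (U k) (V k))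
    {F : (ι → ℝ) → ℝ} {O : Set (ι → ℝ)} (hO : IsOpen O) (hF : ContDiffOn ℝ 1 F O)
    (hUO : ∀ y ∈ K, (fun k => U k y) ∈ O) :
    Approx K (fun y => F (fun k => U k y))
      (fun i y => fderiv ℝ F (fun k => U k y) (fun k => V k i y)) := by
  classical
  have hUc : ContinuousOn (fun y k => U k y) K := continuousOn_pi.2 fun k => (h k).continuousOn
  choose S hS1 hS2 hS3 using h
  have hSU : TendstoUniformlyOn (fun m y k => S k m y) (fun y k => U k y) atTop K := by
    rw [Metric.tendstoUniformlyOn_iff]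
    intro ε hε
    filter_upwards [eventually_all.2 fun k => Metric.tendstoUniformlyOn_iff.1 (hS2 k) ε hε]
      with m hm y hy
    exact (dist_pi_lt_iff hε).2 fun k => hm k y hy
  have hC := hK.image_of_continuousOn hUc
  have hCO : (fun y k => U k y) '' K ⊆ O := by
    rintro _ ⟨y, hy, rfl⟩; exact hUO y hy
  -- `F` is controlled only on `O`. A closed `δ`-neighbourhood `D` of the compact image of `K` stays
  -- inside `O`, and after discarding the first `N` terms all approximants take their values in `D`.
  obtain ⟨δ, hδ, hδO⟩ := hC.exists_cthickening_subset_open hO hCO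
  set D := cthickening δ ((fun y k => U k y) '' K) with hD
  have hDc : IsCompact D := hC.cthickening
  obtain ⟨N, hN⟩ := eventually_atTop.1 (Metric.tendstoUniformlyOn_iff.1 hSU δ hδ)
  have hUD : ∀ y ∈ K, (fun k => U k y) ∈ D := fun y hy =>
    self_subset_cthickening _ (mem_image_of_mem _ hy)
  have hSD : ∀ m, ∀ y ∈ K, (fun k => S k (m + N) y) ∈ D := fun m y hy =>
    mem_cthickening_of_dist_le _ _ _ _ (mem_image_of_mem _ hy) (by
      rw [dist_comm]; exact (hN (m + N) (by omega) y hy).le)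
  have hSU' : TendstoUniformlyOn (fun m y k => S k (m + N) y) (fun y k => U k y) atTop K := by
    rw [Metric.tendstoUniformlyOn_iff] at hSU ⊢
    intro ε hε
    exact (tendsto_add_atTop_nat N).eventually (hSU ε hε)
  have hFat : ∀ x ∈ O, ContDiffAt ℝ 1 F x := fun x hx => hF.contDiffAt (hO.mem_nhds hx)
  have hSat : ∀ m, ∀ y ∈ K, ContDiffAt ℝ 1 (fun y k => S k (m + N) y) y := fun m y hy =>
    contDiffAt_pi.2 fun k => hS1 k _ y hy
  have hcomp : ∀ m, ∀ y ∈ K, ContDiffAt ℝ 1 (fun y => F (fun k => S k (m + N) y)) y :=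
    fun m y hy => (hFat _ (hδO (hSD m y hy))).comp y (hSat m y hy)
  refine ⟨fun m y => F (fun k => S k (m + N) y), hcomp, ?_, fun i => ?_⟩
  · exact tendstoUniformlyOn_comp hSU' hDc hSD hUD (hF.continuousOn.mono hδO)
  · have hsum : ∀ (x z : ι → ℝ), fderiv ℝ F x z =
        ∑ k, fderiv ℝ F x (Pi.single k 1) * z k := by
      intro x z
      conv_lhs => rw [← Finset.univ_sum_single z]
      rw [map_sum]
      refine Finset.sum_congr rfl fun k _ => ?_
      have : Pi.single k (z k) = z k • (Pi.single k 1 : ι → ℝ) := by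
        rw [← Pi.single_smul]; simp
      rw [this, map_smul, smul_eq_mul, mul_comm]
    have hdF : ∀ k, ContinuousOn (fun x => fderiv ℝ F x (Pi.single k 1)) O := fun k =>
      (hF.continuousOn_fderiv_of_isOpen hO le_rfl).clm_apply continuousOn_const
    have main : LpConv 2 (volume.restrict K)
        (fun m y => ∑ k, fderiv ℝ F (fun k => S k (m + N) y) (Pi.single k 1) *
          fderiv ℝ (S k (m + N)) y (basisVec i))
        (fun y => ∑ k, fderiv ℝ F (fun k => U k y) (Pi.single k 1) * V k i y) := by
      refine LpConv.sum one_le_two _ fun k _ => ?_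
      -- The partial derivatives of `F` along the approximants converge uniformly, the gradients in
      -- `L²`.
      refine LpConv.mul (q := ⊤) (t := 2) one_le_two ?_ ((hS3 k i).comp_add N)
      refine LpConv.of_tendstoUniformlyOn hK (fun m => ?_)
        (tendstoUniformlyOn_comp hSU' hDc hSD hUD ((hdF k).mono hδO))
      refine (hdF k).comp (fun y hy => (hSat m y hy).continuousAt.continuousWithinAt) ?_
      exact fun y hy => hδO (hSD m y hy)
    refine main.congr_ae (fun m => ?_) ?_
    · rw [EventuallyEq, ae_restrict_iff' hK.measurableSet]
      refine Eventually.of_forall fun y hy => ?_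
      rw [← hsum _ (fun k => fderiv ℝ (S k (m + N)) y (basisVec i))]
      have h1 : HasFDerivAt F (fderiv ℝ F (fun k => S k (m + N) y)) (fun k => S k (m + N) y) :=
        ((hFat _ (hδO (hSD m y hy))).differentiableAt (by simp)).hasFDerivAt
      have h2 : HasFDerivAt (fun y k => S k (m + N) y)
          (ContinuousLinearMap.pi fun k => fderiv ℝ (S k (m + N)) y) y :=
        hasFDerivAt_pi.2 fun k => ((hS1 k _ y hy).differentiableAt (by simp)).hasFDerivAt
      have h3 := (h1.comp y h2).fderiv
      have e : (fun y => F (fun k => S k (m + N) y)) = F ∘ fun y k => S k (m + N) y := rfl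
      beta_reduce
      rw [e, h3]
      simp only [ContinuousLinearMap.comp_apply]
      congr 1
    · exact Eventually.of_forall fun y => (hsum _ _).symm

/-! ### Integration by parts for approximable functions -/

theorem integrable_mul_of_continuousOn {K : Set (Model n)} (hK : IsCompact K) {f ψ : Model n → ℝ}
    (hf : ContinuousOn f K) (hψ : Continuous ψ) (hψK : tsupport ψ ⊆ K) :
    Integrable (fun y => f y * ψ y) :=
  integrable_mul_of_tsupport_subset (hf.integrableOn_compact hK).locallyIntegrableOn hψ
    (hK.of_isClosed_subset (isClosed_tsupport _) hψK) hψK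

theorem integral_mul_fderiv_of_contDiffAt {K : Set (Model n)} (hK : IsCompact K)
    {f ψ : Model n → ℝ} (hf : ∀ y ∈ K, ContDiffAt ℝ 1 f y) (hψ : ContDiff ℝ ∞ ψ)
    (hψK : tsupport ψ ⊆ K) (e : Model n) :
    ∫ y, f y * fderiv ℝ ψ y e = - ∫ y, fderiv ℝ f y e * ψ y := by
  have hfc : ContinuousOn f K := fun y hy => (hf y hy).continuousAt.continuousWithinAt
  have hdf : ContinuousOn (fun y => fderiv ℝ f y e) K := fun y hy =>
    (((hf y hy).fderiv_right (m := 0) (by simp)).continuousAt.clm_apply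
      continuousAt_const).continuousWithinAt
  apply integral_mul_fderiv_eq_neg_fderiv_mul_of_integrable
  · exact integrable_mul_of_continuousOn hK hdf hψ.continuous hψK
  · exact integrable_mul_of_continuousOn hK hfc (contDiff_fderiv_apply hψ e).continuous
      ((tsupport_fderiv_apply_subset ψ e).trans hψK)
  · exact integrable_mul_of_continuousOn hK hfc hψ.continuous hψK
  · exact fun y hy => (hf y (hψK hy)).differentiableAt (by simp)
  · exact fun y _ => hψ.differentiable (by simp) y

theorem setIntegral_mul_of_tsupport_subset {K : Set (Model n)} {f ψ : Model n → ℝ}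
    (hψK : tsupport ψ ⊆ K) : ∫ y in K, f y * ψ y = ∫ y, f y * ψ y := by
  apply setIntegral_eq_integral_of_forall_compl_eq_zero
  intro y hy
  simp [image_eq_zero_of_notMem_tsupport fun h => hy (hψK h)]

theorem lpConv_top_const {K : Set (Model n)} (hK : IsCompact K) {ψ : Model n → ℝ}
    (hψ : Continuous ψ) : LpConv ⊤ (volume.restrict K) (fun _ => ψ) ψ :=
  LpConv.const (memLp_restrict_of_continuousOn hK hψ.continuousOn ⊤)

theorem isFiniteMeasure_restrict {K : Set (Model n)} (hK : IsCompact K) :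
    IsFiniteMeasure (volume.restrict K) := ⟨by simpa using hK.measure_lt_top⟩

theorem lpConv_top_of_contDiffAt {K : Set (Model n)} (hK : IsCompact K)
    {s : ℕ → Model n → ℝ} {u : Model n → ℝ} (hs : ∀ m, ∀ y ∈ K, ContDiffAt ℝ 1 (s m) y)
    (h : TendstoUniformlyOn s u atTop K) : LpConv ⊤ (volume.restrict K) s u :=
  LpConv.of_tendstoUniformlyOn hK (fun m y hy => (hs m y hy).continuousAt.continuousWithinAt) h

/-- Integration by parts against an approximable function. -/
theorem Approx.integral_mul_weakPartial {Ω K : Set (Model n)} (hΩ : IsOpen Ω)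
    (hK : IsCompact K) (hKΩ : K ⊆ Ω) {ρ : Model n → ℝ} (hρ : ContDiff ℝ ∞ ρ)
    (hρK : tsupport ρ ⊆ K) {f : Model n → ℝ} {df : Fin n → Model n → ℝ} (hf : Approx K f df)
    {u : Model n → ℝ} (hu : IsW21 Ω u) (i j : Fin n) :
    ∫ y in K, f y * (ρ y * weakPartial Ω j (weakPartial Ω i u) y) =
      - ∫ y in K, (f y * (weakPartial Ω i u y * fderiv ℝ ρ y (basisVec j)) +
        df j y * (ρ y * weakPartial Ω i u y)) := by
  have := isFiniteMeasure_restrict hK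
  obtain ⟨s, hs, -, hs2, hs3⟩ := exists_smooth_approx hΩ hK hKΩ hu.continuousOn hu.partial_one
    hu.partial_two
  obtain ⟨g, hg1, hg2, hg3⟩ := hf
  have hg := lpConv_top_of_contDiffAt hK hg1 hg2
  have hρ' := lpConv_top_const hK hρ.continuous
  have hdρ' := lpConv_top_const hK (contDiff_fderiv_apply hρ (basisVec j)).continuous
  -- Both sides pass to the limit: the second derivatives converge in `L¹` against uniformly
  -- convergent factors, and the product of two gradients converges in `L¹` because each factor
  -- converges in `L²`.
  have L1 := (hg.mul (r := 1) (t := 1) le_rfl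
    (hρ'.mul (r := 1) (t := 1) le_rfl (hs3 i j))).tendsto_integral
  have L2 := ((hg.mul (r := 1) (t := 1) le_rfl
    (LpConv.mono_exponent one_le_two ((hs2 i).mul (r := 2) (t := ⊤) one_le_two hdρ'))).add le_rfl
    ((hg3 j).mul (r := 1) (t := 2) le_rfl
      (hρ'.mul (r := 2) (t := 2) one_le_two (hs2 i)))).tendsto_integral
  refine tendsto_nhds_unique L1 (L2.neg.congr fun m => ?_)
  have hds := contDiff_fderiv_apply (hs m) (basisVec i)
  have hsupp : tsupport (fun y => ρ y * fderiv ℝ (s m) y (basisVec i)) ⊆ K :=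
    tsupport_mul_subset_left.trans hρK
  -- For the approximants the identity is classical integration by parts against the test function
  -- `ρ ∂ᵢ(s m)`.
  have key := integral_mul_fderiv_of_contDiffAt hK (hg1 m) (hρ.mul hds) hsupp (basisVec j)
  have e : ∀ y, fderiv ℝ (fun z => ρ z * fderiv ℝ (s m) z (basisVec i)) y (basisVec j) =
      ρ y * fderiv ℝ (fun z => fderiv ℝ (s m) z (basisVec i)) y (basisVec j) +
      fderiv ℝ (s m) y (basisVec i) * fderiv ℝ ρ y (basisVec j) := fun y =>
    fderiv_mul_apply (hρ.differentiable (by simp) y) (hds.differentiable (by simp) y) _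
  have hgc : ContinuousOn (g m) K := fun y hy => (hg1 m y hy).continuousAt.continuousWithinAt
  have hdg : ContinuousOn (fun y => fderiv ℝ (g m) y (basisVec j)) K := fun y hy =>
    (((hg1 m y hy).fderiv_right (m := 0) (by simp)).continuousAt.clm_apply
      continuousAt_const).continuousWithinAt
  have hdρ := contDiff_fderiv_apply hρ (basisVec j)
  have hdds := contDiff_fderiv_apply hds (basisVec j)
  have i1 : IntegrableOn (fun y => g m y * (ρ y *
      fderiv ℝ (fun z => fderiv ℝ (s m) z (basisVec i)) y (basisVec j))) K :=
    (hgc.mul (hρ.mul hdds).continuous.continuousOn).integrableOn_compact hK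
  have i2 : IntegrableOn (fun y => g m y * (fderiv ℝ (s m) y (basisVec i) *
      fderiv ℝ ρ y (basisVec j))) K :=
    (hgc.mul (hds.mul hdρ).continuous.continuousOn).integrableOn_compact hK
  have i3 : IntegrableOn (fun y => fderiv ℝ (g m) y (basisVec j) * (ρ y *
      fderiv ℝ (s m) y (basisVec i))) K :=
    (hdg.mul (hρ.mul hds).continuous.continuousOn).integrableOn_compact hK
  have e1 : ∫ y, g m y * fderiv ℝ (fun z => ρ z * fderiv ℝ (s m) z (basisVec i)) y (basisVec j) =
      ∫ y in K, g m y * fderiv ℝ (fun z => ρ z * fderiv ℝ (s m) z (basisVec i)) y (basisVec j) :=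
    (setIntegral_mul_of_tsupport_subset
      ((tsupport_fderiv_apply_subset _ _).trans hsupp)).symm
  rw [e1, ← setIntegral_mul_of_tsupport_subset hsupp] at key
  simp only [e, mul_add] at key
  rw [integral_add i1 i2] at key
  rw [integral_add i2 i3]
  linarith

/-- Classical integration by parts for the approximants passes to the limit. By uniqueness of weak
derivatives, `df` is therefore determined by `f` almost everywhere on an open `W`. -/
theorem Approx.isWeakPartial {K W : Set (Model n)} (hK : IsCompact K)
    (hWK : W ⊆ K) {f : Model n → ℝ} {df : Fin n → Model n → ℝ} (hf : Approx K f df) (i : Fin n) :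
    IsWeakPartial W i f (df i) := by
  have := isFiniteMeasure_restrict hK
  refine ⟨((hf.continuousOn.integrableOn_compact hK).mono_set hWK).locallyIntegrableOn,
    (IntegrableOn.mono_set (s := W) (t := K)
      ((hf.memLp i).integrable one_le_two) hWK).locallyIntegrableOn, fun ψ hψ hc hs => ?_⟩
  obtain ⟨g, hg1, hg2, hg3⟩ := hf
  have hg := lpConv_top_of_contDiffAt hK hg1 hg2
  have hψK := hs.trans hWK
  have hdψK := (tsupport_fderiv_apply_subset ψ (basisVec i)).trans hψK
  have hψ' := lpConv_top_const hK hψ.continuous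
  have hdψ' := lpConv_top_const hK (contDiff_fderiv_apply hψ (basisVec i)).continuous
  have L1 := (LpConv.mono_exponent (r := 1) le_top
    (hg.mul (r := ⊤) (t := ⊤) le_top hdψ')).tendsto_integral
  have L2 := (LpConv.mono_exponent one_le_two
    ((hg3 i).mul (r := 2) (t := ⊤) one_le_two hψ')).tendsto_integral
  rw [← setIntegral_mul_of_tsupport_subset hψK, ← setIntegral_mul_of_tsupport_subset hdψK]
  refine tendsto_nhds_unique L1 (L2.neg.congr fun m => ?_)
  rw [setIntegral_mul_of_tsupport_subset hψK, setIntegral_mul_of_tsupport_subset hdψK]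
  exact (integral_mul_fderiv_of_contDiffAt hK (hg1 m) hψ hψK (basisVec i)).symm

theorem ext_basisVec {L L' : Model n →L[ℝ] ℝ} (h : ∀ i, L (basisVec i) = L' (basisVec i)) :
    L = L' := by
  have := (EuclideanSpace.basisFun (Fin n) ℝ).toBasis.ext (f₁ := (L : Model n →ₗ[ℝ] ℝ))
    (f₂ := (L' : Model n →ₗ[ℝ] ℝ)) (fun i => by simpa [basisVec] using h i)
  exact ContinuousLinearMap.coe_injective this

/-- An approximable function with vanishing gradient is locally constant. -/
theorem Approx.eq_of_gradient_eq_zero {x : Model n} {r : ℝ} {f : Model n → ℝ}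
    {df : Fin n → Model n → ℝ} (hf : Approx (closedBall x r) f df)
    (h0 : ∀ i, df i =ᵐ[volume.restrict (ball x r)] 0) {y : Model n} (hy : y ∈ ball x (r / 2)) :
    f y = f x := by
  have hr : 0 < r / 2 := dist_nonneg.trans_lt (mem_ball.1 hy)
  have hK := isCompact_closedBall x r
  -- Extension by zero gives an integrable function on the whole space that can be mollified; its
  -- weak gradient is known to vanish only inside the ball.
  set f' := (closedBall x r).indicator f with hf'
  have hi : Integrable f' :=
    (hf.continuousOn.integrableOn_compact hK).integrable_indicator hK.measurableSet
  have hff' : ∀ z ∈ ball x r, f' z = f z := fun z hz =>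
    indicator_of_mem (ball_subset_closedBall hz) f
  have hw : ∀ i, IsWeakPartial (ball x r) i f' 0 := fun i =>
    (hf.isWeakPartial hK ball_subset_closedBall i).congr isOpen_ball (by
      rw [EventuallyEq, ae_restrict_iff' isOpen_ball.measurableSet]
      exact Eventually.of_forall fun z hz => (hff' z hz).symm) (h0 i)
  have hlim : ∀ z ∈ ball x r, Tendsto (fun m => mollify m f' z) atTop (𝓝 (f z)) := by
    intro z hz
    refine ContDiffBump.convolution_tendsto_right tendsto_bump_rOut
      (Eventually.of_forall fun _ => hi.1) ?_ tendsto_const_nhds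
    have hc : ContinuousAt f' z := by
      have := (hf.continuousOn.mono ball_subset_closedBall).continuousAt (isOpen_ball.mem_nhds hz)
      refine this.congr ?_
      filter_upwards [isOpen_ball.mem_nhds hz] with t ht using (hff' t ht).symm
    have := hc.tendsto.comp (tendsto_snd (f := (atTop : Filter ℕ)))
    rwa [hff' z hz] at this
  have hxr : x ∈ ball x r := mem_ball_self (by linarith)
  have hyr : y ∈ ball x r := ball_subset_ball (by linarith) hy
  refine tendsto_nhds_unique (hlim y hyr) ((hlim x hxr).congr' ?_)
  -- Once the kernel radius is below `r / 2`, mollifying at points of the half ball sees only values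
  -- inside the ball, so the mollification is constant on the half ball.
  filter_upwards [(tendsto_bump_rOut (n := n)).eventually (gt_mem_nhds hr)] with m hm
  refine isOpen_ball.is_const_of_fderiv_eq_zero (convex_ball x (r / 2)).isPreconnected
    (((contDiff_mollify m hi.locallyIntegrable).differentiable (by simp)).differentiableOn)
    (fun z hz => ?_) (mem_ball_self hr) hy
  refine ext_basisVec fun i => ?_
  rw [fderiv_mollify m hi.locallyIntegrable (hw i)]
  · simp [mollify_apply]
  · refine closedBall_subset_ball' ?_
    linarith [mem_ball.1 hz]

/-! ### The densitized inverse metric -/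

theorem contDiff_matrix_det {V : Type*} [NormedAddCommGroup V] [NormedSpace ℝ V] {ι : Type*}
    [Fintype ι] [DecidableEq ι] {A : V → Matrix ι ι ℝ} (h : ∀ i j, ContDiff ℝ ∞ fun x => A x i j) :
    ContDiff ℝ ∞ fun x => (A x).det := by
  simp only [Matrix.det_apply]
  exact ContDiff.sum fun σ _ => (contDiff_prod fun i _ => h _ _).const_smul _

/-- The matrix with given entries. -/
def toMat (x : Fin n × Fin n → ℝ) : Matrix (Fin n) (Fin n) ℝ := Matrix.of fun i j => x (i, j)

theorem contDiff_toMat_apply (i j : Fin n) : ContDiff ℝ ∞ fun x => toMat x i j :=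
  contDiff_apply ℝ ℝ (i, j)

/-- The entries of the densitized inverse matrix `√(det x) x⁻¹`. -/
def densInv (i j : Fin n) (x : Fin n × Fin n → ℝ) : ℝ :=
  Real.sqrt (toMat x).det * (toMat x)⁻¹ i j

theorem isOpen_det_pos : IsOpen {x : Fin n × Fin n → ℝ | 0 < (toMat x).det} :=
  isOpen_lt continuous_const (contDiff_matrix_det contDiff_toMat_apply).continuous

theorem contDiff_adjugate_toMat (i j : Fin n) : ContDiff ℝ ∞ fun x => (toMat x).adjugate i j := by
  simp only [Matrix.adjugate_apply]
  refine contDiff_matrix_det fun k l => ?_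
  by_cases hk : k = j
  · subst hk; simp only [Matrix.updateRow_self]; exact contDiff_const
  · simp only [Matrix.updateRow_ne hk]; exact contDiff_toMat_apply k l

theorem inv_apply_eq (X : Matrix (Fin n) (Fin n) ℝ) (i j : Fin n) :
    X⁻¹ i j = X.det⁻¹ * X.adjugate i j := by
  rw [Matrix.inv_def, Ring.inverse_eq_inv']; simp

theorem contDiffOn_inv (i j : Fin n) :
    ContDiffOn ℝ ∞ (fun x => (toMat x)⁻¹ i j) {x | 0 < (toMat x).det} := by
  simp only [inv_apply_eq]
  exact ((contDiff_matrix_det contDiff_toMat_apply).contDiffOn.inv fun x hx => ne_of_gt hx).mul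
    (contDiff_adjugate_toMat i j).contDiffOn

theorem contDiffOn_densInv (i j : Fin n) :
    ContDiffOn ℝ ∞ (densInv i j) {x | 0 < (toMat x).det} :=
  ((contDiff_matrix_det contDiff_toMat_apply).contDiffOn.sqrt fun _ hx => ne_of_gt hx).mul
    (contDiffOn_inv i j)

/-- Jacobi's formula: `det (X + tH) = det X · det (1 + t X⁻¹H)`, and the second factor is `1 + t
tr(X⁻¹H)` plus a polynomial multiple of `t²`. -/
theorem hasDerivAt_det_line {X : Matrix (Fin n) (Fin n) ℝ} (hX : 0 < X.det)
    (H : Matrix (Fin n) (Fin n) ℝ) :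
    HasDerivAt (fun t : ℝ => (X + t • H).det) (X.det * (X⁻¹ * H).trace) 0 := by
  have hu : IsUnit X.det := isUnit_iff_ne_zero.2 hX.ne'
  have e : ∀ t : ℝ, (X + t • H).det = X.det * (1 + (X⁻¹ * H).trace * t +
      (Matrix.det (1 + (Polynomial.X : Polynomial ℝ) •
        (X⁻¹ * H).map Polynomial.C)).divX.divX.eval t * t ^ 2) := by
    intro t
    rw [← Matrix.det_one_add_smul, ← Matrix.det_mul]
    congr 1
    rw [mul_add, mul_one, Matrix.mul_smul, ← mul_assoc, Matrix.mul_nonsing_inv _ hu, one_mul]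
  simp only [e]
  set q := (Matrix.det (1 + (Polynomial.X : Polynomial ℝ) •
        (X⁻¹ * H).map Polynomial.C)).divX.divX
  have h1 : HasDerivAt (fun t : ℝ => q.eval t * t ^ 2) 0 0 := by
    have := (q.hasDerivAt 0).mul (hasDerivAt_pow 2 (0 : ℝ))
    simpa using! this
  have h2 : HasDerivAt (fun t : ℝ => 1 + (X⁻¹ * H).trace * t) ((X⁻¹ * H).trace) 0 := by
    simpa using ((hasDerivAt_id (0 : ℝ)).const_mul ((X⁻¹ * H).trace)).const_add 1
  simpa using! (h2.add h1).const_mul X.det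

theorem hasDerivAt_inv_line {X : Matrix (Fin n) (Fin n) ℝ} (hX : 0 < X.det)
    (H : Matrix (Fin n) (Fin n) ℝ) (i j : Fin n) :
    HasDerivAt (fun t : ℝ => (X + t • H)⁻¹ i j) (-(X⁻¹ * H * X⁻¹) i j) 0 := by
  have hu : IsUnit X.det := isUnit_iff_ne_zero.2 hX.ne'
  have hpos : ∀ᶠ t : ℝ in 𝓝 0, 0 < (X + t • H).det := by
    have := (hasDerivAt_det_line hX H).continuousAt
    have h0 : 0 < (X + (0 : ℝ) • H).det := by simpa using hX
    exact this.eventually (lt_mem_nhds h0)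
  have hdiff : ∀ k l, DifferentiableAt ℝ (fun t : ℝ => (X + t • H)⁻¹ k l) 0 := by
    intro k l
    have h1 := (contDiffOn_inv (n := n) k l).contDiffAt (x := fun p => X p.1 p.2)
      (isOpen_det_pos.mem_nhds (by simpa [toMat] using! hX))
    have h2 : DifferentiableAt ℝ (fun t : ℝ => fun p : Fin n × Fin n => X p.1 p.2 + t * H p.1 p.2)
        0 := by fun_prop
    have h3 := (h1.differentiableAt (by simp))
    have h4 : (fun p : Fin n × Fin n => X p.1 p.2) =
      (fun t : ℝ => fun p : Fin n × Fin n => X p.1 p.2 + t * H p.1 p.2) 0 := by ext p; simp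
    rw [h4] at h3
    exact h3.comp 0 h2
  have hN : ∀ᶠ t : ℝ in 𝓝 0, (X + t • H)⁻¹ i j =
      X⁻¹ i j - t * ∑ k, (X⁻¹ * H) i k * (X + t • H)⁻¹ k j := by
    filter_upwards [hpos] with t ht
    have hut : IsUnit (X + t • H).det := isUnit_iff_ne_zero.2 ht.ne'
    -- The resolvent identity: its explicit factor `t` means that only the value of the other factor
    -- at `t = 0` enters the derivative.
    have h1 : (X + t • H)⁻¹ = X⁻¹ - t • (X⁻¹ * H * (X + t • H)⁻¹) := by
      have h2 : X⁻¹ * ((X + t • H) * (X + t • H)⁻¹) = X⁻¹ := by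
        rw [Matrix.mul_nonsing_inv _ hut, mul_one]
      have h3 : X⁻¹ * ((X + t • H) * (X + t • H)⁻¹) =
          (X + t • H)⁻¹ + t • (X⁻¹ * H * (X + t • H)⁻¹) := by
        rw [← mul_assoc, mul_add, Matrix.nonsing_inv_mul _ hu, add_mul, one_mul, Matrix.mul_smul,
          Matrix.smul_mul]
      rw [h2] at h3
      exact eq_sub_of_add_eq h3.symm
    conv_lhs => rw [h1]
    simp [Matrix.mul_apply]
  have hd : HasDerivAt (fun t : ℝ => X⁻¹ i j - t * ∑ k, (X⁻¹ * H) i k * (X + t • H)⁻¹ k j)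
      (-(X⁻¹ * H * X⁻¹) i j) 0 := by
    have hs : DifferentiableAt ℝ (fun t : ℝ => ∑ k, (X⁻¹ * H) i k * (X + t • H)⁻¹ k j) 0 :=
      DifferentiableAt.fun_sum fun k _ => (hdiff k j).const_mul _
    have := ((hasDerivAt_id (0 : ℝ)).mul hs.hasDerivAt).const_sub (X⁻¹ i j)
    refine (this.congr_deriv ?_)
    simp [Matrix.mul_apply]
  exact hd.congr_of_eventuallyEq hN

/-- Differentiability is already known, so the derivative can be read off along the line `x + t h`
from the formulas for the determinant and the inverse. -/
theorem fderiv_densInv {x : Fin n × Fin n → ℝ} (hx : 0 < (toMat x).det) (i j : Fin n)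
    (h : Fin n × Fin n → ℝ) :
    fderiv ℝ (densInv i j) x h = Real.sqrt (toMat x).det *
      (1 / 2 * ((toMat x)⁻¹ * toMat h).trace * (toMat x)⁻¹ i j -
        ((toMat x)⁻¹ * toMat h * (toMat x)⁻¹) i j) := by
  have h1 := ((contDiffOn_densInv i j).contDiffAt
    (isOpen_det_pos.mem_nhds hx)).differentiableAt (by simp)
  have h2 : HasDerivAt (fun t : ℝ => x + t • h) h 0 := by
    simpa using ((hasDerivAt_id (0 : ℝ)).smul_const h).const_add x
  have h3 : HasDerivAt (fun t : ℝ => densInv i j (x + t • h)) (fderiv ℝ (densInv i j) x h) 0 := by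
    have h1' : HasFDerivAt (densInv i j) (fderiv ℝ (densInv i j) x) (x + (0 : ℝ) • h) := by
      simpa using! h1.hasFDerivAt
    exact h1'.comp_hasDerivAt (0 : ℝ) h2
  have e : ∀ t : ℝ, toMat (x + t • h) = toMat x + t • toMat h := fun t => by
    ext a b; simp [toMat]
  have hd := hasDerivAt_det_line hx (toMat h)
  have h0 : (toMat x + (0 : ℝ) • toMat h).det = (toMat x).det := by simp
  have h4 := (hd.sqrt (by rw [h0]; exact hx.ne')).mul (hasDerivAt_inv_line hx (toMat h) i j)
  simp only [densInv, e] at h3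
  have h5 := h3.unique h4
  change fderiv ℝ (densInv i j) x h = _ at h5
  rw [h5]
  have hs : Real.sqrt (toMat x).det ≠ 0 := (Real.sqrt_pos.2 hx).ne'
  simp only [zero_smul, add_zero]
  have hsq : (toMat x).det = Real.sqrt (toMat x).det * Real.sqrt (toMat x).det :=
    (Real.mul_self_sqrt hx.le).symm
  have h6 : (toMat x).det * ((toMat x)⁻¹ * toMat h).trace / (2 * Real.sqrt (toMat x).det) =
      Real.sqrt (toMat x).det * (1 / 2 * ((toMat x)⁻¹ * toMat h).trace) := by
    rw [div_eq_iff (by positivity)]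
    conv_lhs => rw [hsq]
    ring
  rw [h6]
  ring

/-! ### Calculus of approximable functions -/

theorem Approx.congr {K : Set (Model n)} (hK : IsCompact K) {f f' : Model n → ℝ}
    {df df' : Fin n → Model n → ℝ} (hf : Approx K f df) (h : ∀ y ∈ K, f y = f' y)
    (hd : ∀ i, ∀ y ∈ K, df i y = df' i y) : Approx K f' df' := by
  obtain ⟨s, h1, h2, h3⟩ := hf
  refine ⟨s, h1, h2.congr_right h, fun i => (h3 i).congr_ae (fun m => EventuallyEq.rfl) ?_⟩
  rw [EventuallyEq, ae_restrict_iff' hK.measurableSet]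
  exact Eventually.of_forall fun y hy => hd i y hy

theorem Approx.mul {K : Set (Model n)} (hK : IsCompact K) {f g : Model n → ℝ}
    {df dg : Fin n → Model n → ℝ} (hf : Approx K f df) (hg : Approx K g dg) :
    Approx K (fun y => f y * g y) (fun i y => f y * dg i y + g y * df i y) := by
  have h := Approx.comp hK (ι := Fin 2) (U := ![f, g]) (V := ![df, dg])
    (fun k => by fin_cases k; exacts [hf, hg]) (F := fun x => x 0 * x 1) isOpen_univ
    ((contDiff_apply ℝ ℝ 0).mul (contDiff_apply ℝ ℝ 1)).contDiffOn (fun _ _ => mem_univ _)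
  refine h.congr hK (fun y _ => rfl) fun i y _ => ?_
  have e : HasFDerivAt (fun x : Fin 2 → ℝ => x 0 * x 1) _ (fun k => ![f, g] k y) :=
    (hasFDerivAt_apply (𝕜 := ℝ) (0 : Fin 2) _).mul (hasFDerivAt_apply (𝕜 := ℝ) (1 : Fin 2) _)
  rw [e.fderiv]
  simp

theorem Approx.log_sub_log {K : Set (Model n)} (hK : IsCompact K) {f g : Model n → ℝ}
    {df dg : Fin n → Model n → ℝ} (hf : Approx K f df) (hg : Approx K g dg)
    (hf0 : ∀ y ∈ K, 0 < f y) (hg0 : ∀ y ∈ K, 0 < g y) :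
    Approx K (fun y => Real.log (f y) - Real.log (g y))
      (fun i y => df i y / f y - dg i y / g y) := by
  have hO : IsOpen {x : Fin 2 → ℝ | 0 < x 0 ∧ 0 < x 1} :=
    (isOpen_lt continuous_const (continuous_apply _)).inter
      (isOpen_lt continuous_const (continuous_apply _))
  have h := Approx.comp hK (ι := Fin 2) (U := ![f, g]) (V := ![df, dg])
    (fun k => by fin_cases k; exacts [hf, hg]) (F := fun x => Real.log (x 0) - Real.log (x 1)) hO
    (((contDiff_apply ℝ ℝ 0).contDiffOn.log fun x hx => hx.1.ne').sub
      ((contDiff_apply ℝ ℝ 1).contDiffOn.log fun x hx => hx.2.ne')) (fun y hy => ⟨hf0 y hy, hg0 y hy⟩)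
  refine h.congr hK (fun y _ => rfl) fun i y hy => ?_
  have a0 : (fun k => ![f, g] k y) 0 ≠ 0 := (hf0 y hy).ne'
  have a1 : (fun k => ![f, g] k y) 1 ≠ 0 := (hg0 y hy).ne'
  have e : HasFDerivAt (fun x : Fin 2 → ℝ => Real.log (x 0) - Real.log (x 1)) _
      (fun k => ![f, g] k y) :=
    ((hasFDerivAt_apply (𝕜 := ℝ) (0 : Fin 2) (fun k => ![f, g] k y)).log a0).fun_sub
      ((hasFDerivAt_apply (𝕜 := ℝ) (1 : Fin 2) (fun k => ![f, g] k y)).log a1)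
  rw [e.fderiv]
  simp [div_eq_inv_mul]

/-! ### The divergence form of the Laplace operator -/

/-- The components of a metric on `Ω` are of class `C⁰ ∩ W^{2,1}_loc` and form symmetric matrices
of positive determinant. -/
structure IsMetricField (Ω : Set (Model n)) (g : Model n → Matrix (Fin n) (Fin n) ℝ) : Prop where
  isW21 : ∀ i j, IsW21 Ω (fun y => g y i j)
  symm : ∀ y i j, g y i j = g y j i
  det_pos : ∀ y ∈ Ω, 0 < (g y).det

/-- The derivatives of the densitized inverse metric `√(det g) g⁻¹`. -/
def dDensInv (Ω : Set (Model n)) (g : Model n → Matrix (Fin n) (Fin n) ℝ) (i j k : Fin n)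
    (y : Model n) : ℝ :=
  Real.sqrt (g y).det *
    (1 / 2 * ((g y)⁻¹ * Matrix.of fun a b => weakPartial Ω k (fun z => g z a b) y).trace *
      (g y)⁻¹ i j -
      ((g y)⁻¹ * (Matrix.of fun a b => weakPartial Ω k (fun z => g z a b) y) * (g y)⁻¹) i j)

theorem IsMetricField.approx_densInv {Ω K : Set (Model n)}
    {g : Model n → Matrix (Fin n) (Fin n) ℝ} (hg : IsMetricField Ω g) (hΩ : IsOpen Ω)
    (hK : IsCompact K) (hKΩ : K ⊆ Ω) (i j : Fin n) :
    Approx K (fun y => Real.sqrt (g y).det * (g y)⁻¹ i j) (dDensInv Ω g i j) := by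
  have e : ∀ y, toMat (fun p => g y p.1 p.2) = g y := fun y => by ext a b; simp [toMat]
  have h := Approx.comp hK (U := fun (p : Fin n × Fin n) y => g y p.1 p.2)
    (fun p => (hg.isW21 p.1 p.2).approx hΩ hK hKΩ) (F := densInv i j) isOpen_det_pos
    ((contDiffOn_densInv i j).of_le (by simp)) (fun y hy => by
      simpa only [mem_ofPred_eq, e] using hg.det_pos y (hKΩ hy))
  refine h.congr hK (fun y _ => by simp only [densInv, e]) fun k y hy => ?_
  rw [fderiv_densInv (by simpa only [e] using hg.det_pos y (hKΩ hy))]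
  simp only [e, dDensInv]
  rfl

theorem IsMetricField.inv_symm {Ω : Set (Model n)} {g : Model n → Matrix (Fin n) (Fin n) ℝ}
    (hg : IsMetricField Ω g) (y : Model n) (i j : Fin n) : (g y)⁻¹ i j = (g y)⁻¹ j i := by
  have h : (g y).transpose = g y := by ext a b; exact hg.symm y b a
  have := Matrix.transpose_nonsing_inv (g y)
  rw [h] at this
  exact (congrFun (congrFun this j) i)

/-- Contracting the Christoffel symbol with `g^{kl}` makes its first two terms equal by symmetry;
they match the derivative of `g⁻¹`, and the third term matches the derivative of `√(det g)`. This
identity turns the Laplace operator into divergence form. -/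
theorem IsMetricField.sum_dDensInv {Ω : Set (Model n)} {g : Model n → Matrix (Fin n) (Fin n) ℝ}
    (hg : IsMetricField Ω g) (y : Model n) (j : Fin n) :
    ∑ i, dDensInv Ω g i j i y =
      - ∑ k, ∑ l, Real.sqrt (g y).det * (g y)⁻¹ k l * christoffel Ω g j k l y := by
  have hN := hg.inv_symm y
  set N := (g y)⁻¹ with hNdef
  set H : Fin n → Fin n → Fin n → ℝ := fun k a b => weakPartial Ω k (fun z => g z a b) y with hH
  have hHs : ∀ k a b, H k a b = H k b a := fun k a b => by
    simp only [hH, hg.symm _ a b]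
  have hl : ∑ i, dDensInv Ω g i j i y = Real.sqrt (g y).det *
      (1 / 2 * (∑ i, ∑ a, ∑ b, N a b * H i b a * N i j) - ∑ i, ∑ a, ∑ b, N i a * H i a b * N b j) := by
    rw [mul_sub, Finset.mul_sum, Finset.mul_sum, Finset.mul_sum, ← Finset.sum_sub_distrib]
    refine Finset.sum_congr rfl fun i _ => ?_
    simp only [dDensInv, ← hNdef, Matrix.trace, Matrix.diag, Matrix.mul_apply, Matrix.of_apply,
      mul_sub, Finset.mul_sum, Finset.sum_mul]
    congr 1
    · refine Finset.sum_congr rfl fun a _ => Finset.sum_congr rfl fun b _ => ?_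
      ring
    · rw [Finset.sum_comm]
  have hr : ∑ k, ∑ l, Real.sqrt (g y).det * N k l * christoffel Ω g j k l y =
      Real.sqrt (g y).det * (1 / 2 * ((∑ k, ∑ l, ∑ m, N k l * N j m * H k l m) +
        (∑ k, ∑ l, ∑ m, N k l * N j m * H l k m) - ∑ k, ∑ l, ∑ m, N k l * N j m * H m k l)) := by
    simp only [← Finset.sum_sub_distrib, ← Finset.sum_add_distrib, Finset.mul_sum, christoffel,
      ← hNdef]
    refine Finset.sum_congr rfl fun a _ => Finset.sum_congr rfl fun b _ =>
      Finset.sum_congr rfl fun c _ => ?_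
    simp only [hH]
    ring
  have t1 : ∑ k, ∑ l, ∑ m, N k l * N j m * H k l m = ∑ i, ∑ a, ∑ b, N i a * H i a b * N b j := by
    refine Finset.sum_congr rfl fun a _ => Finset.sum_congr rfl fun b _ =>
      Finset.sum_congr rfl fun c _ => ?_
    rw [hN j c]; ring
  have t2 : ∑ k, ∑ l, ∑ m, N k l * N j m * H l k m = ∑ i, ∑ a, ∑ b, N i a * H i a b * N b j := by
    rw [← t1, Finset.sum_comm]
    refine Finset.sum_congr rfl fun a _ => Finset.sum_congr rfl fun b _ =>
      Finset.sum_congr rfl fun c _ => ?_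
    rw [hN b a]
  have t3 : ∑ k, ∑ l, ∑ m, N k l * N j m * H m k l = ∑ i, ∑ a, ∑ b, N a b * H i b a * N i j := by
    have e : ∀ f : Fin n → Fin n → Fin n → ℝ, ∑ k, ∑ l, ∑ m, f k l m = ∑ m, ∑ k, ∑ l, f k l m := by
      intro f
      refine (Finset.sum_congr rfl fun a _ => Finset.sum_comm).trans ?_
      exact Finset.sum_comm
    rw [e]
    refine Finset.sum_congr rfl fun a _ => Finset.sum_congr rfl fun b _ =>
      Finset.sum_congr rfl fun c _ => ?_
    rw [hHs a b c, hN j a]; ring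
  rw [hl, hr, t1, t2, t3]
  ring

/-! ### Green's identity in a coordinate domain -/

/-- The right side is the product-rule expansion of `∂ᵢ(√g g^{ij} ∂ⱼu)`, kept expanded so that no
weak derivative of the product itself is needed. -/
theorem IsMetricField.laplacian_eq {Ω : Set (Model n)} {g : Model n → Matrix (Fin n) (Fin n) ℝ}
    (hg : IsMetricField Ω g) (u : Model n → ℝ) (y : Model n) :
    Real.sqrt (g y).det * laplacian Ω g u y =
      ∑ i, ∑ j, (Real.sqrt (g y).det * (g y)⁻¹ i j * weakPartial Ω i (weakPartial Ω j u) y +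
        dDensInv Ω g i j i y * weakPartial Ω j u y) := by
  have h1 : ∑ i, ∑ j, dDensInv Ω g i j i y * weakPartial Ω j u y =
      - ∑ j, ∑ k, ∑ l, Real.sqrt (g y).det * (g y)⁻¹ k l * christoffel Ω g j k l y *
        weakPartial Ω j u y := by
    rw [Finset.sum_comm, ← Finset.sum_neg_distrib]
    refine Finset.sum_congr rfl fun j _ => ?_
    rw [← Finset.sum_mul, hg.sum_dDensInv, neg_mul, Finset.sum_mul]
    simp only [Finset.sum_mul]
  have h2 : ∑ j, ∑ k, ∑ l, Real.sqrt (g y).det * (g y)⁻¹ k l * christoffel Ω g j k l y *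
        weakPartial Ω j u y = ∑ k, ∑ l, ∑ j, Real.sqrt (g y).det * (g y)⁻¹ k l *
        christoffel Ω g j k l y * weakPartial Ω j u y := by
    rw [Finset.sum_comm]
    exact Finset.sum_congr rfl fun _ _ => Finset.sum_comm
  simp only [Finset.sum_add_distrib]
  rw [h1, h2, laplacian, ← sub_eq_add_neg]
  simp only [Finset.mul_sum, ← Finset.sum_sub_distrib, mul_sub]
  refine Finset.sum_congr rfl fun i _ => Finset.sum_congr rfl fun j _ => ?_
  congr 1
  · ring
  · exact Finset.sum_congr rfl fun k _ => by ring

/-- This is the divergence form tested against `θ ρ`, where `ρ` localizes to the chart and `θ` is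
merely approximable. -/
theorem IsMetricField.green {Ω K : Set (Model n)} {g : Model n → Matrix (Fin n) (Fin n) ℝ}
    (hg : IsMetricField Ω g) (hΩ : IsOpen Ω) (hK : IsCompact K) (hKΩ : K ⊆ Ω) {ρ : Model n → ℝ}
    (hρ : ContDiff ℝ ∞ ρ) (hρK : tsupport ρ ⊆ K) {θ : Model n → ℝ} {dθ : Fin n → Model n → ℝ}
    (hθ : Approx K θ dθ) {u : Model n → ℝ} (hu : IsW21 Ω u) :
    IntegrableOn (fun y => θ y * ρ y * (Real.sqrt (g y).det * laplacian Ω g u y) +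
      ∑ i, ∑ j, Real.sqrt (g y).det * (g y)⁻¹ i j * weakPartial Ω j u y *
        (θ y * fderiv ℝ ρ y (basisVec i) + ρ y * dθ i y)) K ∧
    ∫ y in K, (θ y * ρ y * (Real.sqrt (g y).det * laplacian Ω g u y) +
      ∑ i, ∑ j, Real.sqrt (g y).det * (g y)⁻¹ i j * weakPartial Ω j u y *
        (θ y * fderiv ℝ ρ y (basisVec i) + ρ y * dθ i y)) = 0 := by
  have hA := fun i j => (hg.approx_densInv hΩ hK hKΩ i j).mul hK hθ
  set P : Fin n → Fin n → Model n → ℝ := fun i j y => Real.sqrt (g y).det * (g y)⁻¹ i j * θ y *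
    (ρ y * weakPartial Ω i (weakPartial Ω j u) y) with hP
  set Q : Fin n → Fin n → Model n → ℝ := fun i j y => Real.sqrt (g y).det * (g y)⁻¹ i j * θ y *
    (weakPartial Ω j u y * fderiv ℝ ρ y (basisVec i)) +
    (Real.sqrt (g y).det * (g y)⁻¹ i j * dθ i y + θ y * dDensInv Ω g i j i y) *
      (ρ y * weakPartial Ω j u y) with hQ
  -- The integrand is regrouped so that for each `i`, `j` the term `P i j` carries the second
  -- derivative and `Q i j` is what integration by parts with the factor `√g g^{ij} θ` produces.
  -- Hence the integrals cancel term by term.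
  have e : ∀ y, θ y * ρ y * (Real.sqrt (g y).det * laplacian Ω g u y) +
      ∑ i, ∑ j, Real.sqrt (g y).det * (g y)⁻¹ i j * weakPartial Ω j u y *
        (θ y * fderiv ℝ ρ y (basisVec i) + ρ y * dθ i y) = ∑ i, ∑ j, (P i j y + Q i j y) := by
    intro y
    rw [hg.laplacian_eq]
    simp only [Finset.mul_sum, ← Finset.sum_add_distrib]
    refine Finset.sum_congr rfl fun i _ => Finset.sum_congr rfl fun j _ => ?_
    simp only [hP, hQ]
    ring
  simp only [e]
  have hdu : ∀ j, MemLp (weakPartial Ω j u) 2 (volume.restrict K) :=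
    (hu.approx hΩ hK hKΩ).memLp
  have := isFiniteMeasure_restrict hK
  have iP : ∀ i j, IntegrableOn (P i j) K := fun i j =>
    (((hu.partial_two j i).2.1.integrableOn_compact_subset hKΩ hK).continuousOn_mul
      hρ.continuous.continuousOn hK).continuousOn_mul (hA i j).continuousOn hK
  have iQ : ∀ i j, IntegrableOn (Q i j) K := fun i j => by
    have h1 : IntegrableOn (weakPartial Ω j u) K := (hdu j).integrable one_le_two
    have h2 : IntegrableOn (fun y => (Real.sqrt (g y).det * (g y)⁻¹ i j * dθ i y +
      θ y * dDensInv Ω g i j i y) * weakPartial Ω j u y) K :=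
      MemLp.integrable_mul ((hA i j).memLp i) (hdu j)
    refine Integrable.add ((h1.mul_continuousOn
      (contDiff_fderiv_apply hρ (basisVec i)).continuous.continuousOn hK).continuousOn_mul
      (hA i j).continuousOn hK) ?_
    refine (h2.continuousOn_mul hρ.continuous.continuousOn hK).congr_fun (fun y _ => ?_)
      hK.measurableSet
    ring
  have iPQ : ∀ i j, IntegrableOn (fun y => P i j y + Q i j y) K := fun i j => (iP i j).add (iQ i j)
  refine ⟨integrable_finsetSum _ fun i _ => integrable_finsetSum _ fun j _ => iPQ i j, ?_⟩
  rw [integral_finsetSum _ fun i _ => integrable_finsetSum _ fun j _ => iPQ i j]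
  refine Finset.sum_eq_zero fun i _ => ?_
  rw [integral_finsetSum _ fun j _ => iPQ i j]
  refine Finset.sum_eq_zero fun j _ => ?_
  rw [integral_add (iP i j) (iQ i j)]
  have := (hA i j).integral_mul_weakPartial hΩ hK hKΩ hρ hρK hu j i
  simp only [hP, hQ]
  linarith

/-- The gradient of `log φ₁ - log φ₂`. -/
def logGrad (Ω : Set (Model n)) (φ₁ φ₂ : Model n → ℝ) (i : Fin n) (y : Model n) : ℝ :=
  weakPartial Ω i φ₁ y / φ₁ y - weakPartial Ω i φ₂ y / φ₂ y

/-- The squared norm of the gradient of `log φ₁ - log φ₂`. -/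
def logEnergy (Ω : Set (Model n)) (g : Model n → Matrix (Fin n) (Fin n) ℝ) (φ₁ φ₂ : Model n → ℝ)
    (y : Model n) : ℝ :=
  ∑ i, ∑ j, (g y)⁻¹ i j * (logGrad Ω φ₁ φ₂ i y * logGrad Ω φ₁ φ₂ j y)

/-- The density `√(det g) (ζ (φ₂ Δφ₁ - φ₁ Δφ₂) + φ₁ φ₂ |∇ζ|²)` for `ζ = log φ₁ - log φ₂`. -/
def bulk (Ω : Set (Model n)) (g : Model n → Matrix (Fin n) (Fin n) ℝ) (φ₁ φ₂ : Model n → ℝ)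
    (y : Model n) : ℝ :=
  Real.sqrt (g y).det * ((Real.log (φ₁ y) - Real.log (φ₂ y)) *
    (φ₂ y * laplacian Ω g φ₁ y - φ₁ y * laplacian Ω g φ₂ y) +
    φ₁ y * φ₂ y * logEnergy Ω g φ₁ φ₂ y)

/-- The density `√(det g) ζ φ₁ φ₂ ⟨∇ζ, ξ⟩` for `ζ = log φ₁ - log φ₂` and a covector `ξ`. -/
def flux (Ω : Set (Model n)) (g : Model n → Matrix (Fin n) (Fin n) ℝ) (φ₁ φ₂ : Model n → ℝ)
    (y : Model n) (ξ : Fin n → ℝ) : ℝ :=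
  Real.sqrt (g y).det * ((Real.log (φ₁ y) - Real.log (φ₂ y)) * (φ₁ y * φ₂ y) *
    ∑ i, ∑ j, (g y)⁻¹ i j * (ξ i * logGrad Ω φ₁ φ₂ j y))

section Green

variable {Ω K : Set (Model n)} {g : Model n → Matrix (Fin n) (Fin n) ℝ} {φ₁ φ₂ : Model n → ℝ}

theorem approx_log (hΩ : IsOpen Ω) (hK : IsCompact K)
    (hKΩ : K ⊆ Ω) (h₁ : IsW21 Ω φ₁) (h₂ : IsW21 Ω φ₂) (p₁ : ∀ y, 0 < φ₁ y) (p₂ : ∀ y, 0 < φ₂ y) :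
    Approx K (fun y => Real.log (φ₁ y) - Real.log (φ₂ y)) (logGrad Ω φ₁ φ₂) :=
  (h₁.approx hΩ hK hKΩ).log_sub_log hK (h₂.approx hΩ hK hKΩ) (fun y _ => p₁ y) (fun y _ => p₂ y)

theorem IsMetricField.integrableOn_flux (hg : IsMetricField Ω g) (hΩ : IsOpen Ω)
    (hK : IsCompact K) (hKΩ : K ⊆ Ω) (h₁ : IsW21 Ω φ₁) (h₂ : IsW21 Ω φ₂) (p₁ : ∀ y, 0 < φ₁ y)
    (p₂ : ∀ y, 0 < φ₂ y) {ξ : Model n → Fin n → ℝ} (hξ : ∀ i, ContinuousOn (fun y => ξ y i) K) :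
    IntegrableOn (fun y => flux Ω g φ₁ φ₂ y (ξ y)) K := by
  have := isFiniteMeasure_restrict hK
  have hl := approx_log hΩ hK hKΩ h₁ h₂ p₁ p₂
  have hA := fun i j => (hg.approx_densInv hΩ hK hKΩ i j).continuousOn
  have h : ∀ i j, IntegrableOn (fun y => (Real.sqrt (g y).det * (g y)⁻¹ i j) *
      (((Real.log (φ₁ y) - Real.log (φ₂ y)) * (φ₁ y * φ₂ y)) * (ξ y i *
        logGrad Ω φ₁ φ₂ j y))) K := fun i j => by
    have h0 : IntegrableOn (logGrad Ω φ₁ φ₂ j) K := (hl.memLp j).integrable one_le_two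
    exact ((h0.continuousOn_mul (hξ i) hK).continuousOn_mul (hl.continuousOn.mul
      ((h₁.continuousOn.mono hKΩ).mul (h₂.continuousOn.mono hKΩ))) hK).continuousOn_mul (hA i j) hK
  have hs : IntegrableOn (fun y => ∑ i, ∑ j, (Real.sqrt (g y).det * (g y)⁻¹ i j) *
      (((Real.log (φ₁ y) - Real.log (φ₂ y)) * (φ₁ y * φ₂ y)) * (ξ y i *
        logGrad Ω φ₁ φ₂ j y))) K :=
    integrable_finsetSum _ fun i _ => integrable_finsetSum _ fun j _ => h i j
  refine hs.congr_fun (fun y _ => ?_) hK.measurableSet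
  simp only [flux, Finset.mul_sum]
  exact Finset.sum_congr rfl fun i _ => Finset.sum_congr rfl fun j _ => by ring

/-- Green's identity for `φ₁` with `θ = ζ φ₂` is subtracted from or paired with that for `φ₂` with
`θ = ζ φ₁`; the difference combines the gradients into `φ₂∇φ₁ - φ₁∇φ₂ = φ₁φ₂∇ζ`. -/
theorem IsMetricField.bulk_add_flux (hg : IsMetricField Ω g) (hΩ : IsOpen Ω)
    (hK : IsCompact K) (hKΩ : K ⊆ Ω) (h₁ : IsW21 Ω φ₁) (h₂ : IsW21 Ω φ₂) (p₁ : ∀ y, 0 < φ₁ y)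
    (p₂ : ∀ y, 0 < φ₂ y) {ρ : Model n → ℝ} (hρ : ContDiff ℝ ∞ ρ) (hρK : tsupport ρ ⊆ K) :
    IntegrableOn (fun y => ρ y * bulk Ω g φ₁ φ₂ y) K ∧
    ∫ y in K, ρ y * bulk Ω g φ₁ φ₂ y =
      - ∫ y in K, flux Ω g φ₁ φ₂ y (fun i => fderiv ℝ ρ y (basisVec i)) := by
  have hl := approx_log hΩ hK hKΩ h₁ h₂ p₁ p₂
  have G₁ := hg.green hΩ hK hKΩ hρ hρK (hl.mul hK (h₂.approx hΩ hK hKΩ)) h₁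
  have G₂ := hg.green hΩ hK hKΩ hρ hρK (hl.mul hK (h₁.approx hΩ hK hKΩ)) h₂
  have hf := hg.integrableOn_flux hΩ hK hKΩ h₁ h₂ p₁ p₂
    (ξ := fun y i => fderiv ℝ ρ y (basisVec i))
    (fun i => (contDiff_fderiv_apply hρ (basisVec i)).continuous.continuousOn)
  have key := integral_sub G₁.1 G₂.1
  rw [G₁.2, G₂.2, sub_zero] at key
  have hi := G₁.1.sub G₂.1
  have e : ∀ y, (Real.log (φ₁ y) - Real.log (φ₂ y)) * φ₂ y * ρ y *
      (Real.sqrt (g y).det * laplacian Ω g φ₁ y) +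
      ∑ i, ∑ j, Real.sqrt (g y).det * (g y)⁻¹ i j * weakPartial Ω j φ₁ y *
        ((Real.log (φ₁ y) - Real.log (φ₂ y)) * φ₂ y * fderiv ℝ ρ y (basisVec i) +
        ρ y * ((Real.log (φ₁ y) - Real.log (φ₂ y)) * weakPartial Ω i φ₂ y +
          φ₂ y * logGrad Ω φ₁ φ₂ i y)) -
      ((Real.log (φ₁ y) - Real.log (φ₂ y)) * φ₁ y * ρ y *
      (Real.sqrt (g y).det * laplacian Ω g φ₂ y) +
      ∑ i, ∑ j, Real.sqrt (g y).det * (g y)⁻¹ i j * weakPartial Ω j φ₂ y *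
        ((Real.log (φ₁ y) - Real.log (φ₂ y)) * φ₁ y * fderiv ℝ ρ y (basisVec i) +
        ρ y * ((Real.log (φ₁ y) - Real.log (φ₂ y)) * weakPartial Ω i φ₁ y +
          φ₁ y * logGrad Ω φ₁ φ₂ i y))) =
      ρ y * bulk Ω g φ₁ φ₂ y + flux Ω g φ₁ φ₂ y (fun i => fderiv ℝ ρ y (basisVec i)) := by
    intro y
    set ζ := Real.log (φ₁ y) - Real.log (φ₂ y) with hζ
    -- The terms `ρ ζ ⟨∇φ₁, ∇φ₂⟩` from the two identities cancel because `g⁻¹` is symmetric.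
    have hanti : ∑ i, ∑ j, Real.sqrt (g y).det * (g y)⁻¹ i j * (ρ y * ζ) *
        (weakPartial Ω j φ₁ y * weakPartial Ω i φ₂ y) =
        ∑ i, ∑ j, Real.sqrt (g y).det * (g y)⁻¹ i j * (ρ y * ζ) *
        (weakPartial Ω j φ₂ y * weakPartial Ω i φ₁ y) := by
      rw [Finset.sum_comm]
      refine Finset.sum_congr rfl fun i _ => Finset.sum_congr rfl fun j _ => ?_
      rw [hg.inv_symm y j i]; ring
    have hgrad : ∀ j, φ₁ y * φ₂ y * logGrad Ω φ₁ φ₂ j y =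
        φ₂ y * weakPartial Ω j φ₁ y - φ₁ y * weakPartial Ω j φ₂ y := fun j => by
      have := (p₁ y).ne'
      have := (p₂ y).ne'
      rw [logGrad]; field_simp
    have s1 : ∑ i, ∑ j, Real.sqrt (g y).det * (g y)⁻¹ i j * weakPartial Ω j φ₁ y *
        (ζ * φ₂ y * fderiv ℝ ρ y (basisVec i) +
        ρ y * (ζ * weakPartial Ω i φ₂ y + φ₂ y * logGrad Ω φ₁ φ₂ i y)) -
      ∑ i, ∑ j, Real.sqrt (g y).det * (g y)⁻¹ i j * weakPartial Ω j φ₂ y *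
        (ζ * φ₁ y * fderiv ℝ ρ y (basisVec i) +
        ρ y * (ζ * weakPartial Ω i φ₁ y + φ₁ y * logGrad Ω φ₁ φ₂ i y)) =
      (∑ i, ∑ j, Real.sqrt (g y).det * (g y)⁻¹ i j * (φ₁ y * φ₂ y * logGrad Ω φ₁ φ₂ j y) *
        (ζ * fderiv ℝ ρ y (basisVec i) + ρ y * logGrad Ω φ₁ φ₂ i y)) +
      (∑ i, ∑ j, Real.sqrt (g y).det * (g y)⁻¹ i j * (ρ y * ζ) *
        (weakPartial Ω j φ₁ y * weakPartial Ω i φ₂ y) -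
        ∑ i, ∑ j, Real.sqrt (g y).det * (g y)⁻¹ i j * (ρ y * ζ) *
        (weakPartial Ω j φ₂ y * weakPartial Ω i φ₁ y)) := by
      simp only [← Finset.sum_sub_distrib, ← Finset.sum_add_distrib, hgrad]
      exact Finset.sum_congr rfl fun i _ => Finset.sum_congr rfl fun j _ => by ring
    rw [hanti, sub_self, add_zero] at s1
    have s2 : ∑ i, ∑ j, Real.sqrt (g y).det * (g y)⁻¹ i j *
        (φ₁ y * φ₂ y * logGrad Ω φ₁ φ₂ j y) *
        (ζ * fderiv ℝ ρ y (basisVec i) + ρ y * logGrad Ω φ₁ φ₂ i y) =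
        ρ y * (Real.sqrt (g y).det * (φ₁ y * φ₂ y * logEnergy Ω g φ₁ φ₂ y)) +
        flux Ω g φ₁ φ₂ y (fun i => fderiv ℝ ρ y (basisVec i)) := by
      simp only [logEnergy, flux, Finset.mul_sum, ← Finset.sum_add_distrib, ← hζ]
      exact Finset.sum_congr rfl fun i _ => Finset.sum_congr rfl fun j _ => by ring
    have s3 := s1.trans s2
    rw [bulk, ← hζ]
    linear_combination s3
  have hi' : IntegrableOn (fun y => ρ y * bulk Ω g φ₁ φ₂ y +
      flux Ω g φ₁ φ₂ y (fun i => fderiv ℝ ρ y (basisVec i))) K :=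
    hi.congr_fun (fun y _ => e y) hK.measurableSet
  have hb : IntegrableOn (fun y => ρ y * bulk Ω g φ₁ φ₂ y) K :=
    (hi'.sub hf).congr_fun (fun y _ => by simp) hK.measurableSet
  refine ⟨hb, ?_⟩
  simp only [e] at key
  rw [integral_add hb hf] at key
  linarith

end Green

/-! ### Changes of coordinates -/

/-- A diffeomorphism between open subsets of `ℝⁿ`. -/
structure IsDiffeo (T : OpenPartialHomeomorph (Model n) (Model n)) : Prop where
  contDiffOn : ContDiffOn ℝ ∞ T T.source
  contDiffOn_symm : ContDiffOn ℝ ∞ T.symm T.target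

/-- The Jacobian matrix `J i j = ∂ᵢ Tⱼ`. -/
def jac (T : OpenPartialHomeomorph (Model n) (Model n)) (y : Model n) : Matrix (Fin n) (Fin n) ℝ :=
  Matrix.of fun i j => (fderiv ℝ T y (basisVec i)) j

theorem det_fderiv_eq_det_jac (T : OpenPartialHomeomorph (Model n) (Model n)) (y : Model n) :
    (fderiv ℝ T y).det = (jac T y).det := by
  set b := (EuclideanSpace.basisFun (Fin n) ℝ).toBasis
  have h : jac T y = (LinearMap.toMatrix b b (fderiv ℝ T y : Model n →ₗ[ℝ] Model n)).transpose := by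
    ext i j
    simp [jac, LinearMap.toMatrix_apply, b, basisVec]
  rw [h, Matrix.det_transpose, LinearMap.det_toMatrix]

theorem eq_sum_basisVec (z : Model n) : z = ∑ j, z j • basisVec j := by
  have := (EuclideanSpace.basisFun (Fin n) ℝ).sum_repr z
  simpa [basisVec] using this.symm

theorem apply_eq_sum_basisVec {F : Type*} [NormedAddCommGroup F] [NormedSpace ℝ F]
    (L : Model n →L[ℝ] F) (z : Model n) : L z = ∑ j, z j • L (basisVec j) := by
  conv_lhs => rw [eq_sum_basisVec z]
  simp [map_sum]

namespace IsDiffeo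

variable {T : OpenPartialHomeomorph (Model n) (Model n)} (hT : IsDiffeo T)
include hT

theorem contDiffAt {y : Model n} (hy : y ∈ T.source) : ContDiffAt ℝ ∞ T y :=
  hT.contDiffOn.contDiffAt (T.open_source.mem_nhds hy)

theorem hasFDerivAt {y : Model n} (hy : y ∈ T.source) : HasFDerivAt T (fderiv ℝ T y) y :=
  ((hT.contDiffAt hy).differentiableAt (by simp)).hasFDerivAt

theorem det_ne_zero {y : Model n} (hy : y ∈ T.source) : (fderiv ℝ T y).det ≠ 0 := by
  have hy' := T.map_source hy
  have h1 : HasFDerivAt T.symm (fderiv ℝ T.symm (T y)) (T y) :=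
    ((hT.contDiffOn_symm.contDiffAt (T.open_target.mem_nhds hy')).differentiableAt
      (by simp)).hasFDerivAt
  have h2 := h1.comp y (hT.hasFDerivAt hy)
  have h3 : HasFDerivAt (T.symm ∘ T) (ContinuousLinearMap.id ℝ (Model n)) y := by
    refine (hasFDerivAt_id y).congr_of_eventuallyEq ?_
    filter_upwards [T.open_source.mem_nhds hy] with z hz using T.left_inv hz
  have h4 := h2.unique h3
  intro h0
  have h5 := congrArg (fun L : Model n →L[ℝ] Model n => LinearMap.det (L : Model n →ₗ[ℝ] Model n)) h4
  simp only [ContinuousLinearMap.toLinearMap_comp, LinearMap.det_comp] at h5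
  have h6 : LinearMap.det (fderiv ℝ T y : Model n →ₗ[ℝ] Model n) = 0 := h0
  rw [h6, mul_zero] at h5
  simp at h5

theorem continuousOn_fderiv : ContinuousOn (fderiv ℝ T) T.source :=
  hT.contDiffOn.continuousOn_fderiv_of_isOpen T.open_source (by simp)

theorem continuousOn_jac (i j : Fin n) : ContinuousOn (fun y => jac T y i j) T.source := by
  have h := hT.continuousOn_fderiv.clm_apply (continuousOn_const (c := basisVec i))
  exact (EuclideanSpace.proj (𝕜 := ℝ) j).continuous.comp_continuousOn h

theorem continuousOn_det : ContinuousOn (fun y => |(fderiv ℝ T y).det|) T.source :=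
  (ContinuousLinearMap.continuous_det.comp_continuousOn hT.continuousOn_fderiv).abs

theorem hasFDerivWithinAt {K : Set (Model n)} (hK : K ⊆ T.source) :
    ∀ y ∈ K, HasFDerivWithinAt T (fderiv ℝ T y) K y := fun _ hy =>
  (hT.hasFDerivAt (hK hy)).hasFDerivWithinAt

omit hT in
theorem injOn {K : Set (Model n)} (hK : K ⊆ T.source) : InjOn T K := T.injOn.mono hK

/-- On the compact set the Jacobian determinant attains a positive minimum `c`, and `C = 1 / c`
works in the change of variables formula. -/
theorem exists_lintegral_comp_le {K : Set (Model n)} (hK : IsCompact K) (hKT : K ⊆ T.source) :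
    ∃ C : ℝ≥0∞, C ≠ ⊤ ∧ ∀ F : Model n → ℝ≥0∞, ∫⁻ y in K, F (T y) ≤ C * ∫⁻ z in T '' K, F z := by
  rcases K.eq_empty_or_nonempty with rfl | hne
  · exact ⟨0, by simp, fun F => by simp⟩
  obtain ⟨y₀, hy₀, hmin⟩ := hK.exists_isMinOn hne (hT.continuousOn_det.mono hKT)
  set c := |(fderiv ℝ T y₀).det| with hc
  have hc0 : 0 < c := abs_pos.2 (hT.det_ne_zero (hKT hy₀))
  refine ⟨(ENNReal.ofReal c)⁻¹, by simpa using hc0, fun F => ?_⟩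
  rw [lintegral_image_eq_lintegral_abs_det_fderiv_mul volume hK.measurableSet
    (hT.hasFDerivWithinAt hKT) (injOn hKT), ← lintegral_const_mul' _ _ (by simpa using hc0)]
  refine setLIntegral_mono' hK.measurableSet fun y hy => ?_
  rw [← mul_assoc]
  refine le_mul_of_one_le_left zero_le ?_
  rw [mul_comm, ← div_eq_mul_inv, ENNReal.le_div_iff_mul_le (by simp [hc0]) (by simp), one_mul]
  exact ENNReal.ofReal_le_ofReal (hmin hy)

/-- The change of variables formula gives measurability of `|det DT| · f ∘ T`; dividing by the
continuous nonvanishing Jacobian leaves `f ∘ T`. -/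
theorem aestronglyMeasurable_comp {K : Set (Model n)} (hK : IsCompact K) (hKT : K ⊆ T.source)
    {f : Model n → ℝ} (hf : IntegrableOn f (T '' K)) :
    AEStronglyMeasurable (fun y => f (T y)) (volume.restrict K) := by
  have h := (integrableOn_image_iff_integrableOn_abs_det_fderiv_smul volume hK.measurableSet
    (hT.hasFDerivWithinAt hKT) (injOn hKT) f).1 hf
  have hc : ContinuousOn (fun y => |(fderiv ℝ T y).det|⁻¹) K :=
    (hT.continuousOn_det.mono hKT).inv₀ fun y hy => abs_ne_zero.2 (hT.det_ne_zero (hKT hy))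
  refine ((hc.aestronglyMeasurable hK.measurableSet).mul h.1).congr ?_
  rw [EventuallyEq, ae_restrict_iff' hK.measurableSet]
  refine Eventually.of_forall fun y hy => ?_
  have := abs_ne_zero.2 (hT.det_ne_zero (hKT hy))
  simp only [Pi.mul_apply, smul_eq_mul]
  field_simp

theorem lpConv_comp {K : Set (Model n)} (hK : IsCompact K) (hKT : K ⊆ T.source)
    {s : ℕ → Model n → ℝ} {v : Model n → ℝ} (h : LpConv 2 (volume.restrict (T '' K)) s v) :
    LpConv 2 (volume.restrict K) (fun m y => s m (T y)) (fun y => v (T y)) := by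
  have hK' : IsCompact (T '' K) := hK.image_of_continuousOn (T.continuousOn.mono hKT)
  have := isFiniteMeasure_restrict hK'
  obtain ⟨C, hC, hb⟩ := hT.exists_lintegral_comp_le hK hKT
  have hle : ∀ f : Model n → ℝ, eLpNorm (fun y => f (T y)) 2 (volume.restrict K) ≤
      C ^ (1 / 2 : ℝ) * eLpNorm f 2 (volume.restrict (T '' K)) := by
    intro f
    rw [eLpNorm_eq_lintegral_rpow_enorm_toReal (by simp) (by simp),
      eLpNorm_eq_lintegral_rpow_enorm_toReal (by simp) (by simp), ENNReal.toReal_ofNat,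
      ← ENNReal.mul_rpow_of_nonneg _ _ (by norm_num)]
    exact ENNReal.rpow_le_rpow (hb fun z => ‖f z‖ₑ ^ (2 : ℝ)) (by norm_num)
  have hCr : C ^ (1 / 2 : ℝ) ≠ ⊤ := ENNReal.rpow_ne_top_of_nonneg (by norm_num) hC
  have hmem : ∀ {f : Model n → ℝ}, MemLp f 2 (volume.restrict (T '' K)) →
      MemLp (fun y => f (T y)) 2 (volume.restrict K) := fun {f} hf =>
    ⟨hT.aestronglyMeasurable_comp hK hKT (hf.integrable one_le_two),
      (hle f).trans_lt (ENNReal.mul_lt_top hCr.lt_top hf.2)⟩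
  refine ⟨fun m => hmem (h.memLp_seq m), hmem h.memLp, ?_⟩
  have hz := ENNReal.Tendsto.const_mul h.tendsto (a := C ^ (1 / 2 : ℝ)) (Or.inr hCr)
  rw [mul_zero] at hz
  exact tendsto_of_tendsto_of_tendsto_of_le_of_le tendsto_const_nhds hz (fun _ => zero_le)
    (fun m => hle (s m - v))

theorem approx_comp {K : Set (Model n)} (hK : IsCompact K) (hKT : K ⊆ T.source)
    {u : Model n → ℝ} {v : Fin n → Model n → ℝ} (h : Approx (T '' K) u v) :
    Approx K (fun y => u (T y)) (fun i y => ∑ j, jac T y i j * v j (T y)) := by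
  obtain ⟨s, h1, h2, h3⟩ := h
  have hTat : ∀ y ∈ K, ContDiffAt ℝ 1 T y := fun y hy => (hT.contDiffAt (hKT hy)).of_le (by simp)
  refine ⟨fun m y => s m (T y), fun m y hy =>
    (h1 m _ (mem_image_of_mem _ hy)).comp y (hTat y hy), ?_, fun i => ?_⟩
  · rw [Metric.tendstoUniformlyOn_iff] at h2 ⊢
    intro ε hε
    filter_upwards [h2 ε hε] with m hm y hy using hm _ (mem_image_of_mem _ hy)
  · have main : LpConv 2 (volume.restrict K)
        (fun m y => ∑ j, jac T y i j * fderiv ℝ (s m) (T y) (basisVec j))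
        (fun y => ∑ j, jac T y i j * v j (T y)) := by
      refine LpConv.sum one_le_two _ fun j _ => ?_
      exact LpConv.mul (q := ⊤) (t := 2) one_le_two (s := fun _ y => jac T y i j)
        (LpConv.const (memLp_restrict_of_continuousOn hK ((hT.continuousOn_jac i j).mono hKT) ⊤))
        (hT.lpConv_comp hK hKT (h3 j))
    refine main.congr_ae (fun m => ?_) EventuallyEq.rfl
    rw [EventuallyEq, ae_restrict_iff' hK.measurableSet]
    refine Eventually.of_forall fun y hy => ?_
    have d1 := ((h1 m _ (mem_image_of_mem _ hy)).differentiableAt (by simp)).hasFDerivAt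
    have d2 := (d1.comp y (hT.hasFDerivAt (hKT hy))).fderiv
    have e : (fun y => s m (T y)) = s m ∘ T := rfl
    beta_reduce
    rw [e, d2, ContinuousLinearMap.comp_apply, apply_eq_sum_basisVec]
    rfl

/-- The chain rule for weak derivatives under a change of coordinates. -/
theorem weakPartial_comp {Ω Ω' : Set (Model n)} (hΩ' : IsOpen Ω')
    (hTΩ : T.source ⊆ Ω) (hTΩ' : T.target ⊆ Ω') {u u' : Model n → ℝ} (hu : IsW21 Ω u)
    (hu' : IsW21 Ω' u') (huu' : ∀ y ∈ T.source, u y = u' (T y)) (i : Fin n) :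
    ∀ᵐ y ∂volume.restrict T.source, weakPartial Ω i u y =
      ∑ j, jac T y i j * weakPartial Ω' j u' (T y) := by
  rw [ae_restrict_iff' T.open_source.measurableSet, ae_iff]
  -- An almost everywhere identity may be checked on small balls. There `u` is the pullback of an
  -- approximable function, whose gradient obeys the chain rule, and weak derivatives are unique.
  apply measure_null_of_locally_null
  intro y hy
  have hyT : y ∈ T.source := by
    by_contra h; exact hy fun h' => absurd h' h
  obtain ⟨r, hr, hrT⟩ := Metric.nhds_basis_closedBall.mem_iff.1 (T.open_source.mem_nhds hyT)
  have hK := isCompact_closedBall y r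
  have hK' : IsCompact (T '' closedBall y r) := hK.image_of_continuousOn (T.continuousOn.mono hrT)
  have hK'Ω : T '' closedBall y r ⊆ Ω' := by
    rintro _ ⟨z, hz, rfl⟩; exact hTΩ' (T.map_source (hrT hz))
  have h1 := (hT.approx_comp hK hrT (hu'.approx hΩ' hK' hK'Ω)).congr hK
    (fun z hz => (huu' z (hrT hz)).symm) (fun i z _ => rfl)
  have h2 := h1.isWeakPartial hK (W := ball y r) ball_subset_closedBall i
  have h3 : IsWeakPartial (ball y r) i u (weakPartial Ω i u) := by
    have hs : ball y r ⊆ Ω := ball_subset_closedBall.trans (hrT.trans hTΩ)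
    have := hu.partial_one i
    exact ⟨this.1.mono_set hs, this.2.1.mono_set hs, fun ψ a b c => this.2.2 ψ a b (c.trans hs)⟩
  have h4 := h3.ae_eq isOpen_ball h2
  rw [EventuallyEq, ae_restrict_iff' isOpen_ball.measurableSet, ae_iff] at h4
  refine ⟨{z | ¬ (z ∈ T.source → weakPartial Ω i u z =
      ∑ j, jac T z i j * weakPartial Ω' j u' (T z))} ∩ ball y r,
    inter_mem self_mem_nhdsWithin (mem_nhdsWithin_of_mem_nhds (ball_mem_nhds y hr)), ?_⟩
  refine measure_mono_null ?_ h4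
  rintro z ⟨hz, hzb⟩ hz'
  exact hz fun _ => hz' hzb

end IsDiffeo

/-- Invariance of the pairing of covectors under a change of coordinates. -/
theorem sum_inv_mul_eq {J g g' : Matrix (Fin n) (Fin n) ℝ} (hJ : J.det ≠ 0)
    (hg : g = J * g' * J.transpose) (ξ' η' : Fin n → ℝ) :
    ∑ i, ∑ j, g⁻¹ i j * ((∑ k, J i k * ξ' k) * ∑ k, J j k * η' k) =
      ∑ i, ∑ j, g'⁻¹ i j * (ξ' i * η' j) := by
  have e : ∀ (N : Matrix (Fin n) (Fin n) ℝ) (a b : Fin n → ℝ),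
      ∑ i, ∑ j, N i j * (a i * b j) = a ⬝ᵥ N.mulVec b := by
    intro N a b
    simp only [dotProduct, Matrix.mulVec, Finset.mul_sum]
    exact Finset.sum_congr rfl fun i _ => Finset.sum_congr rfl fun j _ => by ring
  have e1 := e g⁻¹ (J.mulVec ξ') (J.mulVec η')
  have e2 := e g'⁻¹ ξ' η'
  have e3 : ∀ a : Fin n → ℝ, ∀ i, J.mulVec a i = ∑ k, J i k * a k := fun a i => rfl
  simp only [e3] at e1
  rw [e1, e2]
  have hJu : IsUnit J.det := isUnit_iff_ne_zero.2 hJ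
  have hJu' : IsUnit J.transpose.det := by rwa [Matrix.det_transpose]
  have hN : J.transpose * g⁻¹ * J = g'⁻¹ := by
    rw [hg, Matrix.mul_inv_rev, Matrix.mul_inv_rev]
    calc J.transpose * (J.transpose⁻¹ * (g'⁻¹ * J⁻¹)) * J
        = (J.transpose * J.transpose⁻¹) * g'⁻¹ * (J⁻¹ * J) := by simp only [Matrix.mul_assoc]
      _ = g'⁻¹ := by
        rw [Matrix.mul_nonsing_inv _ hJu', Matrix.nonsing_inv_mul _ hJu, one_mul, mul_one]
  have e4 : (fun i => ∑ k, J i k * ξ' k) = J.mulVec ξ' := rfl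
  have e5 : (fun i => ∑ k, J i k * η' k) = J.mulVec η' := rfl
  change J.mulVec ξ' ⬝ᵥ g⁻¹.mulVec (J.mulVec η') = _
  rw [← hN, ← Matrix.mulVec_mulVec, ← Matrix.mulVec_mulVec, Matrix.dotProduct_mulVec ξ',
    Matrix.vecMul_transpose]

/-- Covectors transform by `J` and the metric by `J g' Jᵀ`, so the pairing is invariant while `√(det
g)` acquires the factor `|det J|`: the flux is a density. -/
theorem flux_comp {Ω Ω' : Set (Model n)} {g g' : Model n → Matrix (Fin n) (Fin n) ℝ}
    {φ₁ φ₂ φ₁' φ₂' : Model n → ℝ} {J : Matrix (Fin n) (Fin n) ℝ} {y z : Model n}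
    (hJ : J.det ≠ 0) (hg : g y = J * g' z * J.transpose)
    (h₁ : φ₁ y = φ₁' z) (h₂ : φ₂ y = φ₂' z)
    (hd₁ : ∀ i, weakPartial Ω i φ₁ y = ∑ j, J i j * weakPartial Ω' j φ₁' z)
    (hd₂ : ∀ i, weakPartial Ω i φ₂ y = ∑ j, J i j * weakPartial Ω' j φ₂' z) (ξ' : Fin n → ℝ) :
    flux Ω g φ₁ φ₂ y (fun i => ∑ k, J i k * ξ' k) = |J.det| * flux Ω' g' φ₁' φ₂' z ξ' := by
  have hl : ∀ i, logGrad Ω φ₁ φ₂ i y = ∑ k, J i k * logGrad Ω' φ₁' φ₂' k z := by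
    intro i
    simp only [logGrad, hd₁, hd₂, h₁, h₂, mul_sub, Finset.sum_sub_distrib, Finset.sum_div,
      mul_div_assoc]
  have hdet : Real.sqrt (g y).det = |J.det| * Real.sqrt (g' z).det := by
    rw [hg, Matrix.det_mul, Matrix.det_mul, Matrix.det_transpose,
      show J.det * (g' z).det * J.det = J.det ^ 2 * (g' z).det by ring,
      Real.sqrt_mul (sq_nonneg _), Real.sqrt_sq_eq_abs]
  simp only [flux, hl, hdet, h₁, h₂]
  rw [sum_inv_mul_eq hJ hg]
  ring

/-! ### Charts of a Riemannian manifold -/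

section Charts

variable {M : Type*} [TopologicalSpace M] [ChartedSpace (Model n) M] [IsManifold (𝓡 n) ∞ M]
  {χ χ' : OpenPartialHomeomorph M (Model n)}

theorem contMDiffOn_chart_of_mem (hχ : χ ∈ atlas (Model n) M) :
    ContMDiffOn (𝓡 n) (𝓡 n) ∞ χ χ.source :=
  contMDiffOn_of_mem_maximalAtlas (IsManifold.subset_maximalAtlas hχ)

theorem contMDiffOn_chart_symm_of_mem (hχ : χ ∈ atlas (Model n) M) :
    ContMDiffOn (𝓡 n) (𝓡 n) ∞ χ.symm χ.target :=
  contMDiffOn_symm_of_mem_maximalAtlas (IsManifold.subset_maximalAtlas hχ)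

theorem isDiffeo_transition (hχ : χ ∈ atlas (Model n) M) (hχ' : χ' ∈ atlas (Model n) M) :
    IsDiffeo (χ.symm.trans χ') := by
  have key : ∀ {e e' : OpenPartialHomeomorph M (Model n)}, e ∈ atlas (Model n) M →
      e' ∈ atlas (Model n) M → ContDiffOn ℝ ∞ (e.symm.trans e') (e.symm.trans e').source := by
    intro e e' he he'
    rw [← contMDiffOn_iff_contDiffOn]
    exact (contMDiffOn_chart_of_mem he').comp ((contMDiffOn_chart_symm_of_mem he).mono
      (fun y hy => hy.1)) (fun y hy => hy.2)
  refine ⟨key hχ hχ', ?_⟩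
  have := key hχ' hχ
  rwa [show χ'.symm.trans χ = (χ.symm.trans χ').symm by
    rw [OpenPartialHomeomorph.trans_symm_eq_symm_trans_symm, OpenPartialHomeomorph.symm_symm]] at this

theorem components_symm (γ : ContMetric n M) (χ : OpenPartialHomeomorph M (Model n)) (y : Model n)
    (i j : Fin n) : components γ χ y i j = components γ χ y j i :=
  γ.symm _ _ _

theorem bilin_sum_basisVec {V : Type*} [AddCommGroup V] [Module ℝ V] [TopologicalSpace V]
    (B : V →L[ℝ] V →L[ℝ] ℝ) (L : Model n →L[ℝ] V) (a b : Fin n → ℝ) :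
    B (L (∑ i, a i • basisVec i)) (L (∑ j, b j • basisVec j)) =
      ∑ i, ∑ j, a i * b j * B (L (basisVec i)) (L (basisVec j)) := by
  simp only [map_sum, map_smul, sum_apply, smul_apply, smul_eq_mul, Finset.mul_sum]
  rw [Finset.sum_comm]
  exact Finset.sum_congr rfl fun i _ => Finset.sum_congr rfl fun j _ => by ring

theorem sum_components (γ : ContMetric n M) (χ : OpenPartialHomeomorph M (Model n)) (y : Model n)
    (a b : Fin n → ℝ) :
    γ.inner (χ.symm y) (mfderiv (𝓡 n) (𝓡 n) χ.symm y (∑ i, a i • basisVec i : Model n))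
      (mfderiv (𝓡 n) (𝓡 n) χ.symm y (∑ j, b j • basisVec j : Model n)) =
      ∑ i, ∑ j, a i * b j * components γ χ y i j :=
  bilin_sum_basisVec (γ.inner (χ.symm y)) (mfderiv (𝓡 n) (𝓡 n) χ.symm y) a b

theorem components_posDef (γ : ContMetric n M) (hχ : χ ∈ atlas (Model n) M) {y : Model n}
    (hy : y ∈ χ.target) : (components γ χ y).PosDef := by
  refine Matrix.PosDef.of_dotProduct_mulVec_pos ?_ fun x hx => ?_
  · ext i j
    simp [components_symm γ χ y i j]
  · have h := sum_components γ χ y x x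
    have e : star x ⬝ᵥ (components γ χ y).mulVec x =
        ∑ i, ∑ j, x i * x j * components γ χ y i j := by
      simp only [dotProduct, Matrix.mulVec, Finset.mul_sum, star_trivial]
      exact Finset.sum_congr rfl fun i _ => Finset.sum_congr rfl fun j _ => by ring
    rw [e, ← h]
    apply γ.pos
    -- Positivity of `γ` applies because the differential of the inverse chart is injective and maps
    -- a nonzero coordinate vector to a nonzero tangent vector.
    have hinj := (mdifferentiable_of_mem_atlas (I := 𝓡 n) hχ).symm.mfderiv_injective (x := y) hy
    intro h0
    have h1 : (∑ i, x i • basisVec i : Model n) = 0 := hinj (h0.trans (map_zero _).symm)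
    apply hx
    ext i
    have := congrArg (fun z : Model n => z i) h1
    simpa [basisVec, Pi.single_apply] using this

theorem continuousOn_components (γ : ContMetric n M) (hχ : χ ∈ atlas (Model n) M) (i j : Fin n) :
    ContinuousOn (fun y => components γ χ y i j) χ.target := by
  -- The coordinate vector fields are continuous into the tangent bundle, being images of constant
  -- fields under the tangent map of the inverse chart.
  have hv : ∀ k : Fin n, ContinuousOn (fun y => (⟨χ.symm y, mfderiv (𝓡 n) (𝓡 n) χ.symm y
      (basisVec k)⟩ : TangentBundle (𝓡 n) M)) χ.target := by
    intro k
    have h1 := (contMDiffOn_chart_symm_of_mem hχ).continuousOn_tangentMapWithin (by simp)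
      χ.open_target.uniqueMDiffOn
    have h2 : Continuous fun y : Model n => (⟨y, basisVec k⟩ : TangentBundle (𝓡 n) (Model n)) :=
      (tangentBundleModelSpaceHomeomorph (𝓡 n)).symm.continuous.comp
        (continuous_id.prodMk continuous_const)
    refine (h1.comp h2.continuousOn (fun y hy => hy)).congr fun y hy => ?_
    simp [tangentMapWithin, mfderivWithin_of_isOpen χ.open_target hy]
  intro y hy
  have hb : ContinuousWithinAt χ.symm χ.target y := χ.continuousOn_symm y hy
  have := (γ.continuous.continuousAt.comp_continuousWithinAt hb).clm_bundle_apply₂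
    (F₁ := Model n) (F₂ := Model n) (hv i y hy) (hv j y hy)
  simp only [FiberBundle.continuousWithinAt_totalSpace] at this
  exact this.2

theorem isMetricField_components {p : ℝ} {γ : ContMetric n M} (hγ : MetricMemW2p p γ)
    (hχ : χ ∈ atlas (Model n) M) : IsMetricField χ.target (components γ χ) where
  isW21 i j := (hγ χ hχ i j).isW21 χ.open_target (continuousOn_components γ hχ i j)
  symm y i j := components_symm γ χ y i j
  det_pos _ hy := (components_posDef γ hχ hy).det_pos

theorem components_transition (γ : ContMetric n M) (hχ : χ ∈ atlas (Model n) M)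
    (hχ' : χ' ∈ atlas (Model n) M) {y : Model n} (hy : y ∈ (χ.symm.trans χ').source) :
    components γ χ y = jac (χ.symm.trans χ') y * components γ χ' (χ.symm.trans χ' y) *
      (jac (χ.symm.trans χ') y).transpose := by
  set T := χ.symm.trans χ' with hT
  have hTy : T y = χ' (χ.symm y) := rfl
  have hpt : χ'.symm (T y) = χ.symm y := by rw [hTy]; exact χ'.left_inv hy.2
  have hder : mfderiv (𝓡 n) (𝓡 n) χ.symm y =
      (mfderiv (𝓡 n) (𝓡 n) χ'.symm (T y)).comp (fderiv ℝ T y) := by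
    have h1 : MDifferentiableAt (𝓡 n) (𝓡 n) χ'.symm (T y) :=
      (mdifferentiable_of_mem_atlas hχ').mdifferentiableAt_symm (χ'.map_source hy.2)
    have h2 : MDifferentiableAt (𝓡 n) (𝓡 n) T y :=
      ((isDiffeo_transition hχ hχ').hasFDerivAt hy).differentiableAt.mdifferentiableAt
    have h3 := mfderiv_comp y h1 h2
    rw [mfderiv_eq_fderiv] at h3
    have hev : (χ.symm : Model n → M) =ᶠ[𝓝 y] χ'.symm ∘ T := by
      filter_upwards [T.open_source.mem_nhds hy] with z hz
      exact (χ'.left_inv hz.2).symm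
    exact (hev.mfderiv_eq (I := 𝓡 n) (I' := 𝓡 n)).trans h3
  ext i j
  have h := sum_components γ χ' (T y) (jac T y i) (jac T y j)
  have hc : ∀ k, (∑ l, jac T y k l • basisVec l : Model n) = fderiv ℝ T y (basisVec k) := fun k =>
    (eq_sum_basisVec _).symm
  rw [hc, hc] at h
  have e : (jac T y * components γ χ' (T y) * (jac T y).transpose) i j =
      ∑ k, ∑ l, jac T y i k * jac T y j l * components γ χ' (T y) k l := by
    simp only [Matrix.mul_apply, Matrix.transpose_apply, Finset.sum_mul]
    rw [Finset.sum_comm]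
    exact Finset.sum_congr rfl fun i _ => Finset.sum_congr rfl fun j _ => by ring
  rw [e, ← h, components, Matrix.of_apply, hder, ← hpt]
  rfl

end Charts

/-! ### Monotonicity of the nonlinearity -/

/-- Factoring out `t` isolates `r` as a constant, which then cancels in `s F(t) - t F(s)`. -/
theorem nonlinearity_eq (n : ℕ) (r a q₁ q₂ b : ℝ) {t : ℝ} (ht : 0 < t) :
    nonlinearity n r a q₁ q₂ b t = t * (r - a * t ^ (-((3 * (n : ℝ) - 2) / ((n : ℝ) - 2)) - 1)
      - q₁ * t ^ (-((n : ℝ) / ((n : ℝ) - 2)) - 1)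
      + (b - q₂) * t ^ (((n : ℝ) + 2) / ((n : ℝ) - 2) - 1)) := by
  rw [nonlinearity, Real.rpow_sub_one ht.ne', Real.rpow_sub_one ht.ne', Real.rpow_sub_one ht.ne']
  field_simp

/-- After division by `t`, the powers multiplying `-a` and `-q₁` have negative exponents and the
power multiplying `b - q₂` a positive one, so each term of `F(t)/t - r` is nondecreasing. -/
theorem mul_nonlinearity_sub_nonneg (hn : 3 ≤ n) (r : ℝ) {a q₁ q₂ b s t : ℝ} (hs : 0 < s)
    (hst : s < t) (ha : 0 ≤ a) (hq₁ : 0 ≤ q₁) (hbq : 0 ≤ b - q₂) :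
    0 ≤ s * nonlinearity n r a q₁ q₂ b t - t * nonlinearity n r a q₁ q₂ b s ∧
      (0 < a + q₁ + b - q₂ →
        0 < s * nonlinearity n r a q₁ q₂ b t - t * nonlinearity n r a q₁ q₂ b s) := by
  have ht : 0 < t := hs.trans hst
  have hn' : (3 : ℝ) ≤ n := by exact_mod_cast hn
  have hn2 : 0 < (n : ℝ) - 2 := by linarith
  have e1 : -((3 * (n : ℝ) - 2) / ((n : ℝ) - 2)) - 1 < 0 := by
    have : 0 < (3 * (n : ℝ) - 2) / ((n : ℝ) - 2) := div_pos (by linarith) hn2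
    linarith
  have e2 : -((n : ℝ) / ((n : ℝ) - 2)) - 1 < 0 := by
    have : 0 < (n : ℝ) / ((n : ℝ) - 2) := div_pos (by linarith) hn2
    linarith
  have e3 : 0 < ((n : ℝ) + 2) / ((n : ℝ) - 2) - 1 := by
    rw [sub_pos, one_lt_div hn2]; linarith
  have l1 := Real.rpow_lt_rpow_of_neg hs hst e1
  have l2 := Real.rpow_lt_rpow_of_neg hs hst e2
  have l3 := Real.rpow_lt_rpow hs.le hst e3
  rw [nonlinearity_eq n r a q₁ q₂ b ht, nonlinearity_eq n r a q₁ q₂ b hs]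
  set s1 := s ^ (-((3 * (n : ℝ) - 2) / ((n : ℝ) - 2)) - 1)
  set s2 := s ^ (-((n : ℝ) / ((n : ℝ) - 2)) - 1)
  set s3 := s ^ (((n : ℝ) + 2) / ((n : ℝ) - 2) - 1)
  set t1 := t ^ (-((3 * (n : ℝ) - 2) / ((n : ℝ) - 2)) - 1)
  set t2 := t ^ (-((n : ℝ) / ((n : ℝ) - 2)) - 1)
  set t3 := t ^ (((n : ℝ) + 2) / ((n : ℝ) - 2) - 1)
  have e : s * (t * (r - a * t1 - q₁ * t2 + (b - q₂) * t3)) -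
      t * (s * (r - a * s1 - q₁ * s2 + (b - q₂) * s3)) =
      s * t * (a * (s1 - t1) + q₁ * (s2 - t2) + (b - q₂) * (t3 - s3)) := by ring
  rw [e]
  have h1 := mul_nonneg ha (sub_pos.2 l1).le
  have h2 := mul_nonneg hq₁ (sub_pos.2 l2).le
  have h3 := mul_nonneg hbq (sub_pos.2 l3).le
  refine ⟨mul_nonneg (mul_pos hs ht).le (by linarith), fun hpos => mul_pos (mul_pos hs ht) ?_⟩
  -- If the sum of three nonnegative terms were not positive, each would vanish; the power
  -- differences are strictly positive, so all three coefficients would be zero.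
  by_contra hle
  have z1 : a * (s1 - t1) = 0 := by linarith
  have z2 : q₁ * (s2 - t2) = 0 := by linarith
  have z3 : (b - q₂) * (t3 - s3) = 0 := by linarith
  have y1 := (mul_eq_zero.1 z1).resolve_right (sub_pos.2 l1).ne'
  have y2 := (mul_eq_zero.1 z2).resolve_right (sub_pos.2 l2).ne'
  have y3 := (mul_eq_zero.1 z3).resolve_right (sub_pos.2 l3).ne'
  linarith

theorem log_mul_nonlinearity (hn : 3 ≤ n) (r : ℝ) {a q₁ q₂ b s t : ℝ} (hs : 0 < s) (ht : 0 < t)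
    (ha : 0 ≤ a) (hq₁ : 0 ≤ q₁) (hbq : 0 ≤ b - q₂) :
    0 ≤ (Real.log t - Real.log s) *
      (s * nonlinearity n r a q₁ q₂ b t - t * nonlinearity n r a q₁ q₂ b s) ∧
    (0 < a + q₁ + b - q₂ → (Real.log t - Real.log s) *
      (s * nonlinearity n r a q₁ q₂ b t - t * nonlinearity n r a q₁ q₂ b s) = 0 → t = s) := by
  rcases lt_trichotomy s t with h | rfl | h
  · have hl := sub_pos.2 (Real.log_lt_log hs h)
    have key := mul_nonlinearity_sub_nonneg hn r hs h ha hq₁ hbq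
    exact ⟨mul_nonneg hl.le key.1, fun hp h0 => absurd h0 (mul_pos hl (key.2 hp)).ne'⟩
  · simp
  · have hl := sub_pos.2 (Real.log_lt_log ht h)
    have key := mul_nonlinearity_sub_nonneg hn r ht h ha hq₁ hbq
    have e : (Real.log t - Real.log s) *
      (s * nonlinearity n r a q₁ q₂ b t - t * nonlinearity n r a q₁ q₂ b s) =
      (Real.log s - Real.log t) *
      (t * nonlinearity n r a q₁ q₂ b s - s * nonlinearity n r a q₁ q₂ b t) := by ring
    rw [e]
    exact ⟨mul_nonneg hl.le key.1, fun hp h0 => absurd h0 (mul_pos hl (key.2 hp)).ne'⟩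

theorem logEnergy_nonneg {Ω : Set (Model n)} {g : Model n → Matrix (Fin n) (Fin n) ℝ}
    {φ₁ φ₂ : Model n → ℝ} {y : Model n} (hg : (g y).PosDef) :
    0 ≤ logEnergy Ω g φ₁ φ₂ y ∧
      (logEnergy Ω g φ₁ φ₂ y = 0 → ∀ i, logGrad Ω φ₁ φ₂ i y = 0) := by
  have e : logEnergy Ω g φ₁ φ₂ y = star (fun i => logGrad Ω φ₁ φ₂ i y) ⬝ᵥ
      (g y)⁻¹.mulVec (fun i => logGrad Ω φ₁ φ₂ i y) := by
    simp only [logEnergy, dotProduct, Matrix.mulVec, Finset.mul_sum, star_trivial]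
    exact Finset.sum_congr rfl fun i _ => Finset.sum_congr rfl fun j _ => by ring
  rw [e]
  by_cases h : (fun i => logGrad Ω φ₁ φ₂ i y) = 0
  · rw [h]
    exact ⟨by simp, fun _ i => congrFun h i⟩
  · have := hg.inv.dotProduct_mulVec_pos h
    exact ⟨this.le, fun h0 => absurd h0 this.ne'⟩

/-! ### Fluxes on the manifold -/

section Manifold

variable {M : Type*} [TopologicalSpace M] [ChartedSpace (Model n) M] [IsManifold (𝓡 n) ∞ M]
  {χ χ' : OpenPartialHomeomorph M (Model n)}

/-- The coordinate expression of the density `√(det γ) ζ φ₁ φ₂ ⟨∇ζ, ∇ρ⟩`, `ζ = log φ₁ - log φ₂`. -/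
def chartFlux (γ : ContMetric n M) (φ₁ φ₂ ρ : M → ℝ) (χ : OpenPartialHomeomorph M (Model n))
    (y : Model n) : ℝ :=
  flux χ.target (components γ χ) (fun z => φ₁ (χ.symm z)) (fun z => φ₂ (χ.symm z)) y
    (fun i => fderiv ℝ (fun z => ρ (χ.symm z)) y (basisVec i))

theorem flux_zero (Ω : Set (Model n)) (g : Model n → Matrix (Fin n) (Fin n) ℝ)
    (φ₁ φ₂ : Model n → ℝ) (y : Model n) : flux Ω g φ₁ φ₂ y (fun _ => 0) = 0 := by
  simp [flux]

theorem flux_sum {ι : Type*} (I : Finset ι) (Ω : Set (Model n))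
    (g : Model n → Matrix (Fin n) (Fin n) ℝ) (φ₁ φ₂ : Model n → ℝ) (y : Model n)
    (ξ : ι → Fin n → ℝ) :
    ∑ k ∈ I, flux Ω g φ₁ φ₂ y (ξ k) = flux Ω g φ₁ φ₂ y (fun i => ∑ k ∈ I, ξ k i) := by
  simp only [flux, ← Finset.mul_sum]
  congr 2
  rw [Finset.sum_comm]
  refine Finset.sum_congr rfl fun i _ => ?_
  rw [Finset.sum_comm]
  refine Finset.sum_congr rfl fun j _ => ?_
  rw [← Finset.mul_sum, Finset.sum_mul]

theorem contDiffOn_comp_chart_symm (hχ : χ ∈ atlas (Model n) M) {ρ : M → ℝ}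
    (hρ : ContMDiff (𝓡 n) 𝓘(ℝ, ℝ) ∞ ρ) : ContDiffOn ℝ ∞ (fun z => ρ (χ.symm z)) χ.target := by
  rw [← contMDiffOn_iff_contDiffOn]
  exact hρ.comp_contMDiffOn (contMDiffOn_chart_symm_of_mem hχ)

omit [ChartedSpace (Model n) M] [IsManifold (𝓡 n) ∞ M] in
theorem eventually_eq_zero_of_notMem_tsupport {ρ : M → ℝ} {y : Model n} (hy : y ∈ χ.target)
    (hρ : χ.symm y ∉ tsupport ρ) : (fun z => ρ (χ.symm z)) =ᶠ[𝓝 y] fun _ => 0 := by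
  have h := (χ.symm.continuousAt (x := y) hy).eventually
    ((isClosed_tsupport ρ).isOpen_compl.mem_nhds hρ)
  filter_upwards [h] with z hz using image_eq_zero_of_notMem_tsupport hz

theorem chartFlux_eq_zero (γ : ContMetric n M) (φ₁ φ₂ : M → ℝ) {ρ : M → ℝ} {y : Model n}
    (hy : y ∈ χ.target) (hρ : χ.symm y ∉ tsupport ρ) : chartFlux γ φ₁ φ₂ ρ χ y = 0 := by
  rw [chartFlux]
  have : (fun i => fderiv ℝ (fun z => ρ (χ.symm z)) y (basisVec i)) = fun _ : Fin n => (0 : ℝ) := by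
    ext i
    rw [(eventually_eq_zero_of_notMem_tsupport hy hρ).fderiv_eq]
    simp
  rw [this, flux_zero]

/-- A positive function of class `C⁰ ∩ W^{2,p}` on the manifold. -/
structure IsPositiveW2p (p : ℝ) (φ : M → ℝ) : Prop where
  continuous : Continuous φ
  memW2p : MemW2p n p φ
  pos : ∀ x, 0 < φ x

omit [IsManifold (𝓡 n) ∞ M] in
theorem IsPositiveW2p.isW21 {p : ℝ} {φ : M → ℝ} (h : IsPositiveW2p (n := n) p φ)
    (hχ : χ ∈ atlas (Model n) M) : IsW21 χ.target (fun y => φ (χ.symm y)) :=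
  (h.memW2p χ hχ).isW21 χ.open_target (h.continuous.comp_continuousOn χ.continuousOn_symm)

variable {p : ℝ} {γ : ContMetric n M} {φ₁ φ₂ : M → ℝ}

theorem chartFlux_transition (h₁ : IsPositiveW2p (n := n) p φ₁)
    (h₂ : IsPositiveW2p (n := n) p φ₂) (hχ : χ ∈ atlas (Model n) M) (hχ' : χ' ∈ atlas (Model n) M)
    {ρ : M → ℝ} (hρ : ContMDiff (𝓡 n) 𝓘(ℝ, ℝ) ∞ ρ) :
    ∀ᵐ y ∂volume.restrict (χ.symm.trans χ').source, chartFlux γ φ₁ φ₂ ρ χ y =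
      |(fderiv ℝ (χ.symm.trans χ') y).det| * chartFlux γ φ₁ φ₂ ρ χ' (χ.symm.trans χ' y) := by
  have hT := isDiffeo_transition hχ hχ'
  set T := χ.symm.trans χ' with hTdef
  have hpt : ∀ y ∈ T.source, χ'.symm (T y) = χ.symm y := fun y hy => χ'.left_inv hy.2
  have hs : T.source ⊆ χ.target := fun y hy => hy.1
  have ht : T.target ⊆ χ'.target := fun y hy => hy.1
  have d₁ := ae_all_iff.2 fun i => hT.weakPartial_comp χ'.open_target hs ht (h₁.isW21 hχ)
    (h₁.isW21 hχ') (fun y hy => by rw [hpt y hy]) i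
  have d₂ := ae_all_iff.2 fun i => hT.weakPartial_comp χ'.open_target hs ht (h₂.isW21 hχ)
    (h₂.isW21 hχ') (fun y hy => by rw [hpt y hy]) i
  filter_upwards [d₁, d₂, ae_restrict_mem T.open_source.measurableSet] with y hy₁ hy₂ hy
  have hξ : (fun i => fderiv ℝ (fun z => ρ (χ.symm z)) y (basisVec i)) = fun i =>
      ∑ k, jac T y i k * fderiv ℝ (fun z => ρ (χ'.symm z)) (T y) (basisVec k) := by
    ext i
    have hTy : T y ∈ χ'.target := ht (T.map_source hy)
    have e1 : HasFDerivAt (fun z => ρ (χ'.symm z)) (fderiv ℝ (fun z => ρ (χ'.symm z)) (T y)) (T y) :=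
      (((contDiffOn_comp_chart_symm hχ' hρ).contDiffAt
        (χ'.open_target.mem_nhds hTy)).differentiableAt (by simp)).hasFDerivAt
    have e2 := (e1.comp y (hT.hasFDerivAt hy)).fderiv
    have e3 : (fun z => ρ (χ.symm z)) =ᶠ[𝓝 y] (fun z => ρ (χ'.symm z)) ∘ T := by
      filter_upwards [T.open_source.mem_nhds hy] with z hz
      simp only [Function.comp_apply, hpt z hz]
    rw [e3.fderiv_eq, e2, ContinuousLinearMap.comp_apply, apply_eq_sum_basisVec]
    rfl
  rw [chartFlux, hξ, det_fderiv_eq_det_jac]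
  have hJ : (jac T y).det ≠ 0 := by
    rw [← det_fderiv_eq_det_jac]; exact hT.det_ne_zero hy
  exact flux_comp hJ (components_transition γ hχ hχ' hy) (by rw [hpt y hy]) (by rw [hpt y hy])
    hy₁ hy₂ _

/-- Only the overlap of the charts contributes: `σ` vanishes off the source of `χ'`, and the flux of
`ρ` vanishes off the source of `χ`. On the overlap the flux transforms as a density. -/
theorem setIntegral_chartFlux_eq (h₁ : IsPositiveW2p (n := n) p φ₁)
    (h₂ : IsPositiveW2p (n := n) p φ₂) (hχ : χ ∈ atlas (Model n) M) (hχ' : χ' ∈ atlas (Model n) M)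
    {σ ρ : M → ℝ} (hσ : tsupport σ ⊆ χ'.source) (hρ : ContMDiff (𝓡 n) 𝓘(ℝ, ℝ) ∞ ρ)
    (hρχ : tsupport ρ ⊆ χ.source) :
    ∫ y in χ.target, σ (χ.symm y) * chartFlux γ φ₁ φ₂ ρ χ y =
      ∫ y in χ'.target, σ (χ'.symm y) * chartFlux γ φ₁ φ₂ ρ χ' y := by
  have hT := isDiffeo_transition hχ hχ'
  have htr := chartFlux_transition (γ := γ) h₁ h₂ hχ hχ' hρ
  set T := χ.symm.trans χ' with hTdef
  have hpt : ∀ y ∈ T.source, χ'.symm (T y) = χ.symm y := fun y hy => χ'.left_inv hy.2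
  have hs : T.source ⊆ χ.target := fun y hy => hy.1
  have ht : T.target ⊆ χ'.target := fun y hy => hy.1
  have e1 : ∫ y in χ.target, σ (χ.symm y) * chartFlux γ φ₁ φ₂ ρ χ y =
      ∫ y in T.source, σ (χ.symm y) * chartFlux γ φ₁ φ₂ ρ χ y := by
    refine setIntegral_eq_of_subset_of_forall_sdiff_eq_zero χ.open_target.measurableSet hs
      fun y hy => ?_
    have : χ.symm y ∉ tsupport σ := fun h => hy.2 ⟨hy.1, hσ h⟩
    rw [image_eq_zero_of_notMem_tsupport this, zero_mul]
  have e2 : ∫ y in χ'.target, σ (χ'.symm y) * chartFlux γ φ₁ φ₂ ρ χ' y =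
      ∫ y in T.target, σ (χ'.symm y) * chartFlux γ φ₁ φ₂ ρ χ' y := by
    refine setIntegral_eq_of_subset_of_forall_sdiff_eq_zero χ'.open_target.measurableSet ht
      fun y hy => ?_
    have : χ'.symm y ∉ tsupport ρ := fun h => hy.2 ⟨hy.1, hρχ h⟩
    rw [chartFlux_eq_zero γ φ₁ φ₂ hy.1 this, mul_zero]
  rw [e1, e2, ← T.image_source_eq_target, integral_image_eq_integral_abs_det_fderiv_smul volume
    T.open_source.measurableSet (hT.hasFDerivWithinAt subset_rfl) T.injOn]
  refine integral_congr_ae ?_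
  filter_upwards [htr, ae_restrict_mem T.open_source.measurableSet] with y hy hyT
  rw [hy, hpt y hyT, smul_eq_mul]
  ring

variable [CompactSpace M]

/-- The coordinate image of the support of a cutoff function. -/
def chartSupport (χ : OpenPartialHomeomorph M (Model n)) (ρ : M → ℝ) : Set (Model n) :=
  χ '' tsupport ρ

omit [ChartedSpace (Model n) M] [IsManifold (𝓡 n) ∞ M] in
theorem isCompact_chartSupport {ρ : M → ℝ} (hρχ : tsupport ρ ⊆ χ.source) :
    IsCompact (chartSupport χ ρ) :=
  (isClosed_tsupport ρ).isCompact.image_of_continuousOn (χ.continuousOn.mono hρχ)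

omit [ChartedSpace (Model n) M] [IsManifold (𝓡 n) ∞ M] [CompactSpace M] in
theorem chartSupport_subset {ρ : M → ℝ} (hρχ : tsupport ρ ⊆ χ.source) :
    chartSupport χ ρ ⊆ χ.target := by
  rintro _ ⟨x, hx, rfl⟩; exact χ.map_source (hρχ hx)

omit [ChartedSpace (Model n) M] [IsManifold (𝓡 n) ∞ M] [CompactSpace M] in
theorem symm_notMem_tsupport {ρ : M → ℝ} {y : Model n} (hy : y ∈ χ.target)
    (h : y ∉ chartSupport χ ρ) : χ.symm y ∉ tsupport ρ := fun h' =>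
  h ⟨χ.symm y, h', χ.right_inv hy⟩

omit [CompactSpace M] in
theorem integrableOn_chartFlux (hγ : MetricMemW2p p γ) (h₁ : IsPositiveW2p (n := n) p φ₁)
    (h₂ : IsPositiveW2p (n := n) p φ₂) (hχ : χ ∈ atlas (Model n) M)
    {ρ : M → ℝ} (hρ : ContMDiff (𝓡 n) 𝓘(ℝ, ℝ) ∞ ρ) {K : Set (Model n)} (hK : IsCompact K)
    (hKχ : K ⊆ χ.target) : IntegrableOn (chartFlux γ φ₁ φ₂ ρ χ) K := by
  refine (isMetricField_components hγ hχ).integrableOn_flux χ.open_target hK hKχ (h₁.isW21 hχ)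
    (h₂.isW21 hχ) (fun _ => h₁.pos _) (fun _ => h₂.pos _)
    (ξ := fun y i => fderiv ℝ (fun z => ρ (χ.symm z)) y (basisVec i)) fun i => ?_
  exact (((contDiffOn_comp_chart_symm hχ hρ).continuousOn_fderiv_of_isOpen χ.open_target
    (by simp)).clm_apply continuousOn_const).mono hKχ

/-- Restricted integrability of a weighted flux, when the weight or the flux is supported in the
chart. -/
theorem integrableOn_mul_chartFlux (hγ : MetricMemW2p p γ) (h₁ : IsPositiveW2p (n := n) p φ₁)
    (h₂ : IsPositiveW2p (n := n) p φ₂) (hχ : χ ∈ atlas (Model n) M) {σ ρ τ : M → ℝ}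
    (hσ : Continuous σ) (hρ : ContMDiff (𝓡 n) 𝓘(ℝ, ℝ) ∞ ρ) (hτ : tsupport τ ⊆ χ.source)
    (h : τ = σ ∨ τ = ρ) :
    IntegrableOn (fun y => σ (χ.symm y) * chartFlux γ φ₁ φ₂ ρ χ y) χ.target := by
  have hK := isCompact_chartSupport hτ
  have hKχ := chartSupport_subset hτ
  refine IntegrableOn.of_forall_sdiff_eq_zero (s := chartSupport χ τ) ?_
    χ.open_target.measurableSet fun y hy => ?_
  · exact (integrableOn_chartFlux hγ h₁ h₂ hχ hρ hK hKχ).continuousOn_mul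
      ((hσ.comp_continuousOn χ.continuousOn_symm).mono hKχ) hK
  · have := symm_notMem_tsupport hy.1 hy.2
    rcases h with rfl | rfl
    · rw [image_eq_zero_of_notMem_tsupport this, zero_mul]
    · rw [chartFlux_eq_zero γ φ₁ φ₂ hy.1 this, mul_zero]

/-- The divergence theorem: the fluxes of a partition of unity cancel. -/
theorem sum_setIntegral_chartFlux {ι : Type*} [Fintype ι] (hγ : MetricMemW2p p γ)
    (h₁ : IsPositiveW2p (n := n) p φ₁) (h₂ : IsPositiveW2p (n := n) p φ₂)
    {X : ι → OpenPartialHomeomorph M (Model n)} (hX : ∀ k, X k ∈ atlas (Model n) M) {ρ : ι → M → ℝ}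
    (hρ : ∀ k, ContMDiff (𝓡 n) 𝓘(ℝ, ℝ) ∞ (ρ k)) (hρX : ∀ k, tsupport (ρ k) ⊆ (X k).source)
    (hsum : ∀ x, ∑ k, ρ k x = 1) :
    ∑ k, ∫ y in (X k).target, chartFlux γ φ₁ φ₂ (ρ k) (X k) y = 0 := by
  -- Inserting `∑ ρ l = 1` localizes each flux to pairs of charts.
  have e1 : ∀ k, ∫ y in (X k).target, chartFlux γ φ₁ φ₂ (ρ k) (X k) y =
      ∑ l, ∫ y in (X k).target, ρ l ((X k).symm y) * chartFlux γ φ₁ φ₂ (ρ k) (X k) y := by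
    intro k
    rw [← integral_finsetSum _ fun l _ => integrableOn_mul_chartFlux hγ h₁ h₂ (hX k)
      (hρ l).continuous (hρ k) (hρX k) (Or.inr rfl)]
    refine setIntegral_congr_fun (X k).open_target.measurableSet fun y _ => ?_
    simp only [← Finset.sum_mul, hsum, one_mul]
  simp only [e1]
  rw [Finset.sum_comm]
  refine Finset.sum_eq_zero fun l _ => ?_
  -- Each pair is moved from chart `k` to chart `l`, where the sum over `k` can be taken under the
  -- integral and produces the differential of `∑ ρ k = 1`.
  have e2 : ∀ k, ∫ y in (X k).target, ρ l ((X k).symm y) * chartFlux γ φ₁ φ₂ (ρ k) (X k) y =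
      ∫ y in (X l).target, ρ l ((X l).symm y) * chartFlux γ φ₁ φ₂ (ρ k) (X l) y := fun k =>
    setIntegral_chartFlux_eq h₁ h₂ (hX k) (hX l) (hρX l) (hρ k) (hρX k)
  simp only [e2]
  rw [← integral_finsetSum _ fun k _ => integrableOn_mul_chartFlux hγ h₁ h₂ (hX l)
      (hρ l).continuous (hρ k) (hρX l) (Or.inl rfl)]
  refine setIntegral_eq_zero_of_forall_eq_zero fun y hy => ?_
  rw [← Finset.mul_sum]
  simp only [chartFlux]
  rw [flux_sum]
  have e3 : (fun i => ∑ k, fderiv ℝ (fun z => ρ k ((X l).symm z)) y (basisVec i)) =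
      fun _ : Fin n => (0 : ℝ) := by
    ext i
    have hd : ∀ k ∈ Finset.univ, DifferentiableAt ℝ (fun z => ρ k ((X l).symm z)) y := fun k _ =>
      ((contDiffOn_comp_chart_symm (hX l) (hρ k)).contDiffAt
        ((X l).open_target.mem_nhds hy)).differentiableAt (by simp)
    rw [← sum_apply, ← fderiv_fun_sum hd]
    simp [hsum]
  rw [e3, flux_zero, mul_zero]

/-- A cutoff function in a chart, extended by zero. -/
theorem contDiff_indicator_chart (hχ : χ ∈ atlas (Model n) M) {ρ : M → ℝ}
    (hρ : ContMDiff (𝓡 n) 𝓘(ℝ, ℝ) ∞ ρ) (hρχ : tsupport ρ ⊆ χ.source) :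
    ContDiff ℝ ∞ (χ.target.indicator fun z => ρ (χ.symm z)) ∧
      tsupport (χ.target.indicator fun z => ρ (χ.symm z)) ⊆ chartSupport χ ρ := by
  have hcl := (isCompact_chartSupport hρχ).isClosed
  have hs : tsupport (χ.target.indicator fun z => ρ (χ.symm z)) ⊆ chartSupport χ ρ := by
    refine closure_minimal (fun y hy => ?_) hcl
    by_contra h
    apply hy
    by_cases hyt : y ∈ χ.target
    · rw [indicator_of_mem hyt, image_eq_zero_of_notMem_tsupport (symm_notMem_tsupport hyt h)]
    · rw [indicator_of_notMem hyt]
  refine ⟨contDiff_iff_contDiffAt.2 fun y => ?_, hs⟩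
  by_cases hyt : y ∈ χ.target
  · refine ((contDiffOn_comp_chart_symm hχ hρ).contDiffAt
      (χ.open_target.mem_nhds hyt)).congr_of_eventuallyEq ?_
    filter_upwards [χ.open_target.mem_nhds hyt] with z hz using indicator_of_mem hz _
  -- Off the chart domain, the compact coordinate support is at positive distance, so the extension
  -- is zero near `y`.
  · have hy : y ∉ chartSupport χ ρ := fun h => hyt (chartSupport_subset hρχ h)
    refine (contDiffAt_const (c := (0 : ℝ))).congr_of_eventuallyEq ?_
    filter_upwards [hcl.isOpen_compl.mem_nhds hy] with z hz
    exact image_eq_zero_of_notMem_tsupport fun h => hz (hs h)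

/-- The coordinate expression of `√(det γ) (ζ (φ₂ Δφ₁ - φ₁ Δφ₂) + φ₁ φ₂ |∇ζ|²)`. -/
def chartBulk (γ : ContMetric n M) (φ₁ φ₂ : M → ℝ) (χ : OpenPartialHomeomorph M (Model n))
    (y : Model n) : ℝ :=
  bulk χ.target (components γ χ) (fun z => φ₁ (χ.symm z)) (fun z => φ₂ (χ.symm z)) y

theorem setIntegral_chartBulk (hγ : MetricMemW2p p γ) (h₁ : IsPositiveW2p (n := n) p φ₁)
    (h₂ : IsPositiveW2p (n := n) p φ₂) (hχ : χ ∈ atlas (Model n) M)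
    {ρ : M → ℝ} (hρ : ContMDiff (𝓡 n) 𝓘(ℝ, ℝ) ∞ ρ) (hρχ : tsupport ρ ⊆ χ.source) :
    IntegrableOn (fun y => ρ (χ.symm y) * chartBulk γ φ₁ φ₂ χ y) χ.target ∧
    ∫ y in χ.target, ρ (χ.symm y) * chartBulk γ φ₁ φ₂ χ y =
      - ∫ y in χ.target, chartFlux γ φ₁ φ₂ ρ χ y := by
  have hK := isCompact_chartSupport hρχ
  have hKχ := chartSupport_subset hρχ
  obtain ⟨hR, hRs⟩ := contDiff_indicator_chart hχ hρ hρχ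
  set R := χ.target.indicator fun z => ρ (χ.symm z) with hRdef
  have hRe : ∀ y ∈ χ.target, R y = ρ (χ.symm y) := fun y hy => indicator_of_mem hy _
  obtain ⟨hi, hb⟩ := (isMetricField_components hγ hχ).bulk_add_flux χ.open_target hK hKχ
    (h₁.isW21 hχ) (h₂.isW21 hχ) (fun _ => h₁.pos _) (fun _ => h₂.pos _) hR hRs
  have hi' : IntegrableOn (fun y => ρ (χ.symm y) * chartBulk γ φ₁ φ₂ χ y) (chartSupport χ ρ) :=
    hi.congr_fun (fun y hy => by rw [← hRe y (hKχ hy)]; rfl) hK.measurableSet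
  have hz : ∀ y ∈ χ.target \ chartSupport χ ρ, ρ (χ.symm y) * chartBulk γ φ₁ φ₂ χ y = 0 :=
    fun y hy => by
      rw [image_eq_zero_of_notMem_tsupport (symm_notMem_tsupport hy.1 hy.2), zero_mul]
  refine ⟨hi'.of_forall_sdiff_eq_zero χ.open_target.measurableSet hz, ?_⟩
  rw [setIntegral_eq_of_subset_of_forall_sdiff_eq_zero χ.open_target.measurableSet hKχ hz,
    setIntegral_eq_of_subset_of_forall_sdiff_eq_zero χ.open_target.measurableSet hKχ
      (fun y hy => chartFlux_eq_zero γ φ₁ φ₂ hy.1 (symm_notMem_tsupport hy.1 hy.2))]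
  refine Eq.trans (setIntegral_congr_fun hK.measurableSet fun y hy => ?_) (hb.trans ?_)
  · simp only [← hRe y (hKχ hy)]; rfl
  · congr 1
    refine setIntegral_congr_fun hK.measurableSet fun y hy => ?_
    have : R =ᶠ[𝓝 y] fun z => ρ (χ.symm z) := by
      filter_upwards [χ.open_target.mem_nhds (hKχ hy)] with z hz using hRe z hz
    simp only [chartFlux, this.fderiv_eq]

variable (n M) in
theorem exists_finite_partition_of_unity [T2Space M] :
    ∃ (t : Finset M) (X : t → OpenPartialHomeomorph M (Model n)) (ρ : t → M → ℝ),
      (∀ k, X k ∈ atlas (Model n) M) ∧ (∀ k, ContMDiff (𝓡 n) 𝓘(ℝ, ℝ) ∞ (ρ k)) ∧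
      (∀ k, tsupport (ρ k) ⊆ (X k).source) ∧ (∀ k x, 0 ≤ ρ k x) ∧ ∀ x, ∑ k, ρ k x = 1 := by
  obtain ⟨t, ht⟩ := isCompact_univ.elim_finite_subcover (fun x : M => (chartAt (Model n) x).source)
    (fun x => (chartAt (Model n) x).open_source)
    (fun x _ => mem_iUnion_of_mem x (mem_chart_source (Model n) x))
  obtain ⟨f, hf⟩ := SmoothPartitionOfUnity.exists_isSubordinate (𝓡 n) (isClosed_univ (X := M))
    (fun x : t => (chartAt (Model n) (x : M)).source) (fun x => (chartAt (Model n) _).open_source)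
    (fun x hx => by
      obtain ⟨y, hy, hxy⟩ := mem_iUnion₂.1 (ht hx)
      exact mem_iUnion_of_mem ⟨y, hy⟩ hxy)
  refine ⟨t, fun x => chartAt (Model n) (x : M), fun k => f k,
    fun k => chart_mem_atlas _ _, fun k => (f k).contMDiff, hf, fun k x => f.nonneg k x, fun x => ?_⟩
  rw [← finsum_eq_sum_of_fintype]
  exact f.sum_eq_one (mem_univ x)

end Manifold

/-! ### Uniqueness -/

section Uniqueness

variable {M : Type*} [TopologicalSpace M] [ChartedSpace (Model n) M] [IsManifold (𝓡 n) ∞ M]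
  {χ : OpenPartialHomeomorph M (Model n)} {p : ℝ} {γ : ContMetric n M} {a q₁ q₂ b φ₁ φ₂ : M → ℝ}

theorem IsPositiveSolution.isPositiveW2p (h : IsPositiveSolution p γ a q₁ q₂ b φ₁) :
    IsPositiveW2p (n := n) p φ₁ :=
  ⟨h.continuous, h.memW2p, h.pos⟩

/-- Here the equation enters: it replaces both Laplacians by the nonlinearity with the same
coefficients. Each of the two summands is then nonnegative, so vanishing of the sum forces vanishing
of both. -/
theorem chartBulk_nonneg (hn : 3 ≤ n) (ha : AlmostEverywhere n (fun x => 0 ≤ a x))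
    (hq₁ : AlmostEverywhere n (fun x => 0 ≤ q₁ x))
    (hbq : AlmostEverywhere n (fun x => 0 ≤ b x - q₂ x))
    (h₁ : IsPositiveSolution p γ a q₁ q₂ b φ₁) (h₂ : IsPositiveSolution p γ a q₁ q₂ b φ₂)
    (hχ : χ ∈ atlas (Model n) M) :
    ∀ᵐ y ∂volume.restrict χ.target, 0 ≤ chartBulk γ φ₁ φ₂ χ y ∧
      (chartBulk γ φ₁ φ₂ χ y = 0 →
        (∀ i, logGrad χ.target (fun z => φ₁ (χ.symm z)) (fun z => φ₂ (χ.symm z)) i y = 0) ∧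
        (0 < a (χ.symm y) + q₁ (χ.symm y) + b (χ.symm y) - q₂ (χ.symm y) →
          φ₁ (χ.symm y) = φ₂ (χ.symm y))) := by
  filter_upwards [ha χ hχ, hq₁ χ hχ, hbq χ hχ, h₁.solves χ hχ, h₂.solves χ hχ,
    ae_restrict_mem χ.open_target.measurableSet] with y hay hqy hby e₁ e₂ hy
  have hP := components_posDef γ hχ hy
  have hd := Real.sqrt_pos.2 hP.det_pos
  obtain ⟨hE, hE0⟩ := logEnergy_nonneg (Ω := χ.target) (φ₁ := fun z => φ₁ (χ.symm z))
    (φ₂ := fun z => φ₂ (χ.symm z)) hP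
  obtain ⟨hN, hN0⟩ := log_mul_nonlinearity hn
    (((n : ℝ) - 2) / (4 * ((n : ℝ) - 1)) * scalarCurvature χ.target (components γ χ) y)
    (h₂.pos (χ.symm y)) (h₁.pos (χ.symm y)) hay hqy hby
  have hφ := mul_pos (h₁.pos (χ.symm y)) (h₂.pos (χ.symm y))
  have hφE := mul_nonneg hφ.le hE
  simp only [chartBulk, bulk]
  rw [e₁, e₂]
  refine ⟨mul_nonneg hd.le (add_nonneg hN hφE), fun h0 => ?_⟩
  have h0' := (add_eq_zero_iff_of_nonneg hN hφE).1 ((mul_eq_zero.1 h0).resolve_left hd.ne')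
  exact ⟨hE0 ((mul_eq_zero.1 h0'.2).resolve_left hφ.ne'), fun hpos => hN0 hpos h0'.1⟩

variable [CompactSpace M]

/-- The integrals of `ρ k` times the bulk add up to minus the total flux, which is zero. Being
nonnegative, each of them vanishes, and so does each integrand almost everywhere. -/
theorem chartBulk_eq_zero {ι : Type*} [Fintype ι] (hγ : MetricMemW2p p γ)
    (h₁ : IsPositiveW2p (n := n) p φ₁) (h₂ : IsPositiveW2p (n := n) p φ₂)
    {X : ι → OpenPartialHomeomorph M (Model n)} (hX : ∀ k, X k ∈ atlas (Model n) M) {ρ : ι → M → ℝ}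
    (hρ : ∀ k, ContMDiff (𝓡 n) 𝓘(ℝ, ℝ) ∞ (ρ k)) (hρX : ∀ k, tsupport (ρ k) ⊆ (X k).source)
    (hρ0 : ∀ k x, 0 ≤ ρ k x) (hsum : ∀ x, ∑ k, ρ k x = 1)
    (hb : ∀ k, ∀ᵐ y ∂volume.restrict (X k).target, 0 ≤ chartBulk γ φ₁ φ₂ (X k) y) (k : ι) :
    ∀ᵐ y ∂volume.restrict (X k).target,
      0 < ρ k ((X k).symm y) → chartBulk γ φ₁ φ₂ (X k) y = 0 := by
  have hI := fun k => setIntegral_chartBulk hγ h₁ h₂ (hX k) (hρ k) (hρX k)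
  have hnn : ∀ k, 0 ≤ᵐ[volume.restrict (X k).target]
      fun y => ρ k ((X k).symm y) * chartBulk γ φ₁ φ₂ (X k) y := fun k => by
    filter_upwards [hb k] with y hy using mul_nonneg (hρ0 _ _) hy
  have hs : ∑ k, ∫ y in (X k).target, ρ k ((X k).symm y) * chartBulk γ φ₁ φ₂ (X k) y = 0 := by
    simp only [fun k => (hI k).2, Finset.sum_neg_distrib,
      sum_setIntegral_chartFlux hγ h₁ h₂ hX hρ hρX hsum, neg_zero]
  have hk := (Finset.sum_eq_zero_iff_of_nonneg fun k _ => integral_nonneg_of_ae (hnn k)).1 hs k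
    (Finset.mem_univ k)
  filter_upwards [(integral_eq_zero_iff_of_nonneg_ae (hnn k) (hI k).1).1 hk] with y hy hpos
  exact (mul_eq_zero.1 hy).resolve_left hpos.ne'

omit [IsManifold (𝓡 n) ∞ M] [CompactSpace M] in
theorem eventually_log_sub_log_eq (h₁ : IsPositiveW2p (n := n) p φ₁)
    (h₂ : IsPositiveW2p (n := n) p φ₂) (hχ : χ ∈ atlas (Model n) M) {V : Set (Model n)}
    (hV : IsOpen V) (hVχ : V ⊆ χ.target)
    (h0 : ∀ᵐ y ∂volume.restrict V,
      ∀ i, logGrad χ.target (fun z => φ₁ (χ.symm z)) (fun z => φ₂ (χ.symm z)) i y = 0)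
    {x : M} (hx : x ∈ χ.source) (hxV : χ x ∈ V) :
    ∀ᶠ z in 𝓝 x, Real.log (φ₁ z) - Real.log (φ₂ z) = Real.log (φ₁ x) - Real.log (φ₂ x) := by
  obtain ⟨r, hr, hrV⟩ := Metric.nhds_basis_closedBall.mem_iff.1 (hV.mem_nhds hxV)
  have hl := approx_log χ.open_target (isCompact_closedBall (χ x) r) (hrV.trans hVχ)
    (h₁.isW21 hχ) (h₂.isW21 hχ) (fun _ => h₁.pos _) (fun _ => h₂.pos _)
  have h0' : ∀ i, logGrad χ.target (fun z => φ₁ (χ.symm z)) (fun z => φ₂ (χ.symm z)) i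
      =ᵐ[volume.restrict (ball (χ x) r)] 0 := fun i => by
    filter_upwards [ae_restrict_of_ae_restrict_of_subset (ball_subset_closedBall.trans hrV) h0]
      with y hy using hy i
  filter_upwards [(χ.continuousAt hx).eventually (ball_mem_nhds (χ x) (half_pos hr)),
    χ.open_source.mem_nhds hx] with z hz hzs
  simpa only [χ.left_inv hx, χ.left_inv hzs] using hl.eq_of_gradient_eq_zero h0' hz

theorem IsPositiveSolution.eq [T2Space M] [ConnectedSpace M] (hn : 3 ≤ n) (hγ : MetricMemW2p p γ)
    (ha : AlmostEverywhere n (fun x => 0 ≤ a x)) (hq₁ : AlmostEverywhere n (fun x => 0 ≤ q₁ x))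
    (hbq : AlmostEverywhere n (fun x => 0 ≤ b x - q₂ x))
    (hne : NotIdenticallyZero n (fun x => a x + q₁ x + b x - q₂ x))
    (h₁ : IsPositiveSolution p γ a q₁ q₂ b φ₁) (h₂ : IsPositiveSolution p γ a q₁ q₂ b φ₂) :
    φ₁ = φ₂ := by
  obtain ⟨t, X, ρ, hX, hρ, hρX, hρ0, hsum⟩ := exists_finite_partition_of_unity n M
  have w₁ := h₁.isPositiveW2p
  have w₂ := h₂.isPositiveW2p
  have hB := fun k => chartBulk_nonneg hn ha hq₁ hbq h₁ h₂ (hX k)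
  have hB0 := chartBulk_eq_zero hγ w₁ w₂ hX hρ hρX hρ0 hsum
    fun k => (hB k).mono fun y hy => hy.1
  -- These are the coordinate images of the sets where `ρ k > 0`; the latter cover the manifold
  -- because the `ρ k` sum to one.
  set V : t → Set (Model n) := fun k => (X k).target ∩ (X k).symm ⁻¹' {x | 0 < ρ k x} with hVdef
  have hVo : ∀ k, IsOpen (V k) := fun k => (X k).isOpen_inter_preimage_symm
    (isOpen_lt continuous_const (hρ k).continuous)
  have hVX : ∀ k, V k ⊆ (X k).target := fun k => inter_subset_left
  have hV : ∀ k, ∀ᵐ y ∂volume.restrict (V k),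
      (∀ i, logGrad (X k).target (fun z => φ₁ ((X k).symm z)) (fun z => φ₂ ((X k).symm z)) i y = 0) ∧
      (0 < a ((X k).symm y) + q₁ ((X k).symm y) + b ((X k).symm y) - q₂ ((X k).symm y) →
        φ₁ ((X k).symm y) = φ₂ ((X k).symm y)) := fun k => by
    filter_upwards [ae_restrict_of_ae_restrict_of_subset (hVX k) (hB k),
      ae_restrict_of_ae_restrict_of_subset (hVX k) (hB0 k),
      ae_restrict_mem (hVo k).measurableSet] with y hy hy0 hyV
    exact hy.2 (hy0 hyV.2)
  have hex : ∀ x : M, ∃ k, x ∈ (X k).source ∧ 0 < ρ k x := fun x => by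
    obtain ⟨k, -, hk⟩ := Finset.exists_ne_zero_of_sum_ne_zero (by rw [hsum x]; exact one_ne_zero)
    exact ⟨k, hρX k (subset_tsupport _ hk), (hρ0 k x).lt_of_ne' hk⟩
  have hmem : ∀ {k x}, x ∈ (X k).source → 0 < ρ k x → X k x ∈ V k := fun {k x} hs hp =>
    ⟨(X k).map_source hs, by
      rw [mem_preimage, (X k).left_inv hs]; exact hp⟩
  have hlc : IsLocallyConstant fun x => Real.log (φ₁ x) - Real.log (φ₂ x) := by
    refine (IsLocallyConstant.iff_eventually_eq _).2 fun x => ?_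
    obtain ⟨k, hs, hp⟩ := hex x
    exact eventually_log_sub_log_eq w₁ w₂ (hX k) (hVo k) (hVX k)
      ((hV k).mono fun y hy => hy.1) hs (hmem hs hp)
  obtain ⟨U, hU, ⟨x, hx⟩, c, hc, hUc⟩ := hne
  obtain ⟨k, hs, hp⟩ := hex x
  have hWo : IsOpen (V k ∩ (X k).symm ⁻¹' U) :=
    ((X k).continuousOn_symm.mono (hVX k)).isOpen_inter_preimage (hVo k) hU
  have hW : (V k ∩ (X k).symm ⁻¹' U).Nonempty :=
    ⟨X k x, hmem hs hp, by simpa only [mem_preimage, (X k).left_inv hs] using hx⟩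
  -- A nonempty open set has positive Lebesgue measure, so the equality `φ₁ = φ₂`, valid almost
  -- everywhere on it, holds at some point.
  obtain ⟨z, hz⟩ : ∃ z, φ₁ z = φ₂ z := by
    have : NeZero (volume.restrict (V k ∩ (X k).symm ⁻¹' U)) :=
      ⟨fun h => (hWo.measure_pos volume hW).ne' (Measure.restrict_eq_zero.1 h)⟩
    have hae : ∀ᵐ y ∂volume.restrict (V k ∩ (X k).symm ⁻¹' U),
        φ₁ ((X k).symm y) = φ₂ ((X k).symm y) := by
      filter_upwards [ae_restrict_of_ae_restrict_of_subset inter_subset_left (hV k),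
        ae_restrict_of_ae_restrict_of_subset (inter_subset_left.trans (hVX k)) (hUc _ (hX k)),
        ae_restrict_mem hWo.measurableSet] with y hy hyc hyW
      exact hy.2 (hc.trans_le (hyc hyW.2))
    obtain ⟨y, hy⟩ := hae.exists
    exact ⟨_, hy⟩
  funext x
  -- On a connected space the locally constant `log φ₁ - log φ₂` equals its value at `z`, which is
  -- zero.
  have h := hlc.apply_eq_of_preconnectedSpace x z
  simp only [hz, sub_self] at h
  exact Real.log_injOn_pos (h₁.pos x) (h₂.pos x) (sub_eq_zero.1 h)

end Uniqueness

end Lichnerowicz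

end

theorem theorem4p9 (n : ℕ) (hn : 3 ≤ n)
    {M : Type*} [TopologicalSpace M] [T2Space M] [CompactSpace M] [ConnectedSpace M]
    [ChartedSpace (Lichnerowicz.Model n) M] [IsManifold (𝓡 n) ∞ M]
    (p : ℝ) (hp : (n : ℝ) / 2 < p)
    (γ : Lichnerowicz.ContMetric n M) (hγ : Lichnerowicz.MetricMemW2p p γ)
    (a q₁ q₂ b : M → ℝ)
    (ha : Lichnerowicz.MemL1 n a) (hq₁ : Lichnerowicz.MemL1 n q₁)
    (hq₂ : Lichnerowicz.MemL1 n q₂) (hb : Lichnerowicz.MemL1 n b)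
    (ha_nonneg : Lichnerowicz.AlmostEverywhere n (fun x => 0 ≤ a x))
    (hq₁_nonneg : Lichnerowicz.AlmostEverywhere n (fun x => 0 ≤ q₁ x))
    (hbq_nonneg : Lichnerowicz.AlmostEverywhere n (fun x => 0 ≤ b x - q₂ x))
    (hne : Lichnerowicz.NotIdenticallyZero n (fun x => a x + q₁ x + b x - q₂ x))
    (φ₁ φ₂ : M → ℝ)
    (h₁ : Lichnerowicz.IsPositiveSolution p γ a q₁ q₂ b φ₁)
    (h₂ : Lichnerowicz.IsPositiveSolution p γ a q₁ q₂ b φ₂) :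
    φ₁ = φ₂ := by
  exact h₁.eq hn hγ ha_nonneg hq₁_nonneg hbq_nonneg hne h₂
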